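/- Let $\overline M$ be a compact oriented 3-manifold whose boundary is a union of tori ("cusps"), decomposed into finitely many truncated tetrahedra glued in pairs along all their hexagonal faces; the truncation triangles give a (possibly non-simplicial) triangulation of $\partial\overline M$. A generalized angle structure $\theta$ assigns a real number to each pair of opposite edges of each tetrahedron so that the three numbers of each tetrahedron sum to $\pi$ and the numbers around each interior edge sum to $2\pi$; it is positive if all the numbers are $>0$, and taut if they all lie in $\{0,\pi\}$. Each corner of a boundary triangle inherits the number of the tetrahedron edge on which it lies. A taut angle structure is veering if for every vertex $v$ of $\partial\overline M$, either all triangles with angle $0$ at $v$ have their $\pi$-angle immediately before $v$ in the counterclockwise cyclic order, or all of them have it immediately after $v$. A normal closed curve $\gamma$ in $\partial\overline M$ is an oriented closed curve transverse to the edges that enters and leaves each triangle it crosses through different sides, so that each of its arcs cuts off one corner, to its left or to its right. Its turning angle is $t_\theta(\gamma)=\mathcal A_\gamma-\mathcal B_\gamma$, where $\mathcal A_\gamma$ (resp. $\mathcal B_\gamma$) is the sum of the angles cut off to the left (resp. right) of $\gamma$. The angular holonomy of $\theta$ is the linear functional $h_\theta$ on $H_1(\partial\overline M;\mathbb Z)$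 such that $h_\theta([\gamma])=t_\theta(\gamma)$ for every embedded, homologically non-trivial normal closed curve $\gamma$ in a component of $\partial\overline M$. The leading-trailing deformation $D^\gamma$ of a normal closed curve $\gamma$ is the vector that has, for each crossing of $\gamma$ with an edge $e$ of $\partial\overline M$, a contribution $+1$ at the angle opposite to $e$ in the triangle entered and $-1$ at the angle opposite to $e$ in the triangle left. Let $\theta_{\mathrm{taut}}$ be a veering taut angle structure. Then: 1. The angular holonomy of $\theta_{\mathrm{taut}}$ vanishes on every cusp: $h_{\theta_{\mathrm{taut}}}=0$. That is, $t_{\theta_{\mathrm{taut}}}(\gamma)=0$ for every embedded, homologically non-trivial normal closed curve $\gamma$ in $\partial\overline M$. 2. Consequently, $h_{\theta'}=0$ for every $\theta'=\theta_{\mathrm{taut}}+\sum_{k=1}^m r_k D^{\gamma_k}$ with $m\ge 0$, real numbers $r_k$ and homologically trivial normal closed curves $\gamma_k$ (not necessarily embedded). In particular, every positive angle structure obtained from $\theta_{\mathrm{taut}}$ by leading-trailing deformations along homologically trivial curves has zero angular holonomy. -/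

import Mathlib

open Finset

/-! ## Triangulated oriented closed surfaces, by their corners

A (possibly non-simplicial) triangulated oriented surface is described by the set `C` of corners of
its triangles. A corner `c` also names the side opposite to `c` of its triangle. -/

/-- `rot c` is the corner following `c` counterclockwise in its triangle, so that the triangle has
corners `c, rot c, rot (rot c)`, and its side `c` (the one opposite to the corner `c`) runs from
`rot c` to `rot (rot c)` in the boundary orientation. `glue c` is the side to which the side `c`
is glued, reversing the boundary orientations. -/
structure TriangulatedSurface (C : Type*) where
  rot : Equiv.Perm C
  rot_rot_rot : ∀ c, rot (rot (rot c)) = c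
  rot_ne : ∀ c, rot c ≠ c
  glue : Equiv.Perm C
  glue_glue : ∀ c, glue (glue c) = c
  glue_ne : ∀ c, glue c ≠ c

namespace TriangulatedSurface

variable {C : Type*} (S : TriangulatedSurface C)

/-- The corner following `c` counterclockwise around the vertex of the surface at which `c` lies:
cross the side that joins the vertex of `c` to that of `rot (rot c)`. The cycles of this
permutation are the vertices of the surface. -/
def vertexRot : Equiv.Perm C := S.rot * S.glue * S.rot

/-- Cellular `1`-cycles of the dual cell decomposition (one `0`-cell in each triangle, one `1`-cell
across each side, one `2`-cell around each vertex): `x s` is the coefficient of the dual `1`-cell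
that leaves through the side `s` the triangle of `s`. -/
def oneCycles : Submodule ℤ (C → ℤ) where
  carrier := {x | (∀ s, x (S.glue s) = -x s) ∧
    ∀ s, x s + x (S.rot s) + x (S.rot (S.rot s)) = 0}
  add_mem' := by
    rintro x y ⟨h1, h2⟩ ⟨h3, h4⟩
    refine ⟨fun s => ?_, fun s => ?_⟩
    · simp only [Pi.add_apply, h1, h3]; ring
    · have := h2 s; have := h4 s; simp only [Pi.add_apply]; linarith
  zero_mem' := by simp
  smul_mem' := by
    rintro a x ⟨h1, h2⟩
    refine ⟨fun s => ?_, fun s => ?_⟩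
    · simp [h1]
    · have := h2 s
      simp only [Pi.smul_apply, smul_eq_mul]
      linear_combination a * this

/-- Cellular `2`-chains of the dual cell decomposition: a coefficient for each vertex. -/
def twoChains : Submodule ℤ (C → ℤ) where
  carrier := {f | ∀ c, f (S.vertexRot c) = f c}
  add_mem' := by intro f g hf hg c; simp [hf c, hg c]
  zero_mem' := by intro c; simp
  smul_mem' := by intro a f hf c; simp [hf c]

/-- The boundary map of the dual cell decomposition. The dual `2`-cell around a vertex is bounded
by the counterclockwise loop around that vertex, which leaves through `s` the triangle of `s` if
the end `rot (rot s)` of `s` is at the vertex, and enters it through `s` if the start `rot s` is. -/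
def boundaryMap : S.twoChains →ₗ[ℤ] S.oneCycles where
  toFun f := ⟨fun s => f.1 (S.rot (S.rot s)) - f.1 (S.rot s), by
    have hf : ∀ c, f.1 (S.rot (S.glue (S.rot c))) = f.1 c := f.2
    have key : ∀ s, f.1 (S.rot (S.glue s)) = f.1 (S.rot (S.rot s)) := fun s => by
      have := hf (S.rot (S.rot s)); rwa [S.rot_rot_rot] at this
    refine ⟨fun s => ?_, fun s => ?_⟩
    · have h1 := key s
      have h2 := key (S.glue s)
      rw [S.glue_glue] at h2
      simp only [h1, ← h2]; ring
    · simp only [S.rot_rot_rot]; ring⟩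
  map_add' f g := by ext s; simp; ring
  map_smul' a f := by ext s; simp; ring

/-- The first homology group of the surface with integer coefficients. -/
abbrev H1 : Type _ := S.oneCycles ⧸ LinearMap.range S.boundaryMap

/-- A closed oriented normal path, not necessarily embedded, up to normal homotopy: a cyclic
sequence of `len` oriented arcs. The `i`-th arc crosses a triangle, entering and leaving it through
different sides and thus cutting off the corner `corner i`, which is to its left if
`left i = true` and to its right if `left i = false`. -/
structure ClosedNormalPath where
  len : ℕ
  len_pos : NeZero len
  corner : ZMod len → C
  left : ZMod len → Bool
  /-- Each arc starts on the edge where the preceding one ends. -/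
  next : ∀ i,
    (if left (i + 1) then S.rot (S.rot (corner (i + 1))) else S.rot (corner (i + 1))) =
      S.glue (if left i then S.rot (corner i) else S.rot (S.rot (corner i)))

namespace ClosedNormalPath

variable {S} (γ : S.ClosedNormalPath)

instance : NeZero γ.len := γ.len_pos

/-- The side through which the `i`-th arc enters its triangle. -/
def enter (i : ZMod γ.len) : C :=
  if γ.left i then S.rot (S.rot (γ.corner i)) else S.rot (γ.corner i)

/-- The side through which the `i`-th arc leaves its triangle. -/
def exit (i : ZMod γ.len) : C :=
  if γ.left i then S.rot (γ.corner i) else S.rot (S.rot (γ.corner i))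

/-- The sum of the angles cut off to the left of the path, for angles `α` at the corners. -/
noncomputable def leftSum (α : C → ℝ) : ℝ := ∑ i, if γ.left i then α (γ.corner i) else 0

/-- The sum of the angles cut off to the right of the path. -/
noncomputable def rightSum (α : C → ℝ) : ℝ := ∑ i, if γ.left i then 0 else α (γ.corner i)

/-- The turning angle of the path. -/
noncomputable def turning (α : C → ℝ) : ℝ := γ.leftSum α - γ.rightSum α

/-- Given the position `a i ∈ (0, 1)` at which the `i`-th arc enters its triangle, measured along
the side `enter i` from its start in the boundary orientation (so that the `i`-th arc ends at the
position `1 - a (i + 1)` of the side `exit i`): the distance to `corner i` of the end of the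
`i`-th arc on the side from `corner i` to `rot (corner i)`. -/
def distRot (a : ZMod γ.len → ℝ) (i : ZMod γ.len) : ℝ :=
  if γ.left i then a i else 1 - a (i + 1)

/-- The distance to `corner i` of the end of the `i`-th arc on the side from `corner i` to
`rot (rot (corner i))`. -/
def distRotRot (a : ZMod γ.len → ℝ) (i : ZMod γ.len) : ℝ :=
  if γ.left i then a (i + 1) else 1 - a i

/-- The path can be drawn as an embedded closed curve: the crossings with the edges can be so
placed that the arcs, drawn as chords, are pairwise disjoint. Two arcs that cut off the same corner
of a triangle are disjoint if one is closer to the corner on both sides; arcs that cut off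
two different corners `c` and `rot c` are disjoint if they do not overlap on the side
between these corners. -/
def IsEmbedded : Prop :=
  ∃ a : ZMod γ.len → ℝ, (∀ i, 0 < a i ∧ a i < 1) ∧
    (∀ i j, i ≠ j → γ.corner i = γ.corner j →
      (γ.distRot a i < γ.distRot a j ∧ γ.distRotRot a i < γ.distRotRot a j) ∨
      (γ.distRot a j < γ.distRot a i ∧ γ.distRotRot a j < γ.distRotRot a i)) ∧
    (∀ i j, γ.corner j = S.rot (γ.corner i) → γ.distRot a i + γ.distRotRot a j < 1)

/-- The `1`-cycle carried by the path: the number of times that it leaves through the side `s`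
the triangle of `s`, minus the number of times that it enters it through `s`. -/
def cycle [DecidableEq C] : S.oneCycles :=
  ⟨fun s => ∑ i, ((if γ.exit i = s then 1 else 0) - (if γ.enter i = s then 1 else 0)), by
    have hnext : ∀ i, γ.enter (i + 1) = S.glue (γ.exit i) := γ.next
    constructor
    · intro s
      have h : ∀ s, (∑ i, if γ.enter i = S.glue s then (1 : ℤ) else 0) =
          ∑ i, if γ.exit i = s then (1 : ℤ) else 0 := by
        intro s
        rw [← Equiv.sum_comp (Equiv.addRight (1 : ZMod γ.len))]
        refine Finset.sum_congr rfl fun i _ => ?_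
        simp only [Equiv.coe_addRight, hnext, EmbeddingLike.apply_eq_iff_eq]
      have h1 := h s
      have h2 := h (S.glue s)
      rw [S.glue_glue] at h2
      simp only [Finset.sum_sub_distrib, h1, h2]
      ring
    · intro s
      rw [← Finset.sum_add_distrib, ← Finset.sum_add_distrib]
      refine Finset.sum_eq_zero fun i _ => ?_
      have hs := S.rot_rot_rot
      have key : ∀ c, (if S.rot c = s then (1 : ℤ) else 0) +
          (if S.rot c = S.rot s then 1 else 0) + (if S.rot c = S.rot (S.rot s) then 1 else 0) =
          (if S.rot (S.rot c) = s then 1 else 0) + (if S.rot (S.rot c) = S.rot s then 1 else 0) +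
          (if S.rot (S.rot c) = S.rot (S.rot s) then 1 else 0) := by
        intro c
        have e1 : S.rot c = s ↔ S.rot (S.rot c) = S.rot s := S.rot.apply_eq_iff_eq.symm
        have e2 : S.rot c = S.rot s ↔ S.rot (S.rot c) = S.rot (S.rot s) :=
          S.rot.apply_eq_iff_eq.symm
        have e3 : S.rot c = S.rot (S.rot s) ↔ S.rot (S.rot c) = s := by
          rw [← S.rot.apply_eq_iff_eq, hs]
        simp only [e1, e2, e3]
        ring
      have k := key (γ.corner i)
      unfold exit enter
      split_ifs at k ⊢ <;> linarith⟩

/-- The homology class of the path. -/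
def homologyClass [DecidableEq C] : S.H1 := Submodule.Quotient.mk γ.cycle

end ClosedNormalPath

/-- `h : H₁ → ℝ` is the angular holonomy for the angles `α` at the corners: the linear functional
whose value at the class of any homologically non-trivial, embedded, oriented, normal closed
curve is the turning angle of this curve. -/
def IsAngularHolonomy [DecidableEq C] (α : C → ℝ) (h : S.H1 →ₗ[ℤ] ℝ) : Prop :=
  ∀ γ : S.ClosedNormalPath, γ.IsEmbedded → γ.homologyClass ≠ 0 →
    h γ.homologyClass = γ.turning α

end TriangulatedSurface

/-! ## Oriented ideal triangulations -/

/-- Oriented tetrahedra, indexed by `T`, with vertices `0, 1, 2, 3`, glued in pairs along all their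
faces. The face `f` (opposite to the vertex `f`) of the tetrahedron `t` is glued to the face
`perm t f f` of `nbr t f`, each vertex `v ≠ f` of it to the vertex `perm t f v`. All these gluings
reverse the orientation, so that the orientations of the tetrahedra agree. -/
structure IdealTriangulation (T : Type*) where
  nbr : T → Fin 4 → T
  perm : T → Fin 4 → Equiv.Perm (Fin 4)
  sign_perm : ∀ t f, Equiv.Perm.sign (perm t f) = -1
  nbr_nbr : ∀ t f, nbr (nbr t f) (perm t f f) = t
  perm_nbr : ∀ t f, perm (nbr t f) (perm t f f) = (perm t f)⁻¹
  no_self_gluing : ∀ t f, ¬ (nbr t f = t ∧ perm t f f = f)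

namespace IdealTriangulation

/-- For `v ≠ w`, the vertex `x` such that `(v, w, x, y)` is an even permutation of `(0, 1, 2, 3)`
for the fourth vertex `y`. So `w ↦ nxt v w` is the counterclockwise order of the corners of
the triangle that truncates the tip `v` of an oriented tetrahedron. -/
def nxt (v w : Fin 4) : Fin 4 :=
  ![![0, 2, 3, 1], ![3, 1, 0, 2], ![1, 3, 2, 0], ![2, 0, 1, 3]] v w

/-- The three pairs of opposite edges of a tetrahedron are indexed by `Fin 3`; this is the index
of the pair that contains the edge `vw`, for `v ≠ w`. -/
def pairIdx (v w : Fin 4) : Fin 3 :=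
  ![![0, 0, 1, 2], ![0, 0, 2, 1], ![1, 2, 0, 0], ![2, 1, 0, 0]] v w

/-- Corners of boundary triangles: `(t, v, w)` with `v ≠ w` is the corner, on the edge `vw`, of the
triangle that truncates the tip `v` of the tetrahedron `t`. The opposite side of this triangle
lies in the face opposite to `w`. -/
abbrev Corner (T : Type*) : Type _ := T × {p : Fin 4 × Fin 4 // p.1 ≠ p.2}

variable {T : Type*} (τ : IdealTriangulation T)

theorem nxt_ne : ∀ v w : Fin 4, v ≠ w → v ≠ nxt v w := by decide

theorem nxt_nxt_nxt : ∀ v w : Fin 4, v ≠ w → nxt v (nxt v (nxt v w)) = w := by decide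

theorem nxt_ne_right : ∀ v w : Fin 4, v ≠ w → nxt v w ≠ w := by decide

/-- The next corner counterclockwise in the same boundary triangle. -/
def cornerRot (c : Corner T) : Corner T :=
  (c.1, ⟨(c.2.1.1, nxt c.2.1.1 c.2.1.2), nxt_ne _ _ c.2.2⟩)

theorem cornerRot_cornerRot_cornerRot (c : Corner T) :
    cornerRot (cornerRot (cornerRot c)) = c := by
  obtain ⟨t, ⟨⟨v, w⟩, h⟩⟩ := c
  simp [cornerRot, nxt_nxt_nxt v w h]

/-- The side of a boundary triangle to which a given side is glued. -/
def cornerGlue (c : Corner T) : Corner T :=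
  (τ.nbr c.1 c.2.1.2,
    ⟨(τ.perm c.1 c.2.1.2 c.2.1.1, τ.perm c.1 c.2.1.2 c.2.1.2), by simpa using c.2.2⟩)

theorem cornerGlue_cornerGlue (c : Corner T) : τ.cornerGlue (τ.cornerGlue c) = c := by
  obtain ⟨t, ⟨⟨v, w⟩, h⟩⟩ := c
  simp [cornerGlue, τ.nbr_nbr, τ.perm_nbr]

/-- The triangulated boundary of the compact manifold glued from the truncated tetrahedra. -/
def boundary : TriangulatedSurface (Corner T) where
  rot := ⟨cornerRot, fun c => cornerRot (cornerRot c),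
    cornerRot_cornerRot_cornerRot, cornerRot_cornerRot_cornerRot⟩
  rot_rot_rot := cornerRot_cornerRot_cornerRot
  rot_ne := by
    rintro ⟨t, ⟨⟨v, w⟩, h⟩⟩ he
    simp only [Equiv.coe_fn_mk, cornerRot, Prod.mk.injEq, Subtype.mk.injEq] at he
    exact nxt_ne_right v w h he.2.2
  glue := ⟨τ.cornerGlue, τ.cornerGlue, τ.cornerGlue_cornerGlue, τ.cornerGlue_cornerGlue⟩
  glue_glue := τ.cornerGlue_cornerGlue
  glue_ne := by
    rintro ⟨t, ⟨⟨v, w⟩, h⟩⟩ he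
    simp only [Equiv.coe_fn_mk, cornerGlue, Prod.mk.injEq, Subtype.mk.injEq] at he
    exact τ.no_self_gluing t w ⟨he.1, he.2.2⟩

/-- The angle at a corner of the boundary, for an angle `θ t j` at each pair `j` of opposite edges
of each tetrahedron `t`. -/
def cornerAngle (θ : T → Fin 3 → ℝ) (c : Corner T) : ℝ := θ c.1 (pairIdx c.2.1.1 c.2.1.2)

/-- Generalized angle structures. The second equation is stated for the angles around each vertex
of the boundary, that is, around the interior edge that ends there. -/
def IsGeneralizedAngleStructure [Fintype T] [DecidableEq T] (θ : T → Fin 3 → ℝ) : Prop :=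
  (∀ t, ∑ j, θ t j = Real.pi) ∧
  ∀ c : Corner T, ∑ d with τ.boundary.vertexRot.SameCycle c d, cornerAngle θ d = 2 * Real.pi

/-- Taut angle structures. -/
def IsTaut [Fintype T] [DecidableEq T] (θ : T → Fin 3 → ℝ) : Prop :=
  τ.IsGeneralizedAngleStructure θ ∧ ∀ t j, θ t j = 0 ∨ θ t j = Real.pi

/-- Veering taut angle structures: for every vertex of the boundary (given by a corner `c` at it),
either all the triangles with angle `0` at this vertex have their angle `π` immediately before this
vertex in the counterclockwise order, or all of them have it immediately after. -/
def IsVeering [Fintype T] [DecidableEq T] (θ : T → Fin 3 → ℝ) : Prop :=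
  τ.IsTaut θ ∧ ∀ c : Corner T,
    (∀ d, τ.boundary.vertexRot.SameCycle c d → cornerAngle θ d = 0 →
      cornerAngle θ (τ.boundary.rot (τ.boundary.rot d)) = Real.pi) ∨
    (∀ d, τ.boundary.vertexRot.SameCycle c d → cornerAngle θ d = 0 →
      cornerAngle θ (τ.boundary.rot d) = Real.pi)

/-- The vector that has entry `1` at the angle of the tetrahedron found at the corner `c`, and `0`
at all other angles. -/
def angleVec [DecidableEq T] (c : Corner T) : T → Fin 3 → ℝ :=
  fun t j => if c.1 = t ∧ pairIdx c.2.1.1 c.2.1.2 = j then 1 else 0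

/-- The leading-trailing deformation `D^γ`: for each crossing of `γ` with an edge of the boundary,
add `1` to the angle opposite to this edge in the triangle entered, and subtract `1` from the angle
opposite to it in the triangle left (recall that a side is named by the opposite corner). -/
noncomputable def leadingTrailing [DecidableEq T] (γ : τ.boundary.ClosedNormalPath) :
    T → Fin 3 → ℝ :=
  ∑ i, (angleVec (γ.enter (i + 1)) - angleVec (γ.exit i))

/-- The angle vectors that are obtained from `θ` by finitely many leading-trailing deformations,
with real coefficients, along homologically trivial closed normal paths. Loops around vertices of
the boundary are such paths, so the common deformation `D^ε` of the two ends of an interior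
edge `ε` is included. -/
inductive TrivialDeformation [DecidableEq T] (θ : T → Fin 3 → ℝ) : (T → Fin 3 → ℝ) → Prop
  | refl : TrivialDeformation θ θ
  | step (θ' : T → Fin 3 → ℝ) (γ : τ.boundary.ClosedNormalPath) (r : ℝ) :
      TrivialDeformation θ θ' → γ.homologyClass = 0 →
      TrivialDeformation θ (θ' + r • τ.leadingTrailing γ)

/-- `h` is the angular holonomy of the angle vector `θ` on the boundary. -/
def IsAngularHolonomy [DecidableEq T] (θ : T → Fin 3 → ℝ) (h : τ.boundary.H1 →ₗ[ℤ] ℝ) : Prop :=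
  τ.boundary.IsAngularHolonomy (cornerAngle θ) h

end IdealTriangulation

/-! For the deformations: the cycle of a null-homologous path is the boundary of an integer function
`f` on the vertices of the boundary surface, that is, on the ends of the interior edges. Write
`E(xy)` for the sum of `f` over the two ends of the edge `xy` of a tetrahedron. To the side at the
tip `v` in the face `vab` assign `E(ab) - E(va) - E(vb)`. Glued sides get equal values, and the
deformation changes each corner angle by the difference of the values at two sides of its triangle.
So its effect on any turning angle telescopes to zero (`turning_leadingTrailing`), and the second
claim reduces to the first.

For the veering structure: the two alternatives of the veering condition colour the vertices. Each
triangle has one corner `π` and exactly one side with ends of the same colour. Glued along their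
other two sides, the triangles form ladders with monochromatic poles, and crossing a pole reverses
the upward direction. After a direction is attached to each triangle, the ladders unroll into
vertical strips of a plane, with column numbers in `ℤ` and heights in `ℝ`. A further coordinate, in
the functions on the sides modulo boundaries, records homology (`Veering.ladderSystem`,
`exists_heights`, `toLadderSystem`).

An embedded path with non-zero class lifts to this covering. It returns with its original direction,
because a closed path crosses an even number of poles (`Reaches.eq_false`). So the lift is invariant
under a translation. The planar part of the translation is not zero: otherwise the lift would close
up, and the homology coordinate would show that the class is zero. Hence the lift is embedded as
well.

For such a periodic path a discrete form of Hopf's Umlaufsatz holds (`umlaufsatz`). For each `i`,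
count with signs the crossings of the path from its arc `i` onwards with the curve that runs from
the start of the arc `i` to the left, along the side entered, up to a vertex, and then along a
vertical ray to infinity. Embeddedness makes the change of this count from `i` to `i + 1` a local
term, and by periodicity the local terms of one period add up to zero. By `turn_eq`, four times the
local term is the turning of the arc in units of `π / 2`, up to a change of direction, which also
telescopes over a period (`sum_straight_eq_zero`). -/

set_option linter.unusedSimpArgs false

/-! ### Turning angles and cycles as sums along a path -/

namespace TriangulatedSurface
variable {C : Type*} {S : TriangulatedSurface C}

namespace ClosedNormalPath
variable (γ : S.ClosedNormalPath)

theorem enter_succ (i : ZMod γ.len) : γ.enter (i + 1) = S.glue (γ.exit i) := γ.next i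

theorem turning_eq_sum (α : C → ℝ) :
    γ.turning α = ∑ i, if γ.left i then α (γ.corner i) else -α (γ.corner i) := by
  unfold turning leftSum rightSum
  rw [← Finset.sum_sub_distrib]
  refine Finset.sum_congr rfl fun i _ => ?_
  split_ifs <;> simp

theorem turning_add (α β : C → ℝ) : γ.turning (α + β) = γ.turning α + γ.turning β := by
  simp only [turning_eq_sum, ← Finset.sum_add_distrib]
  refine Finset.sum_congr rfl fun i _ => ?_
  split_ifs <;> simp; ring

theorem turning_smul (r : ℝ) (α : C → ℝ) : γ.turning (r • α) = r * γ.turning α := by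
  simp only [turning_eq_sum, Finset.mul_sum]
  refine Finset.sum_congr rfl fun i _ => ?_
  split_ifs <;> simp

/-- The turning angle vanishes if the angles are the differences of a function of the edges. -/
theorem turning_eq_zero_of_potential (α Q : C → ℝ) (hQ : ∀ s, Q (S.glue s) = Q s)
    (hα : ∀ c, α c = Q (S.rot c) - Q (S.rot (S.rot c))) : γ.turning α = 0 := by
  have h : ∀ i, (if γ.left i then α (γ.corner i) else -α (γ.corner i)) =
      Q (γ.exit i) - Q (γ.enter i) := by
    intro i
    unfold exit enter
    split_ifs <;> simp [hα]
  rw [turning_eq_sum, Finset.sum_congr rfl fun i _ => h i, Finset.sum_sub_distrib,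
    ← Equiv.sum_comp (Equiv.addRight (1 : ZMod γ.len)) fun i => Q (γ.enter i)]
  simp [enter_succ, hQ]

theorem exists_twoChain [DecidableEq C] (h : γ.homologyClass = 0) :
    ∃ f : C → ℤ, (∀ c, f (S.vertexRot c) = f c) ∧
      ∀ s, γ.cycle.1 s = f (S.rot (S.rot s)) - f (S.rot s) := by
  obtain ⟨f, hf⟩ := (Submodule.Quotient.mk_eq_zero _).1 h
  exact ⟨f.1, f.2, fun s => by rw [← hf]; rfl⟩

/-- A sum along the path is a sum over the sides, weighted by the cycle of the path. -/
theorem sum_exit_sub_enter [DecidableEq C] [Fintype C] (F : C → ℝ) :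
    ∑ i, (F (γ.exit i) - F (γ.enter i)) = ∑ s, (γ.cycle.1 s : ℝ) * F s := by
  have : ∀ s, (γ.cycle.1 s : ℝ) * F s =
      ∑ i, (if γ.exit i = s then F s else 0) - ∑ i, (if γ.enter i = s then F s else 0) := by
    intro s
    rw [← Finset.sum_sub_distrib]
    simp only [cycle]
    push_cast
    rw [Finset.sum_mul]
    refine Finset.sum_congr rfl fun i _ => ?_
    split_ifs <;> simp
  simp only [this, Finset.sum_sub_distrib]
  rw [Finset.sum_comm, Finset.sum_comm (s := univ (α := C))]
  simp

end ClosedNormalPath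
end TriangulatedSurface

/-! ### Leading-trailing deformations along null-homologous paths -/

namespace IdealTriangulation
variable {T : Type*} (τ : IdealTriangulation T)

/-- The value at the edge `vw` of a function of the ends of the edges of a tetrahedron. -/
def edgeSum (f : Corner T → ℝ) (t : T) (v w : Fin 4) : ℝ :=
  if h : v ≠ w then f (t, ⟨(v, w), h⟩) + f (t, ⟨(w, v), h.symm⟩) else 0

/-- The sum over the ends of a pair of opposite edges of a tetrahedron. -/
def pairSum [Fintype T] [DecidableEq T] (f : Corner T → ℝ) (t : T) (j : Fin 3) : ℝ :=
  ∑ c : Corner T, if c.1 = t ∧ pairIdx c.2.1.1 c.2.1.2 = j then f c else 0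

/-- The potential at the side of a boundary triangle that lies in a face of a tetrahedron. -/
def sidePotential (f : Corner T → ℝ) (c : Corner T) : ℝ :=
  let v := c.2.1.1
  let a := nxt v c.2.1.2
  let b := nxt v a
  edgeSum f c.1 a b - edgeSum f c.1 v a - edgeSum f c.1 v b

theorem edgeSum_comm (f : Corner T → ℝ) (t : T) (v w : Fin 4) :
    edgeSum f t v w = edgeSum f t w v := by
  unfold edgeSum
  by_cases h : v = w
  · subst h; rfl
  · rw [dif_pos h, dif_pos (Ne.symm h), add_comm]

theorem pairSum_pairIdx [Fintype T] [DecidableEq T] (f : Corner T → ℝ) (t : T) :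
    pairSum f t 0 = edgeSum f t 0 1 + edgeSum f t 2 3 ∧
    pairSum f t 1 = edgeSum f t 0 2 + edgeSum f t 1 3 ∧
    pairSum f t 2 = edgeSum f t 0 3 + edgeSum f t 1 2 := by
  have h : ∀ j, pairSum f t j = ∑ v : Fin 4, ∑ w : Fin 4,
      if h : v ≠ w then (if pairIdx v w = j then f (t, ⟨(v, w), h⟩) else 0) else 0 := by
    intro j
    unfold pairSum
    rw [Fintype.sum_prod_type, Finset.sum_eq_single t]
    · rw [← Fintype.sum_prod_type' (f := fun v w : Fin 4 => if h : v ≠ w then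
        (if pairIdx v w = j then f (t, ⟨(v, w), h⟩) else 0) else 0),
        ← Finset.sum_filter_of_ne (p := fun p : Fin 4 × Fin 4 => p.1 ≠ p.2)
          (fun p _ hp hne => hp (by simp [hne])),
        Finset.sum_subtype (p := fun p : Fin 4 × Fin 4 => p.1 ≠ p.2) _ (by simp)]
      refine Finset.sum_congr rfl fun p _ => ?_
      simp [p.2]
    · intro t' _ ht
      simp [ht]
    · simp
  simp only [h]
  refine ⟨?_, ?_, ?_⟩ <;>
  · simp [Fin.sum_univ_four, pairIdx, edgeSum]
    try ring

theorem pairIdx_nxt : ∀ v w : Fin 4, v ≠ w → pairIdx v (nxt v w) = pairIdx v w + 1 := by decide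

/-- The two faces on the right share the edge of the corner `c`. Its term cancels, and the four
remaining edge sums regroup into the two other pairs of opposite edges. -/
theorem pairSum_sub_eq [Fintype T] [DecidableEq T] (f : Corner T → ℝ) (c : Corner T) :
    pairSum f c.1 (pairIdx c.2.1.1 c.2.1.2 + 1) - pairSum f c.1 (pairIdx c.2.1.1 c.2.1.2 + 2) =
      sidePotential f (cornerRot c) - sidePotential f (cornerRot (cornerRot c)) := by
  obtain ⟨t, ⟨⟨v, w⟩, h⟩⟩ := c
  obtain ⟨h0, h1, h2⟩ := pairSum_pairIdx f t
  have e := edgeSum_comm f t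
  fin_cases v <;> fin_cases w <;>
    simp [sidePotential, cornerRot, pairIdx, nxt, h0, h1, h2] at h ⊢ <;>
    linarith [e 0 1, e 0 2, e 0 3, e 1 2, e 1 3, e 2 3]

/-- An odd gluing reverses the cyclic order of the corners at a tip. -/
theorem nxt_odd : ∀ σ : Equiv.Perm (Fin 4), Equiv.Perm.sign σ = -1 → ∀ v w : Fin 4, v ≠ w →
    nxt (σ v) (σ (nxt v w)) = σ w := by decide

/-- The two corners lie at the same vertex of the boundary, on either side of the side in the face
opposite to `w`. So one is the `vertexRot` of the other; which one depends on the cyclic order of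
`w` and `x` around `v`. -/
theorem vertexFun_glue {R : Type*} {f : Corner T → R}
    (hf : ∀ c, f (τ.boundary.vertexRot c) = f c) (t : T) (w v x : Fin 4) (hvw : v ≠ w) (hxw : x ≠ w)
    (hvx : v ≠ x) :
    f (τ.nbr t w, ⟨(τ.perm t w v, τ.perm t w x), by simpa using hvx⟩) = f (t, ⟨(v, x), hvx⟩) := by
  have key : ∀ c : Corner T, f (cornerRot (τ.cornerGlue (cornerRot c))) = f c := hf
  have cases : ∀ v w x : Fin 4, v ≠ w → x ≠ w → v ≠ x → x = nxt v w ∨ w = nxt v x := by decide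
  rcases cases v w x hvw hxw hvx with h | h
  · have h4 : cornerRot (τ.nbr t w, (⟨(τ.perm t w v, τ.perm t w x), by simpa using hvx⟩ :
        {p : Fin 4 × Fin 4 // p.1 ≠ p.2})) = τ.cornerGlue (t, ⟨(v, w), hvw⟩) := by
      subst h
      simp only [cornerRot, cornerGlue, Prod.mk.injEq, Subtype.mk.injEq, true_and]
      exact nxt_odd _ (τ.sign_perm t w) v w hvw
    rw [← key (τ.nbr t w, _), h4, τ.cornerGlue_cornerGlue]
    subst h; rfl
  · have h4 : cornerRot (τ.cornerGlue (cornerRot (t, ⟨(v, x), hvx⟩))) =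
        (τ.nbr t w, ⟨(τ.perm t w v, τ.perm t w x), by simpa using hvx⟩) := by
      subst h
      simp only [cornerRot, cornerGlue, Prod.mk.injEq, Subtype.mk.injEq, true_and]
      exact nxt_odd _ (τ.sign_perm t _) v x hvx
    rw [← key (t, _), h4]

theorem edgeSum_glue {f : Corner T → ℝ}
    (hf : ∀ c, f (τ.boundary.vertexRot c) = f c) (t : T) (w v x : Fin 4) (hvw : v ≠ w)
    (hxw : x ≠ w) :
    edgeSum f (τ.nbr t w) (τ.perm t w v) (τ.perm t w x) = edgeSum f t v x := by
  unfold edgeSum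
  by_cases h : v = x
  · simp [h]
  · have h' : τ.perm t w v ≠ τ.perm t w x := by simpa using h
    rw [dif_pos h, dif_pos h', vertexFun_glue τ hf t w v x hvw hxw h,
      vertexFun_glue τ hf t w x v hxw hvw (Ne.symm h)]

theorem sidePotential_glue {f : Corner T → ℝ}
    (hf : ∀ c, f (τ.boundary.vertexRot c) = f c) (c : Corner T) :
    sidePotential f (τ.boundary.glue c) = sidePotential f c := by
  obtain ⟨t, ⟨⟨v, w⟩, h⟩⟩ := c
  have h1 := nxt_odd _ (τ.sign_perm t w) v (nxt v (nxt v w)) (nxt_ne _ _ (nxt_ne _ _ h))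
  have h2 := nxt_odd _ (τ.sign_perm t w) v (nxt v w) (nxt_ne _ _ h)
  rw [nxt_nxt_nxt v w h] at h1
  have n1 : nxt v w ≠ w := nxt_ne_right v w h
  have n2 : nxt v (nxt v w) ≠ w := fun e => n1 (by
    have := nxt_nxt_nxt v w h
    rw [e] at this
    exact this)
  change sidePotential f (τ.cornerGlue (t, ⟨(v, w), h⟩)) = _
  simp only [sidePotential, cornerGlue, h1, h2]
  rw [edgeSum_glue τ hf t w _ _ n2 n1, edgeSum_glue τ hf t w _ _ h n2,
    edgeSum_glue τ hf t w _ _ h n1, edgeSum_comm f t (nxt v (nxt v w))]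
  ring

theorem leadingTrailing_apply [DecidableEq T] (γ : τ.boundary.ClosedNormalPath) (t : T)
    (j : Fin 3) : τ.leadingTrailing γ t j =
      -∑ i, (angleVec (γ.exit i) t j - angleVec (γ.enter i) t j) := by
  unfold leadingTrailing
  simp only [Finset.sum_apply, Pi.sub_apply, Finset.sum_sub_distrib]
  have := Equiv.sum_comp (Equiv.addRight (1 : ZMod γ.len)) fun i => angleVec (γ.enter i) t j
  simp only [Equiv.coe_addRight] at this
  rw [this]
  ring

/-- A leading-trailing deformation along a homologically trivial path does not change the turning
angle of any closed normal path. -/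
theorem turning_leadingTrailing [Fintype T] [DecidableEq T] (γ γ' : τ.boundary.ClosedNormalPath)
    (h : γ.homologyClass = 0) : γ'.turning (cornerAngle (τ.leadingTrailing γ)) = 0 := by
  obtain ⟨f, hf, hx⟩ := γ.exists_twoChain h
  let F : Corner T → ℝ := fun c => f c
  have hF : ∀ c, F (τ.boundary.vertexRot c) = F c := fun c => by simp [F, hf c]
  refine γ'.turning_eq_zero_of_potential _ (sidePotential F) (sidePotential_glue τ hF) fun c => ?_
  have e := pairSum_sub_eq F c
  change _ = sidePotential F (cornerRot c) - sidePotential F (cornerRot (cornerRot c))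
  rw [← e]
  have r1 : ∀ d : Corner T, angleVec (cornerRot d) c.1 (pairIdx c.2.1.1 c.2.1.2) =
      if d.1 = c.1 ∧ pairIdx d.2.1.1 d.2.1.2 = pairIdx c.2.1.1 c.2.1.2 + 2 then 1 else 0 := by
    intro d
    have : ∀ a b : Fin 3, a + 1 = b ↔ a = b + 2 := by decide
    simp only [angleVec, cornerRot, pairIdx_nxt _ _ d.2.2, this]
  have r2 : ∀ d : Corner T, angleVec (cornerRot (cornerRot d)) c.1 (pairIdx c.2.1.1 c.2.1.2) =
      if d.1 = c.1 ∧ pairIdx d.2.1.1 d.2.1.2 = pairIdx c.2.1.1 c.2.1.2 + 1 then 1 else 0 := by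
    intro d
    have : ∀ a b : Fin 3, a + 2 = b ↔ a = b + 1 := by decide
    rw [r1 (cornerRot d)]
    have : ∀ a b : Fin 3, a + 1 = b + 2 ↔ a = b + 1 := by decide
    simp only [cornerRot, pairIdx_nxt _ _ d.2.2, this]
  simp only [cornerAngle, leadingTrailing_apply]
  rw [γ.sum_exit_sub_enter fun s => angleVec s c.1 (pairIdx c.2.1.1 c.2.1.2)]
  simp only [hx]
  push_cast
  simp only [sub_mul, Finset.sum_sub_distrib]
  -- Both sums over the sides are reindexed so that `f` is evaluated at the summation variable. They
  -- then become `pairSum` at the two other pairs of edges of the tetrahedron.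
  have s1 := Equiv.sum_comp τ.boundary.rot fun s => (f (τ.boundary.rot (τ.boundary.rot s)) : ℝ) *
    angleVec s c.1 (pairIdx c.2.1.1 c.2.1.2)
  have s2 := Equiv.sum_comp (τ.boundary.rot * τ.boundary.rot) fun s =>
    (f (τ.boundary.rot s) : ℝ) * angleVec s c.1 (pairIdx c.2.1.1 c.2.1.2)
  rw [← s1, ← s2]
  simp only [Equiv.Perm.coe_mul, Function.comp_apply, τ.boundary.rot_rot_rot]
  have q1 : ∀ d : Corner T, (f d : ℝ) * angleVec (τ.boundary.rot d) c.1
      (pairIdx c.2.1.1 c.2.1.2) = if d.1 = c.1 ∧ pairIdx d.2.1.1 d.2.1.2 =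
        pairIdx c.2.1.1 c.2.1.2 + 2 then F d else 0 := by
    intro d
    have := r1 d
    change angleVec (τ.boundary.rot d) _ _ = _ at this
    rw [this]; split_ifs <;> simp [F]
  have q2 : ∀ d : Corner T, (f d : ℝ) * angleVec (τ.boundary.rot (τ.boundary.rot d)) c.1
      (pairIdx c.2.1.1 c.2.1.2) = if d.1 = c.1 ∧ pairIdx d.2.1.1 d.2.1.2 =
        pairIdx c.2.1.1 c.2.1.2 + 1 then F d else 0 := by
    intro d
    have := r2 d
    change angleVec (τ.boundary.rot (τ.boundary.rot d)) _ _ = _ at this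
    rw [this]; split_ifs <;> simp [F]
  simp only [q1, q2, pairSum]
  ring

theorem turning_trivialDeformation [Fintype T] [DecidableEq T] (θ θ' : T → Fin 3 → ℝ)
    (h : τ.TrivialDeformation θ θ') (γ : τ.boundary.ClosedNormalPath) :
    γ.turning (cornerAngle θ') = γ.turning (cornerAngle θ) := by
  induction h with
  | refl => rfl
  | step θ' γ' r _ h0 ih =>
    have : cornerAngle (θ' + r • τ.leadingTrailing γ') =
        cornerAngle θ' + r • cornerAngle (τ.leadingTrailing γ') := by
      ext c; simp [cornerAngle]
    rw [this, γ.turning_add, γ.turning_smul, turning_leadingTrailing τ γ' γ h0, ih]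
    simp

end IdealTriangulation

/-! ### Infinite normal paths and the Umlaufsatz -/

namespace TriangulatedSurface
variable {C : Type*} (S : TriangulatedSurface C)

theorem rot_rot_ne (c : C) : S.rot (S.rot c) ≠ c := fun h => S.rot_ne c (by
  conv_rhs => rw [← S.rot_rot_rot c, h])

/-- An oriented normal path that starts somewhere and goes on forever, drawn with crossing points
at given positions on the sides. -/
structure NormalRay where
  corner : ℕ → C
  left : ℕ → Bool
  pos : ℕ → ℝ
  next : ∀ i,
    (if left (i + 1) then S.rot (S.rot (corner (i + 1))) else S.rot (corner (i + 1))) =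
      S.glue (if left i then S.rot (corner i) else S.rot (S.rot (corner i)))

namespace NormalRay
variable {S} (γ : S.NormalRay)

/-- The side through which the `i`-th arc enters its triangle. -/
def enter (i : ℕ) : C :=
  if γ.left i then S.rot (S.rot (γ.corner i)) else S.rot (γ.corner i)

/-- The side through which the `i`-th arc leaves its triangle. -/
def exit (i : ℕ) : C :=
  if γ.left i then S.rot (γ.corner i) else S.rot (S.rot (γ.corner i))

/-- The distance to the corner of the end of an arc on the side towards the next corner. -/
def distRot (i : ℕ) : ℝ := if γ.left i then γ.pos i else 1 - γ.pos (i + 1)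

/-- The distance to the corner of the end of an arc on the side towards the last corner. -/
def distRotRot (i : ℕ) : ℝ := if γ.left i then γ.pos (i + 1) else 1 - γ.pos i

theorem enter_succ (i : ℕ) : γ.enter (i + 1) = S.glue (γ.exit i) := γ.next i

/-- The arcs are pairwise disjoint. -/
structure IsEmbedded : Prop where
  nested : ∀ i j, i ≠ j → γ.corner i = γ.corner j →
      (γ.distRot i < γ.distRot j ∧ γ.distRotRot i < γ.distRotRot j) ∨
      (γ.distRot j < γ.distRot i ∧ γ.distRotRot j < γ.distRotRot i)
  disjoint : ∀ i j, γ.corner j = S.rot (γ.corner i) → γ.distRot i + γ.distRotRot j < 1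

/-- The arc `j` enters the triangle of the arc `i` on the left of the arc `i`. -/
def EntersLeft (i j : ℕ) : Prop :=
  (γ.enter j = γ.enter i ∧ γ.pos j < γ.pos i) ∨
  (γ.enter j = γ.exit i ∧ 1 - γ.pos (i + 1) < γ.pos j) ∨
  (γ.left i = false ∧ γ.enter j = γ.corner i)

/-- The arc `j` leaves the triangle of the arc `i` on the left of the arc `i`. -/
def ExitsLeft (i j : ℕ) : Prop :=
  (γ.exit j = γ.enter i ∧ 1 - γ.pos (j + 1) < γ.pos i) ∨
  (γ.exit j = γ.exit i ∧ γ.pos (j + 1) < γ.pos (i + 1)) ∨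
  (γ.left i = false ∧ γ.exit j = γ.corner i)

/-- Disjoint chords do not separate each other's ends. The cases are: the arc `j` cuts off the same
corner as the arc `i`, the next one, the last one, or lies in another triangle, where both sides are
false. -/
theorem entersLeft_iff_exitsLeft (hγ : γ.IsEmbedded) {i j : ℕ} (hij : i ≠ j) :
    γ.EntersLeft i j ↔ γ.ExitsLeft i j := by
  have r1 := S.rot_ne
  have r2 := S.rot_rot_ne
  have r3 := S.rot_rot_rot
  have r1' := fun c => (S.rot_ne c).symm
  have r2' := fun c => (S.rot_rot_ne c).symm
  by_cases h0 : γ.corner j = γ.corner i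
  · have h := hγ.nested i j hij h0.symm
    unfold EntersLeft ExitsLeft enter exit
    unfold distRot distRotRot at h
    cases hi : γ.left i <;> cases hj : γ.left j <;>
      simp only [hi, hj, h0, r1, r2, r1', r2', Bool.false_eq_true, if_true, if_false,
        EmbeddingLike.apply_eq_iff_eq, true_and, false_and, false_or, or_false, and_false,
        reduceCtorEq] at h ⊢ <;>
      constructor <;> intro _ <;> rcases h with h | h <;> linarith
  by_cases h1 : γ.corner j = S.rot (γ.corner i)
  · have h := hγ.disjoint i j h1
    unfold EntersLeft ExitsLeft enter exit
    unfold distRot distRotRot at h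
    cases hi : γ.left i <;> cases hj : γ.left j <;>
      simp only [hi, hj, h1, r1, r2, r3, r1', r2', Bool.false_eq_true, if_true, if_false,
        EmbeddingLike.apply_eq_iff_eq, true_and, false_and, false_or, or_false, and_false,
        true_or, or_true, reduceCtorEq, iff_true, true_iff, iff_false, false_iff, iff_self,
        not_lt] at h ⊢ <;> linarith
  by_cases h2 : γ.corner j = S.rot (S.rot (γ.corner i))
  · have h := hγ.disjoint j i (by rw [h2, r3])
    unfold EntersLeft ExitsLeft enter exit
    unfold distRot distRotRot at h
    cases hi : γ.left i <;> cases hj : γ.left j <;>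
      simp only [hi, hj, h2, r1, r2, r3, r1', r2', Bool.false_eq_true, if_true, if_false,
        EmbeddingLike.apply_eq_iff_eq, true_and, false_and, false_or, or_false, and_false,
        true_or, or_true, reduceCtorEq, iff_true, true_iff, iff_false, false_iff, iff_self,
        not_lt] at h ⊢ <;> linarith
  · have e1 : ∀ x y : C, S.rot (S.rot x) = S.rot y ↔ S.rot x = y := fun x y =>
      S.rot.apply_eq_iff_eq
    have e2 : ∀ x y : C, S.rot x = S.rot (S.rot y) ↔ x = S.rot y := fun x y =>
      S.rot.apply_eq_iff_eq
    have e3 : ∀ x y : C, S.rot (S.rot x) = y ↔ x = S.rot y := fun x y => by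
      rw [← S.rot.apply_eq_iff_eq, r3]
    have e4 : ∀ x y : C, S.rot x = y ↔ x = S.rot (S.rot y) := fun x y => by
      rw [eq_comm, ← e3, eq_comm]
    unfold EntersLeft ExitsLeft enter exit
    cases hi : γ.left i <;> cases hj : γ.left j <;>
      simp [e1, e2, e3, e4, r3, h0, h1, h2]

theorem exit_ne_enter (i : ℕ) : γ.exit i ≠ γ.enter i := by
  unfold exit enter
  split_ifs
  · exact (S.rot_ne _).symm
  · exact S.rot_ne _

theorem exit_ne_corner (i : ℕ) : γ.exit i ≠ γ.corner i := by
  unfold exit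
  split_ifs
  · exact S.rot_ne _
  · exact S.rot_rot_ne _

theorem enter_ne_corner (i : ℕ) : γ.enter i ≠ γ.corner i := by
  unfold enter
  split_ifs
  · exact S.rot_rot_ne _
  · exact S.rot_ne _

/-- `x` is a corner of the triangle of `c`. -/
def _root_.TriangulatedSurface.SameTriangle (S : TriangulatedSurface C) (c x : C) : Prop :=
  x = c ∨ x = S.rot c ∨ x = S.rot (S.rot c)

theorem _root_.TriangulatedSurface.SameTriangle.rot {S : TriangulatedSurface C} {c x : C}
    (h : S.SameTriangle c x) : S.SameTriangle c (S.rot x) := by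
  rcases h with rfl | rfl | rfl
  · exact Or.inr (Or.inl rfl)
  · exact Or.inr (Or.inr rfl)
  · exact Or.inl (S.rot_rot_rot _)

theorem _root_.TriangulatedSurface.SameTriangle.symm {S : TriangulatedSurface C} {c x : C}
    (h : S.SameTriangle c x) : S.SameTriangle x c := by
  rcases h with rfl | rfl | rfl
  · exact Or.inl rfl
  · exact Or.inr (Or.inr (S.rot_rot_rot _).symm)
  · exact Or.inr (Or.inl (S.rot_rot_rot _).symm)

theorem _root_.TriangulatedSurface.SameTriangle.trans {S : TriangulatedSurface C} {c x y : C}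
    (h : S.SameTriangle c x) (h' : S.SameTriangle x y) : S.SameTriangle c y := by
  rcases h' with rfl | rfl | rfl
  exacts [h, h.rot, h.rot.rot]

theorem sameTriangle_enter (i : ℕ) : S.SameTriangle (γ.corner i) (γ.enter i) := by
  unfold enter SameTriangle
  split_ifs <;> simp

theorem sameTriangle_exit (i : ℕ) : S.SameTriangle (γ.corner i) (γ.exit i) := by
  unfold exit SameTriangle
  split_ifs <;> simp

section Umlaufsatz
open Classical

theorem ite_or_or (p q r : Prop) [Decidable p] [Decidable q]
    [Decidable r] {_ : Decidable (p ∨ q ∨ r)} (h1 : p → ¬q) (h2 : p → ¬r) (h3 : q → ¬r) :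
    (if p ∨ q ∨ r then (1 : ℤ) else 0) =
      (if p then 1 else 0) + (if q then 1 else 0) + if r then 1 else 0 := by
  by_cases p <;> by_cases q <;> by_cases r <;> simp_all

/-- The signed number of times that the path crosses, between its arcs `j` and `j + 1`, the part
of the side through which the arc `i` enters that is on the left of the arc `i`. -/
noncomputable def crossLeft (i j : ℕ) : ℤ :=
  (if γ.enter (j + 1) = γ.enter i ∧ γ.pos (j + 1) < γ.pos i then 1 else 0) -
  if γ.exit j = γ.enter i ∧ 1 - γ.pos (j + 1) < γ.pos i then 1 else 0

/-- The part of the triangle to the left of the arc `i` is bounded by the left parts of the sides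
entered and left and, if the arc turns right, by the whole side `corner i`. Signed crossings of this
boundary count exits minus entries. The term for `i + 1` is read from the neighbouring triangle,
hence with the opposite sign. -/
theorem crossLeft_succ_sub (i j : ℕ) :
    γ.crossLeft (i + 1) j - γ.crossLeft i j + (if γ.left i then 0 else
      ((if γ.exit j = γ.corner i then 1 else 0) -
        if S.glue (γ.exit j) = γ.corner i then 1 else 0)) =
    (if γ.ExitsLeft i j then 1 else 0) - if γ.EntersLeft i (j + 1) then 1 else 0 := by
  unfold ExitsLeft EntersLeft crossLeft
  have n1 := γ.exit_ne_enter i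
  have n2 := γ.exit_ne_corner i
  have n3 := γ.enter_ne_corner i
  rw [ite_or_or _ _ _ (by rintro ⟨h, -⟩ ⟨h', -⟩; exact n1 (h'.symm.trans h))
      (by rintro ⟨h, -⟩ ⟨-, h'⟩; exact n3 (h.symm.trans h'))
      (by rintro ⟨h, -⟩ ⟨-, h'⟩; exact n2 (h.symm.trans h')),
    ite_or_or _ _ _ (by rintro ⟨h, -⟩ ⟨h', -⟩; exact n1 (h'.symm.trans h))
      (by rintro ⟨h, -⟩ ⟨-, h'⟩; exact n3 (h.symm.trans h'))
      (by rintro ⟨h, -⟩ ⟨-, h'⟩; exact n2 (h.symm.trans h'))]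
  have e1 : γ.enter (j + 1) = γ.enter (i + 1) ↔ γ.exit j = γ.exit i := by
    rw [enter_succ, enter_succ, S.glue.apply_eq_iff_eq]
  have e2 : γ.exit j = γ.enter (i + 1) ↔ γ.enter (j + 1) = γ.exit i := by
    rw [enter_succ, enter_succ, ← S.glue.apply_eq_iff_eq, S.glue_glue]
  have e3 : 1 - γ.pos (j + 1) < γ.pos (i + 1) ↔ 1 - γ.pos (i + 1) < γ.pos (j + 1) := by
    constructor <;> intro h <;> linarith
  simp only [e1, e2, e3, ← γ.enter_succ]
  by_cases hl : γ.left i = true <;> simp [hl] <;> ring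

/-- **Hopf's Umlaufsatz** for a periodic embedded path in a triangulated plane. Here `J i x` is
the signed number of times that the side `x` crosses a ray to infinity from the vertex on the left
of the arc `i` where this arc begins, and `K i x` depends on the triangle of `x`; if the arc `i`
turns right, then `K i` compares two such rays, joined by the side `corner i`. -/
theorem umlaufsatz (hγ : γ.IsEmbedded) (hS : ∀ x, ¬ S.SameTriangle x (S.glue x))
    (J K : ℕ → C → ℤ) (hK : ∀ i x, K i (S.rot x) = K i x)
    (hleft : ∀ i, γ.left i = true → ∀ j, J (i + 1) (γ.exit j) = J i (γ.exit j))
    (hright : ∀ i, γ.left i = false → ∀ j, J (i + 1) (γ.exit j) - J i (γ.exit j) =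
      (if γ.exit j = γ.corner i then 1 else 0) -
        (if S.glue (γ.exit j) = γ.corner i then 1 else 0) +
      K i (γ.exit j) - K i (S.glue (γ.exit j)))
    (hfin : ∀ i, ∃ N, ∀ j, N ≤ j → J i (γ.exit j) = 0 ∧ K i (γ.corner j) = 0 ∧
      ¬ S.SameTriangle (γ.corner i) (γ.corner j))
    (n : ℕ) (f : C → C) (hf : Function.Injective f) (hfr : ∀ x, f (S.rot x) = S.rot (f x))
    (hc : ∀ j, γ.corner (j + n) = f (γ.corner j)) (hl : ∀ j, γ.left (j + n) = γ.left j)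
    (hp : ∀ j, γ.pos (j + n) = γ.pos j)
    (hJ : ∀ j, J n (γ.exit (j + n)) = J 0 (γ.exit j)) :
    ∑ i ∈ range n, (-J i (γ.exit i) + if γ.left i then 0 else K i (γ.corner (i + 1))) = 0 := by
  have hKt : ∀ i x y, S.SameTriangle x y → K i y = K i x := by
    rintro i x y (rfl | rfl | rfl) <;> simp [hK]
  -- `A i j` is the signed crossing, between the arcs `j` and `j + 1`, of the curve from the start
  -- of the arc `i` along its side to the vertex on the left, then along the ray.
  let A : ℕ → ℕ → ℤ := fun i j => J i (γ.exit j) + γ.crossLeft i j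
  have hA : ∀ i, ∃ N, ∀ j, N ≤ j → A i j = 0 := by
    intro i
    obtain ⟨N, hN⟩ := hfin i
    refine ⟨N, fun j hj => ?_⟩
    have h1 : γ.enter (j + 1) ≠ γ.enter i := fun h => (hN (j + 1) (by omega)).2.2 <|
      (γ.sameTriangle_enter i).trans (h ▸ (γ.sameTriangle_enter (j + 1)).symm)
    have h2 : γ.exit j ≠ γ.enter i := fun h => (hN j hj).2.2 <|
      (γ.sameTriangle_enter i).trans (h ▸ (γ.sameTriangle_exit j).symm)
    simp [A, crossLeft, h1, h2, (hN j hj).1]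
  have hself : ∀ i, ¬ S.SameTriangle (γ.corner i) (γ.corner (i + 1)) := fun i h =>
    hS (γ.exit i) <| (γ.sameTriangle_exit i).symm.trans <| h.trans <| by
      rw [← enter_succ]; exact γ.sameTriangle_enter (i + 1)
  have hA0 : ∀ i, A i i = J i (γ.exit i) := by
    intro i
    have h1 : γ.enter (i + 1) ≠ γ.enter i := fun h => hself i <|
      (γ.sameTriangle_enter i).trans (h ▸ (γ.sameTriangle_enter (i + 1)).symm)
    simp [A, crossLeft, h1, γ.exit_ne_enter i]
  have hnl : ∀ i j, ¬ S.SameTriangle (γ.corner i) (γ.corner j) → ¬ γ.EntersLeft i j := by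
    intro i j h
    have h0 : ∀ x, S.SameTriangle (γ.corner i) x → γ.enter j ≠ x := fun x hx h' =>
      h (hx.trans (h' ▸ (γ.sameTriangle_enter j).symm))
    simp [EntersLeft, h0 _ (γ.sameTriangle_enter i), h0 _ (γ.sameTriangle_exit i),
      h0 _ (Or.inl rfl)]
  -- `B i j` tells whether the arc `j` starts in the region between the curves of `i` and `i + 1`:
  -- the part of the triangle left of the arc `i` and, after a right turn, the region between the
  -- two rays.
  let B : ℕ → ℕ → ℤ := fun i j => (if γ.EntersLeft i j then 1 else 0) +
    if γ.left i then 0 else K i (γ.corner j)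
  have hstep : ∀ i j, i < j → A (i + 1) j - A i j = B i j - B i (j + 1) := by
    intro i j hij
    have h1 := γ.crossLeft_succ_sub i j
    have h2 : (if γ.EntersLeft i j then (1 : ℤ) else 0) = if γ.ExitsLeft i j then 1 else 0 := by
      simp only [γ.entersLeft_iff_exitsLeft hγ hij.ne]
    have k1 : K i (γ.exit j) = K i (γ.corner j) := hKt _ _ _ (γ.sameTriangle_exit j)
    have k2 : K i (S.glue (γ.exit j)) = K i (γ.corner (j + 1)) := by
      rw [← enter_succ]; exact hKt _ _ _ (γ.sameTriangle_enter _)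
    simp only [A, B, h2]
    cases hl : γ.left i
    · have h3 := hright i hl j
      simp only [hl, Bool.false_eq_true, if_false] at h1 ⊢
      linarith
    · have h3 := hleft i hl j
      simp only [hl, if_true] at h1 ⊢
      linarith
  have hB0 : ∀ i, B i (i + 1) = if γ.left i then 0 else K i (γ.corner (i + 1)) := by
    intro i
    simp only [B, hnl i _ (hself i), if_false, zero_add]
  -- The differences telescope in `j`. Besides the end terms there remains the diagonal crossing `j
  -- = i`, which only the sum for `i` contains.
  have hsum : ∀ i N, i < N → ∑ j ∈ Ico (i + 1) N, A (i + 1) j - ∑ j ∈ Ico i N, A i j =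
      B i (i + 1) - B i N - J i (γ.exit i) := by
    intro i N hN
    have h1 := Finset.sum_Ico_sub (fun j => B i j) (show i + 1 ≤ N from hN)
    have h2 : ∑ j ∈ Ico (i + 1) N, A (i + 1) j - ∑ j ∈ Ico (i + 1) N, A i j =
        -∑ j ∈ Ico (i + 1) N, (B i (j + 1) - B i j) := by
      rw [← Finset.sum_sub_distrib, ← Finset.sum_neg_distrib]
      refine Finset.sum_congr rfl fun j hj => ?_
      rw [hstep i j (by have := Finset.mem_Ico.1 hj; omega), neg_sub]
    rw [Finset.sum_eq_sum_Ico_succ_bot hN, hA0]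
    linarith
  choose N1 hN1 using hA
  choose N2 hN2 using hfin
  obtain ⟨N, hN, hNn⟩ : ∃ N, (∀ i ≤ n, n + N1 i ≤ N ∧ N2 i ≤ N) ∧ n < N := by
    refine ⟨n + 1 + ∑ i ∈ range (n + 1), (N1 i + N2 i), fun i hi => ?_, by omega⟩
    have := Finset.single_le_sum (f := fun i => N1 i + N2 i) (fun _ _ => Nat.zero_le _)
      (Finset.mem_range.2 (show i < n + 1 by omega))
    omega
  have hBN : ∀ i ≤ n, B i N = 0 := by
    intro i hi
    obtain ⟨-, h2, h3⟩ := hN2 i N (hN i hi).2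
    simp [B, hnl i N h3, h2]
  have htel : ∀ m ≤ n, ∑ i ∈ range m,
      (-J i (γ.exit i) + if γ.left i then 0 else K i (γ.corner (i + 1))) =
      ∑ j ∈ Ico m N, A m j - ∑ j ∈ Ico 0 N, A 0 j := by
    intro m
    induction m with
    | zero => simp
    | succ m ih =>
      intro hm
      have := hsum m N (by omega)
      rw [Finset.sum_range_succ, ih (by omega), ← hB0]
      rw [hBN m (by omega)] at this
      linarith
  -- The count for `n` is the translate of the count for `0`, cut off at a different place; the
  -- cut-off terms vanish since they are far away.
  rw [htel n le_rfl, sub_eq_zero]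
  have hfx : ∀ j, γ.exit (j + n) = f (γ.exit j) := by
    intro j; unfold exit; rw [hl, hc]; split_ifs <;> simp [hfr]
  have hfe : ∀ j, γ.enter (j + n) = f (γ.enter j) := by
    intro j; unfold enter; rw [hl, hc]; split_ifs <;> simp [hfr]
  have hper : ∀ j, A n (j + n) = A 0 j := by
    intro j
    have p0 := hp 0
    have e0 := hfe 0
    have p1 := hp (j + 1)
    have e1 := hfe (j + 1)
    rw [zero_add] at p0 e0
    rw [add_right_comm] at p1 e1
    have hJj := hJ j
    rw [hfx] at hJj
    simp only [A, hJj, crossLeft, p0, p1, e0, e1, hfx, hf.eq_iff]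
  have : ∑ j ∈ Ico n N, A n j = ∑ j ∈ Ico 0 (N - n), A 0 j := by
    rw [Finset.sum_Ico_eq_sum_range, Nat.Ico_zero_eq_range]
    exact Finset.sum_congr rfl fun j _ => by rw [Nat.add_comm, hper]
  rw [this, ← Finset.sum_Ico_consecutive _ (Nat.zero_le (N - n)) (Nat.sub_le N n),
    Finset.sum_eq_zero (s := Ico (N - n) N), add_zero]
  intro j hj
  have := hN 0 (Nat.zero_le n)
  have := Finset.mem_Ico.1 hj
  exact hN1 0 j (by omega)

end Umlaufsatz

end NormalRay
end TriangulatedSurface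

/-! ### Ladder systems and their strips -/

/-- The combinatorics of a surface that is decomposed into ladders: `D` is the set of triangles,
each of them has one side on the left or on the right pole of its ladder, `up` goes to the next
triangle up in the same ladder, `across` goes to the triangle on the other side of the pole. The
last field says how these maps fit together at the vertices; `rise` and `cross` are the increments
in these two directions of a cocycle with values in `G`. -/
structure LadderSystem (D G : Type*) [AddCommGroup G] where
  up : Equiv.Perm D
  across : D → D
  left : D → Bool
  rise : D → G
  cross : D → G
  across_across : ∀ d, across (across d) = d
  left_across : ∀ d, left (across d) = !left d
  cross_across : ∀ d, cross (across d) = -cross d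
  exists_left : ∀ d b, ∃ k : ℕ, left ((up ^ k) d) = b
  next : ∀ d k, 0 < k → left ((up ^ k) d) = left d →
    (∀ j, 0 < j → j < k → left ((up ^ j) d) ≠ left d) →
    ∃ k', 0 < k' ∧ (up ^ k') (across d) = across ((up ^ k) d) ∧
      (∀ j, 0 < j → j < k' → left ((up ^ j) (across d)) ≠ left (across d)) ∧
      ∑ j ∈ range k, rise ((up ^ j) d) + cross ((up ^ k) d) =
        cross d + ∑ j ∈ range k', rise ((up ^ j) (across d))

namespace LadderSystem
variable {D G : Type*} [AddCommGroup G] (L : LadderSystem D G)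

/-- The map `up` on lifted triangles. -/
def liftUp : Equiv.Perm (D × G) where
  toFun e := (L.up e.1, e.2 + L.rise e.1)
  invFun e := (L.up.symm e.1, e.2 - L.rise (L.up.symm e.1))
  left_inv e := by simp
  right_inv e := by simp

/-- The map `across` on lifted triangles. -/
def liftAcross (e : D × G) : D × G := (L.across e.1, e.2 + L.cross e.1)

theorem liftAcross_liftAcross (e : D × G) : L.liftAcross (L.liftAcross e) = e := by
  simp [liftAcross, L.across_across, L.cross_across]

theorem liftUp_pow (k : ℕ) (e : D × G) : (L.liftUp ^ k) e =
    ((L.up ^ k) e.1, e.2 + ∑ j ∈ range k, L.rise ((L.up ^ j) e.1)) := by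
  induction k with
  | zero => simp
  | succ k ih =>
    rw [pow_succ', Equiv.Perm.mul_apply, ih, Finset.sum_range_succ, pow_succ',
      Equiv.Perm.mul_apply, ← add_assoc]
    rfl

theorem liftUp_zpow_fst (k : ℤ) (e : D × G) : ((L.liftUp ^ k) e).1 = (L.up ^ k) e.1 := by
  have h : ∀ (k : ℕ) e, ((L.liftUp ^ k) e).1 = (L.up ^ k) e.1 := fun k e => by
    rw [liftUp_pow]
  obtain ⟨n, rfl | rfl⟩ := k.eq_nat_or_neg
  · simp [h]
  · rw [zpow_neg, zpow_natCast, zpow_neg, zpow_natCast, Equiv.Perm.eq_inv_iff_eq, ← h]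
    simp

theorem exists_return (d : D) : ∃ k, 0 < k ∧ L.left ((L.up ^ k) d) = L.left d ∧
    ∀ j, 0 < j → j < k → L.left ((L.up ^ j) d) ≠ L.left d := by
  classical
  have h : ∃ k, 0 < k ∧ L.left ((L.up ^ k) d) = L.left d := by
    obtain ⟨k, hk⟩ := L.exists_left (L.up d) (L.left d)
    exact ⟨k + 1, k.succ_pos, by rwa [pow_succ, Equiv.Perm.mul_apply]⟩
  refine ⟨Nat.find h, (Nat.find_spec h).1, (Nat.find_spec h).2, fun j h0 hj hl => ?_⟩
  exact Nat.find_min h hj ⟨h0, hl⟩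

/-- The field `next` treats two consecutive triangles on the same pole, including their cocycle
values. The general case is split at the first return to this pole. -/
theorem sameCycle_liftAcross_pow (m : ℕ) (e : D × G)
    (h : L.left ((L.up ^ m) e.1) = L.left e.1) :
    L.liftUp.SameCycle (L.liftAcross e) (L.liftAcross ((L.liftUp ^ m) e)) := by
  induction m using Nat.strong_induction_on generalizing e with
  | _ m ih =>
    rcases Nat.eq_zero_or_pos m with rfl | hm
    · simpa using Equiv.Perm.SameCycle.refl _ _
    obtain ⟨k, hk, hk1, hk2⟩ := L.exists_return e.1
    have hkm : k ≤ m := by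
      by_contra hlt
      exact hk2 m hm (not_le.1 hlt) h
    obtain ⟨k', _, h1, _, h2⟩ := L.next e.1 k hk hk1 hk2
    have hs : L.liftUp.SameCycle (L.liftAcross e) (L.liftAcross ((L.liftUp ^ k) e)) := by
      refine ⟨k', ?_⟩
      rw [zpow_natCast, liftUp_pow, liftUp_pow]
      simp only [liftAcross, h1, Prod.mk.injEq, true_and]
      rw [add_assoc, add_assoc, h2]
    obtain ⟨r, rfl⟩ := Nat.exists_eq_add_of_le hkm
    have h3 := ih r (by omega) ((L.liftUp ^ k) e) (by
      rw [liftUp_pow, hk1, ← h, add_comm k r, pow_add, Equiv.Perm.mul_apply])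
    rw [← Equiv.Perm.mul_apply, ← pow_add, add_comm] at h3
    exact hs.trans h3

theorem sameCycle_liftAcross {e e' : D × G} (h : L.liftUp.SameCycle e e')
    (hl : L.left e'.1 = L.left e.1) :
    L.liftUp.SameCycle (L.liftAcross e) (L.liftAcross e') := by
  obtain ⟨k, rfl⟩ := h
  obtain ⟨n, rfl | rfl⟩ := k.eq_nat_or_neg
  · rw [zpow_natCast] at hl ⊢
    rw [liftUp_pow] at hl
    exact L.sameCycle_liftAcross_pow n e hl
  · have := L.sameCycle_liftAcross_pow n ((L.liftUp ^ (-(n : ℤ))) e) (by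
      rw [hl, ← zpow_natCast, ← liftUp_zpow_fst, ← Equiv.Perm.mul_apply, ← zpow_add]
      simp)
    rw [← zpow_natCast, ← Equiv.Perm.mul_apply, ← zpow_add] at this
    simpa using this.symm

theorem sameCycle_up_iff {d d' : D} :
    L.up.SameCycle d d' ↔ ∃ g, L.liftUp.SameCycle (d, 0) (d', g) := by
  constructor
  · rintro ⟨k, rfl⟩
    exact ⟨((L.liftUp ^ k) (d, 0)).2, k, Prod.ext (L.liftUp_zpow_fst k (d, 0)) rfl⟩
  · rintro ⟨g, k, hk⟩
    exact ⟨k, by rw [← L.liftUp_zpow_fst k (d, 0), hk]⟩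

theorem sameCycle_across {d d' : D} (h : L.up.SameCycle d d') (hl : L.left d' = L.left d) :
    L.up.SameCycle (L.across d) (L.across d') := by
  obtain ⟨g, hg⟩ := L.sameCycle_up_iff.1 h
  obtain ⟨k, hk⟩ := L.sameCycle_liftAcross hg hl
  exact ⟨k, (L.liftUp_zpow_fst k (L.liftAcross (d, 0))).symm.trans (by rw [hk]; rfl)⟩

section Strips

/-- The lifted triangle across the right pole, if `b = false`, or across the left pole, if
`b = true`, from some triangle of the strip of `e`. -/
noncomputable def crossFrom (b : Bool) (e : D × G) : D × G :=
  L.liftAcross ((L.liftUp ^ (L.exists_left e.1 b).choose) e)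

theorem left_crossFrom (b : Bool) (e : D × G) : L.left (L.crossFrom b e).1 = !b := by
  rw [crossFrom, liftAcross, L.left_across, liftUp_pow]
  exact congrArg _ (L.exists_left e.1 b).choose_spec

theorem sameCycle_crossFrom {b : Bool} {e e' : D × G} (h : L.liftUp.SameCycle e e')
    (hb : L.left e'.1 = b) : L.liftUp.SameCycle (L.crossFrom b e) (L.liftAcross e') := by
  refine L.sameCycle_liftAcross (Equiv.Perm.SameCycle.trans ?_ h) ?_
  · exact Equiv.Perm.sameCycle_pow_left.2 (Equiv.Perm.SameCycle.refl _ _)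
  · rw [hb, liftUp_pow]
    exact ((L.exists_left e.1 b).choose_spec).symm

theorem sameCycle_crossFrom_crossFrom (b : Bool) (e : D × G) :
    L.liftUp.SameCycle (L.crossFrom (!b) (L.crossFrom b e)) e := by
  refine (L.sameCycle_crossFrom (Equiv.Perm.SameCycle.refl _ _) (L.left_crossFrom b e)).trans ?_
  rw [crossFrom, liftAcross_liftAcross]
  exact Equiv.Perm.sameCycle_pow_left.2 (Equiv.Perm.SameCycle.refl _ _)

theorem sameCycle_crossFrom_congr (b : Bool) {e e' : D × G} (h : L.liftUp.SameCycle e e') :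
    L.liftUp.SameCycle (L.crossFrom b e) (L.crossFrom b e') := by
  refine L.sameCycle_crossFrom (h.trans ?_) ?_
  · exact Equiv.Perm.sameCycle_pow_right.2 (Equiv.Perm.SameCycle.refl _ _)
  · rw [liftUp_pow]
    exact (L.exists_left e'.1 b).choose_spec

/-- The strips: the cycles of `up` on the lifted triangles. -/
abbrev Strip : Type _ := Quotient (Equiv.Perm.SameCycle.setoid L.liftUp)

/-- From each strip to the next strip on the right. -/
noncomputable def shift : Equiv.Perm L.Strip where
  toFun := Quotient.map (L.crossFrom false) fun _ _ h => L.sameCycle_crossFrom_congr false h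
  invFun := Quotient.map (L.crossFrom true) fun _ _ h => L.sameCycle_crossFrom_congr true h
  left_inv := by
    rintro ⟨e⟩
    exact Quotient.sound (L.sameCycle_crossFrom_crossFrom false e)
  right_inv := by
    rintro ⟨e⟩
    exact Quotient.sound (L.sameCycle_crossFrom_crossFrom true e)

/-- The strip of a lifted triangle. -/
def strip (e : D × G) : L.Strip := Quotient.mk _ e

theorem strip_eq_iff {e e' : D × G} : L.strip e = L.strip e' ↔ L.liftUp.SameCycle e e' :=
  Quotient.eq

theorem strip_liftAcross (e : D × G) :
    L.strip (L.liftAcross e) = (L.shift ^ (if L.left e.1 then (-1 : ℤ) else 1)) (L.strip e) := by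
  cases h : L.left e.1
  · exact (L.strip_eq_iff.2 (L.sameCycle_crossFrom (Equiv.Perm.SameCycle.refl _ e) h)).symm
  · exact (L.strip_eq_iff.2 (L.sameCycle_crossFrom (Equiv.Perm.SameCycle.refl _ e) h)).symm

end Strips

/-! ### Heights of the vertices in the strips -/

/-- Heights of the vertices: the side of a triangle `d` on a pole has length `width d`, and the
right end of the bottom side of `d` is higher than the left end by `slope d`. -/
structure Heights where
  width : D → ℝ
  slope : D → ℝ
  width_pos : ∀ d, 0 < width d
  width_across : ∀ d, width (L.across d) = width d
  slope_up : ∀ d, slope (L.up d) = slope d + if L.left d then -width d else width d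

section ExistsHeights
variable [Fintype D]
open Classical

/-- In `orderOf σ` steps the orbit of `d` visits each element of its cycle equally often; `c` is
this number of visits. -/
theorem sum_range_orderOf {D : Type*} [Fintype D] (σ : Equiv.Perm D) (d : D) :
    ∃ c : ℝ, ∀ F : D → ℝ, ∑ k ∈ range (orderOf σ), F ((σ ^ k) d) =
      c * ∑ e with σ.SameCycle d e, F e := by
  let c : D → ℝ := fun e => ∑ k ∈ range (orderOf σ), if (σ ^ k) d = e then 1 else 0
  have h1 : ∀ e, c (σ e) = c e := by
    intro e
    have hs := Finset.sum_range_succ (fun k => if (σ ^ k) d = σ e then (1 : ℝ) else 0) (orderOf σ)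
    have hs' := Finset.sum_range_succ' (fun k => if (σ ^ k) d = σ e then (1 : ℝ) else 0)
      (orderOf σ)
    rw [hs] at hs'
    simp only [pow_orderOf_eq_one, pow_zero, add_left_inj] at hs'
    simp only [c, hs']
    refine Finset.sum_congr rfl fun k _ => ?_
    rw [pow_succ', Equiv.Perm.mul_apply, σ.apply_eq_iff_eq]
  have h2 : ∀ e, σ.SameCycle d e → c e = c d := by
    intro e he
    obtain ⟨k, -, -, rfl⟩ := he.exists_pow_eq'
    induction k with
    | zero => rfl
    | succ k ih =>
      rw [pow_succ', Equiv.Perm.mul_apply, h1]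
      exact ih (Equiv.Perm.sameCycle_pow_right.2 (Equiv.Perm.SameCycle.refl _ _))
  refine ⟨c d, fun F => ?_⟩
  have : ∀ k, F ((σ ^ k) d) = ∑ e with σ.SameCycle d e, if (σ ^ k) d = e then F e else 0 := by
    intro k
    rw [Finset.sum_ite_eq, if_pos]
    simp only [Finset.mem_filter, Finset.mem_univ, true_and]
    exact Equiv.Perm.sameCycle_pow_right.2 (Equiv.Perm.SameCycle.refl _ _)
  simp only [this]
  rw [Finset.sum_comm, Finset.mul_sum]
  refine Finset.sum_congr rfl fun e he => ?_
  rw [← h2 e (Finset.mem_filter.1 he).2]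
  simp only [c, Finset.sum_mul]
  refine Finset.sum_congr rfl fun k _ => ?_
  split_ifs <;> simp

/-- A function whose sum over each cycle of a permutation vanishes is a coboundary. -/
theorem exists_potential {D : Type*} [Fintype D] (σ : Equiv.Perm D) (F : D → ℝ)
    (hF : ∀ d, ∑ e with σ.SameCycle d e, F e = 0) : ∃ ψ : D → ℝ, ∀ d, ψ (σ d) = ψ d + F d := by
  set N := orderOf σ with hN
  have hN0 : 0 < N := orderOf_pos σ
  -- Replacing `d` by `σ d` lowers every weight by one and adds `N * F d` at the end. The unweighted
  -- sum over the `N` steps is zero.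
  refine ⟨fun d => (∑ k ∈ range N, (k : ℝ) * F ((σ ^ k) d)) / N, fun d => ?_⟩
  have h1 := Finset.sum_range_succ (fun k : ℕ => (k : ℝ) * F ((σ ^ k) d)) N
  have h2 := Finset.sum_range_succ' (fun k : ℕ => (k : ℝ) * F ((σ ^ k) d)) N
  have h3 : ∑ k ∈ range N, F ((σ ^ k) d) = 0 := by
    obtain ⟨c, hc⟩ := sum_range_orderOf σ d
    rw [hc, hF, mul_zero]
  have h4 := Finset.sum_range_succ (fun k : ℕ => F ((σ ^ k) d)) N
  have h5 := Finset.sum_range_succ' (fun k : ℕ => F ((σ ^ k) d)) N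
  have h6 : σ ^ N = 1 := pow_orderOf_eq_one σ
  have h7 : ∑ k ∈ range N, (k : ℝ) * F ((σ ^ k) (σ d)) =
      ∑ k ∈ range N, (k : ℝ) * F ((σ ^ (k + 1)) d) := by
    simp only [pow_succ, Equiv.Perm.mul_apply]
  simp only [Nat.cast_add, Nat.cast_one, add_mul, one_mul, Finset.sum_add_distrib,
    Nat.cast_zero, zero_mul, add_zero] at h2
  simp only [h6, pow_zero, Equiv.Perm.coe_one, id_eq] at h1 h2 h4 h5
  beta_reduce
  rw [h7]
  have hN' : (N : ℝ) ≠ 0 := by positivity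
  field_simp
  linarith

/-- The width is the inverse of the number of triangles of the same cycle on the same pole. `across`
preserves this number, so widths agree across poles. Each pole of a cycle then has total length `1`,
so the increments prescribed for the slope cancel over the cycle and `exists_potential` applies. -/
theorem exists_heights : Nonempty L.Heights := by
  let s : D → Finset D := fun d => {e | L.up.SameCycle d e ∧ L.left e = L.left d}
  have hs0 : ∀ d, 0 < (s d).card := fun d => Finset.card_pos.2 ⟨d, by
    simpa [s] using Equiv.Perm.SameCycle.refl _ _⟩
  have hs : ∀ d e, L.up.SameCycle d e → L.left e = L.left d → s e = s d := by
    intro d e h hl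
    ext x
    simp only [s, Finset.mem_filter, Finset.mem_univ, true_and, hl]
    exact and_congr_left fun _ => ⟨fun h' => h.trans h', fun h' => h.symm.trans h'⟩
  have hle : ∀ d, (s d).card ≤ (s (L.across d)).card := by
    intro d
    refine Finset.card_le_card_of_injOn L.across (fun e he => ?_) fun a _ b _ h => ?_
    · simp only [s, Finset.coe_filter, Finset.mem_univ, true_and, Set.mem_ofPred_eq] at he ⊢
      exact ⟨L.sameCycle_across he.1 he.2, by rw [L.left_across, L.left_across, he.2]⟩
    · rw [← L.across_across a, h, L.across_across]
  have hcard : ∀ d, (s (L.across d)).card = (s d).card := fun d =>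
    le_antisymm (by simpa [L.across_across] using hle (L.across d)) (hle d)
  have hsum : ∀ d b, ∑ e with L.up.SameCycle d e, (if L.left e = b then ((s e).card : ℝ)⁻¹ else 0)
      = 1 := by
    intro d b
    obtain ⟨k, hk⟩ := L.exists_left d b
    set d' := (L.up ^ k) d with hd'
    have h1 : L.up.SameCycle d d' :=
      Equiv.Perm.sameCycle_pow_right.2 (Equiv.Perm.SameCycle.refl _ _)
    rw [← Finset.sum_filter, Finset.filter_filter]
    have h2 : ({e | L.up.SameCycle d e ∧ L.left e = b} : Finset D) = s d' := by
      ext x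
      simp only [s, Finset.mem_filter, Finset.mem_univ, true_and, hk]
      exact and_congr_left fun _ => ⟨fun h' => h1.symm.trans h', fun h' => h1.trans h'⟩
    rw [h2, Finset.sum_congr rfl fun e he => ?_, Finset.sum_const, nsmul_eq_mul]
    · exact mul_inv_cancel₀ (Nat.cast_ne_zero.2 (hs0 d').ne')
    · simp only [s, Finset.mem_filter, Finset.mem_univ, true_and] at he
      rw [hs d' e he.1 he.2]
  obtain ⟨ψ, hψ⟩ := exists_potential L.up
    (fun d => if L.left d then -((s d).card : ℝ)⁻¹ else ((s d).card : ℝ)⁻¹) (fun d => by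
      have h1 := hsum d true
      have h2 := hsum d false
      rw [← sub_self (1 : ℝ)]
      nth_rw 2 [← h1]
      rw [← h2, ← Finset.sum_sub_distrib]
      refine Finset.sum_congr rfl fun e _ => ?_
      cases L.left e <;> simp)
  exact ⟨⟨fun d => ((s d).card : ℝ)⁻¹, ψ, fun d => by have := hs0 d; positivity,
    fun d => by simp only [hcard], hψ⟩⟩

end ExistsHeights

namespace Heights
variable {L} (H : L.Heights)

/-- Up to the next triangle on the same pole, only `d` itself contributes to the length of that
pole. -/
theorem sum_return {d : D} {k : ℕ} (hk : 0 < k)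
    (h : ∀ j, 0 < j → j < k → L.left ((L.up ^ j) d) ≠ L.left d) :
    ∑ j ∈ range k, (if L.left ((L.up ^ j) d) = L.left d then H.width ((L.up ^ j) d) else 0) =
      H.width d := by
  rw [Finset.sum_eq_single 0]
  · simp
  · intro j hj h0
    rw [if_neg (h j (Nat.pos_of_ne_zero h0) (Finset.mem_range.1 hj))]
  · intro h0; exact absurd (Finset.mem_range.2 hk) h0

theorem slope_pow (k : ℕ) (d : D) : H.slope ((L.up ^ k) d) = H.slope d +
    ∑ j ∈ range k, (if L.left ((L.up ^ j) d) = false then H.width ((L.up ^ j) d) else 0) -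
    ∑ j ∈ range k, (if L.left ((L.up ^ j) d) = true then H.width ((L.up ^ j) d) else 0) := by
  induction k with
  | zero => simp
  | succ k ih =>
    rw [pow_succ', Equiv.Perm.mul_apply, H.slope_up, ih, Finset.sum_range_succ,
      Finset.sum_range_succ]
    cases L.left ((L.up ^ k) d) <;> simp <;> ring

/-- The ladder system with the positions in the plane added to the cocycle: `ℤ` counts strips, and
`ℝ` is the height of the left end of the bottom side. -/
def toLadderSystem : LadderSystem D (ℤ × ℝ × G) where
  up := L.up
  across := L.across
  left := L.left
  rise d := (0, if L.left d then H.width d else 0, L.rise d)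
  cross d := (if L.left d then -1 else 1,
    if L.left d then -H.slope (L.across d) else H.slope d, L.cross d)
  across_across := L.across_across
  left_across := L.left_across
  cross_across d := by
    rw [L.left_across, L.across_across, L.cross_across]
    cases L.left d <;> simp
  exists_left := L.exists_left
  next d k hk h1 h2 := by
    obtain ⟨k', hk', h3, h4, h5⟩ := L.next d k hk h1 h2
    refine ⟨k', hk', h3, h4, ?_⟩
    have s1 := H.sum_return hk h2
    have s2 := H.sum_return hk' h4
    have s3 := H.slope_pow k d
    have s4 := H.slope_pow k' (L.across d)
    have s5 := H.width_across d
    refine Prod.ext ?_ (Prod.ext ?_ ?_)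
    · simp [Prod.fst_sum, h1]
    -- Passing from `d` to the next triangle on the same pole climbs by `width d` along that pole,
    -- whether measured in the strip of `d` or in the strip across. `slope_pow` converts this to the
    -- height on the other pole when needed.
    · simp only [Prod.snd_add, Prod.fst_add, Prod.snd_sum, Prod.fst_sum, h1]
      rw [← h3]
      rw [L.left_across] at s2
      cases hl : L.left d <;> simp only [hl, Bool.not_true, Bool.not_false, if_true, if_false,
        Bool.false_eq_true] at s1 s2 ⊢ <;> linarith
    · simp only [Prod.snd_add, Prod.snd_sum]
      exact h5

end Heights

end LadderSystem

/-! ### The plane of strips and its vertical rays -/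

namespace LadderSystem

/-- The sides of a triangle of a ladder; each of them also names the opposite corner. -/
inductive Kind
  | top
  | bot
  | pole
  deriving DecidableEq

open Kind

/-- The counterclockwise order of the corners of a triangle that has a side on the left, or on the
right pole. -/
def rotKind : Bool → Kind → Kind
  | true, top => pole
  | true, pole => bot
  | true, bot => top
  | false, pole => top
  | false, top => bot
  | false, bot => pole

theorem rotKind_rotKind_rotKind (b : Bool) (k : Kind) :
    rotKind b (rotKind b (rotKind b k)) = k := by
  cases b <;> cases k <;> rfl

variable {D G : Type*} [AddCommGroup G] (L : LadderSystem D G)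

/-- The gluing of the sides of lifted triangles. -/
def glueSide : Kind × (D × G) → Kind × (D × G)
  | (top, e) => (bot, L.liftUp e)
  | (bot, e) => (top, L.liftUp.symm e)
  | (pole, e) => (pole, L.liftAcross e)

theorem glueSide_glueSide (x : Kind × (D × G)) : L.glueSide (L.glueSide x) = x := by
  obtain ⟨_ | _ | _, e⟩ := x
  · simp [glueSide]
  · simp [glueSide]
  · simp [glueSide, L.liftAcross_liftAcross]

theorem liftAcross_ne (e : D × G) : L.liftAcross e ≠ e := by
  intro h
  have := L.left_across e.1
  rw [show L.across e.1 = e.1 from congrArg Prod.fst h] at this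
  simp at this

/-- The surface covered by the ladders, or rather its lift to the group of the cocycle. -/
def surface : TriangulatedSurface (Kind × (D × G)) where
  rot := ⟨fun x => (rotKind (L.left x.2.1) x.1, x.2),
    fun x => (rotKind (L.left x.2.1) (rotKind (L.left x.2.1) x.1), x.2),
    fun x => by simp [rotKind_rotKind_rotKind], fun x => by simp [rotKind_rotKind_rotKind]⟩
  rot_rot_rot x := by simp [rotKind_rotKind_rotKind]
  rot_ne := by
    rintro ⟨k, e⟩ h
    have := congrArg Prod.fst h
    revert this
    dsimp only [Equiv.coe_fn_mk]
    cases L.left e.1 <;> cases k <;> simp [rotKind]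
  glue := ⟨L.glueSide, L.glueSide, L.glueSide_glueSide, L.glueSide_glueSide⟩
  glue_glue := L.glueSide_glueSide
  glue_ne := by
    rintro ⟨_ | _ | _, e⟩ h
    · simp [glueSide] at h
    · simp [glueSide] at h
    · exact L.liftAcross_ne e (congrArg Prod.snd h)

theorem surface_rot (k : Kind) (e : D × G) :
    L.surface.rot (k, e) = (rotKind (L.left e.1) k, e) := rfl

theorem surface_glue (x : Kind × (D × G)) : L.surface.glue x = L.glueSide x := rfl

theorem sameTriangle_snd {x y : Kind × (D × G)} (h : L.surface.SameTriangle x y) : y.2 = x.2 := by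
  rcases h with rfl | rfl | rfl <;> rfl

theorem strip_liftUp (e : D × G) : L.strip (L.liftUp e) = L.strip e :=
  L.strip_eq_iff.2 (Equiv.Perm.sameCycle_apply_left.2 (Equiv.Perm.SameCycle.refl _ _))

namespace Heights
variable {L} (H : L.Heights)

/-- A triangle lifted to the plane (and to `G`): the triangle, the number of its strip, the height
of the left end of its bottom side, and the lift to `G`. -/
abbrev Lifted (_ : L.Heights) : Type _ := D × (ℤ × ℝ × G)

variable {H}

/-- The height of the right end of the bottom side. -/
def rightHeight (e : H.Lifted) : ℝ := e.2.2.1 + H.slope e.1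

/-- A function that increases on going up in a strip. -/
def sumHeight (e : H.Lifted) : ℝ := e.2.2.1 + rightHeight e

theorem liftUp_eq (e : H.Lifted) : H.toLadderSystem.liftUp e = (L.up e.1, e.2.1,
    e.2.2.1 + (if L.left e.1 then H.width e.1 else 0), e.2.2.2 + L.rise e.1) := by
  simp [liftUp, toLadderSystem, Prod.ext_iff]

theorem rightHeight_liftUp (e : H.Lifted) : rightHeight (H := H) (H.toLadderSystem.liftUp e) =
    rightHeight (H := H) e + if L.left e.1 then 0 else H.width e.1 := by
  rw [liftUp_eq]
  simp only [rightHeight, H.slope_up]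
  split_ifs <;> ring

theorem liftAcross_eq (e : H.Lifted) : H.toLadderSystem.liftAcross e = (L.across e.1,
    e.2.1 + (if L.left e.1 then -1 else 1),
    e.2.2.1 + (if L.left e.1 then -H.slope (L.across e.1) else H.slope e.1),
    e.2.2.2 + L.cross e.1) := by
  simp [liftAcross, toLadderSystem, Prod.ext_iff]

/-- `e` is in the same strip as `e'`, below `e'`. -/
structure Below (e e' : H.Lifted) : Prop where
  left_le : e.2.2.1 ≤ e'.2.2.1
  right_le : rightHeight (H := H) e ≤ rightHeight (H := H) e'
  left_add_le : L.left e.1 = true → e.2.2.1 + H.width e.1 ≤ e'.2.2.1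
  right_add_le : L.left e.1 = false →
    rightHeight (H := H) e + H.width e.1 ≤ rightHeight (H := H) e'

theorem Below.sum_lt {e e' : H.Lifted} (h : Below e e') :
    sumHeight (H := H) e < sumHeight (H := H) e' := by
  have h1 := h.left_le
  have h2 := h.right_le
  have h3 := h.left_add_le
  have h4 := h.right_add_le
  have h5 := H.width_pos e.1
  unfold sumHeight
  cases hl : L.left e.1
  · have := h4 hl; linarith
  · have := h3 hl; linarith

theorem below_liftUp (e : H.Lifted) : Below (H := H) e (H.toLadderSystem.liftUp e) := by
  have h5 := H.width_pos e.1
  have hr := rightHeight_liftUp e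
  constructor
  · rw [liftUp_eq]; dsimp only; split_ifs <;> linarith
  · rw [hr]; split_ifs <;> linarith
  · intro h; rw [liftUp_eq]; simp [h]
  · intro h; rw [hr]; simp [h]

theorem Below.trans {e e' e'' : H.Lifted} (h : Below e e') (h' : Below e' e'') : Below e e'' :=
  ⟨h.left_le.trans h'.left_le, h.right_le.trans h'.right_le,
    fun hl => (h.left_add_le hl).trans h'.left_le,
    fun hl => (h.right_add_le hl).trans h'.right_le⟩

theorem below_liftUp_pow (n : ℕ) (e : H.Lifted) :
    Below (H := H) e ((H.toLadderSystem.liftUp ^ (n + 1)) e) := by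
  induction n with
  | zero => simpa using below_liftUp e
  | succ n ih =>
    rw [pow_succ', Equiv.Perm.mul_apply]
    exact ih.trans (below_liftUp _)

theorem below_trichotomy {e e' : H.Lifted} (h : H.toLadderSystem.liftUp.SameCycle e e') :
    e' = e ∨ Below e e' ∨ Below e' e := by
  obtain ⟨k, rfl⟩ := h
  obtain ⟨n, rfl | rfl⟩ := k.eq_nat_or_neg <;> rcases n with _ | n
  · simp
  · right; left; exact below_liftUp_pow n e
  · simp
  · right; right
    have := below_liftUp_pow (H := H) n ((H.toLadderSystem.liftUp ^ (-((n + 1 : ℕ) : ℤ))) e)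
    rwa [← zpow_natCast, ← Equiv.Perm.mul_apply, ← zpow_add, add_neg_cancel, zpow_zero] at this

variable (H)

/-- The position in the plane of a corner of a lifted triangle. -/
noncomputable def vertex : Kind × H.Lifted → ℤ × ℝ
  | (bot, e) => if L.left e.1 then (e.2.1, e.2.2.1 + H.width e.1)
      else (e.2.1 + 1, rightHeight (H := H) e + H.width e.1)
  | (top, e) => if L.left e.1 then (e.2.1, e.2.2.1) else (e.2.1 + 1, rightHeight (H := H) e)
  | (pole, e) => if L.left e.1 then (e.2.1 + 1, rightHeight (H := H) e) else (e.2.1, e.2.2.1)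

/-- The position in the plane of the lower end of the side of a lifted triangle on a pole. -/
noncomputable def poleBase (e : H.Lifted) : ℤ × ℝ := H.vertex (top, e)

theorem vertex_rot_bot (e : H.Lifted) :
    H.vertex (H.toLadderSystem.surface.rot (bot, e)) = (e.2.1, e.2.2.1) := by
  rw [surface_rot]
  change H.vertex (rotKind (L.left e.1) bot, e) = _
  cases h : L.left e.1 <;> simp [rotKind, vertex, h]

theorem vertex_rot_rot_bot (e : H.Lifted) :
    H.vertex (H.toLadderSystem.surface.rot (H.toLadderSystem.surface.rot (bot, e))) =
      (e.2.1 + 1, rightHeight (H := H) e) := by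
  rw [surface_rot, surface_rot]
  change H.vertex (rotKind (L.left e.1) (rotKind (L.left e.1) bot), e) = _
  cases h : L.left e.1 <;> simp [rotKind, vertex, h]

theorem vertex_rot_top (e : H.Lifted) :
    H.vertex (H.toLadderSystem.surface.rot (top, e)) =
      (e.2.1 + 1, rightHeight (H := H) (H.toLadderSystem.liftUp e)) := by
  rw [surface_rot, rightHeight_liftUp]
  change H.vertex (rotKind (L.left e.1) top, e) = _
  cases h : L.left e.1 <;> simp [rotKind, vertex, h]

theorem vertex_rot_rot_top (e : H.Lifted) :
    H.vertex (H.toLadderSystem.surface.rot (H.toLadderSystem.surface.rot (top, e))) =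
      (e.2.1, e.2.2.1 + if L.left e.1 then H.width e.1 else 0) := by
  rw [surface_rot, surface_rot]
  change H.vertex (rotKind (L.left e.1) (rotKind (L.left e.1) top), e) = _
  cases h : L.left e.1 <;> simp [rotKind, vertex, h]

theorem poleBase_liftAcross (e : H.Lifted) :
    H.poleBase (H.toLadderSystem.liftAcross e) = H.poleBase e := by
  rw [liftAcross_eq]
  cases h : L.left e.1 <;> simp [poleBase, vertex, h, L.left_across, rightHeight]

theorem vertex_rot_pole (e : H.Lifted) :
    H.vertex (H.toLadderSystem.surface.rot (pole, e)) = if L.left e.1 then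
      ((H.poleBase e).1, (H.poleBase e).2 + H.width e.1) else H.poleBase e := by
  rw [surface_rot]
  change H.vertex (rotKind (L.left e.1) pole, e) = _
  cases h : L.left e.1 <;> simp [rotKind, vertex, h, poleBase]

theorem vertex_rot_rot_pole (e : H.Lifted) :
    H.vertex (H.toLadderSystem.surface.rot (H.toLadderSystem.surface.rot (pole, e))) =
      if L.left e.1 then H.poleBase e
      else ((H.poleBase e).1, (H.poleBase e).2 + H.width e.1) := by
  rw [surface_rot, surface_rot]
  change H.vertex (rotKind (L.left e.1) (rotKind (L.left e.1) pole), e) = _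
  cases h : L.left e.1 <;> simp [rotKind, vertex, h, poleBase]

/-- The ends of glued sides have the same coordinates, so `vertex` is well defined on the vertices
of the lifted surface. -/
theorem vertex_rot_glue (x : Kind × H.Lifted) :
    H.vertex (H.toLadderSystem.surface.rot (H.toLadderSystem.surface.glue x)) =
      H.vertex (H.toLadderSystem.surface.rot (H.toLadderSystem.surface.rot x)) := by
  obtain ⟨_ | _ | _, e⟩ := x
  · rw [vertex_rot_rot_top]
    change H.vertex (H.toLadderSystem.surface.rot (bot, _)) = _
    rw [vertex_rot_bot, liftUp_eq]
  · rw [vertex_rot_rot_bot]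
    change H.vertex (H.toLadderSystem.surface.rot (top, _)) = _
    rw [vertex_rot_top, Equiv.apply_symm_apply]
    obtain ⟨e, rfl⟩ := H.toLadderSystem.liftUp.surjective e
    rw [Equiv.symm_apply_apply, liftUp_eq]
  · rw [vertex_rot_rot_pole]
    change H.vertex (H.toLadderSystem.surface.rot (pole, _)) = _
    rw [vertex_rot_pole, poleBase_liftAcross, liftAcross_eq]
    simp only [L.left_across, H.width_across]
    cases h : L.left e.1 <;> simp [h, H.width_across]

/-- The signed number of times that the side `x` crosses a vertical ray that starts at `v`: upwards
if `b = 0`, downwards if `b = 1`. Leaving a triangle through `x` to the right counts as `1`. -/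
noncomputable def rayCrossing (b : ℤ) (v : ℤ × ℝ) : Kind × H.Lifted → ℤ
  | (pole, e) => (if L.left e.1 then -1 else 1) *
      if (H.poleBase e).1 = v.1 then (if v.2 ≤ (H.poleBase e).2 then 1 else 0) - b else 0
  | _ => 0

/-- Whether a lifted triangle is on the same strip as `e`, above or below the bottom side of `e`. -/
noncomputable def aboveBottom (b : ℤ) (e e' : H.Lifted) : ℤ :=
  if e'.2.1 = e.2.1 then b - (if sumHeight (H := H) e ≤ sumHeight (H := H) e' then 1 else 0)
  else 0

/-- The same for any side of a triangle that is not on a pole. -/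
noncomputable def aboveSide (b : ℤ) : Kind × H.Lifted → Kind × H.Lifted → ℤ
  | (bot, e), x => H.aboveBottom b e x.2
  | (top, e), x => -H.aboveBottom b (H.toLadderSystem.liftUp e) x.2
  | (pole, _), _ => 0

theorem rayCrossing_glue (b : ℤ) (v : ℤ × ℝ) (x : Kind × H.Lifted) :
    H.rayCrossing b v (H.toLadderSystem.surface.glue x) = -H.rayCrossing b v x := by
  obtain ⟨_ | _ | _, e⟩ := x
  · rfl
  · rfl
  · change H.rayCrossing b v (pole, _) = _
    simp only [rayCrossing, poleBase_liftAcross]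
    rw [liftAcross_eq]
    cases h : L.left e.1 <;> simp only [h, L.left_across, Bool.not_true, Bool.not_false,
      if_true, if_false, Bool.false_eq_true] <;> ring

theorem aboveSide_glue (b : ℤ) (c x : Kind × H.Lifted) :
    H.aboveSide b (H.toLadderSystem.surface.glue c) x = -H.aboveSide b c x := by
  obtain ⟨_ | _ | _, e⟩ := c
  · exact (neg_neg _).symm
  · change -H.aboveBottom b (H.toLadderSystem.liftUp (H.toLadderSystem.liftUp.symm e)) _ = _
    rw [Equiv.apply_symm_apply]; rfl
  · rfl

/-- The lifted triangles that form a plane: those that lie in the strips `shift ^ n` of `s`, for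
their number `n` of the strip. -/
def OnSheet (s : H.toLadderSystem.Strip) (e : H.Lifted) : Prop :=
  H.toLadderSystem.strip e = (H.toLadderSystem.shift ^ e.2.1) s

variable {H}

theorem OnSheet.liftUp {s : H.toLadderSystem.Strip} {e : H.Lifted} (h : H.OnSheet s e) :
    H.OnSheet s (H.toLadderSystem.liftUp e) := by
  unfold OnSheet
  rw [strip_liftUp, h, liftUp_eq]

theorem OnSheet.liftUp_symm {s : H.toLadderSystem.Strip} {e : H.Lifted} (h : H.OnSheet s e) :
    H.OnSheet s (H.toLadderSystem.liftUp.symm e) := by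
  obtain ⟨e, rfl⟩ := H.toLadderSystem.liftUp.surjective e
  rw [Equiv.symm_apply_apply]
  unfold OnSheet at h
  rwa [strip_liftUp, liftUp_eq] at h

theorem OnSheet.liftAcross {s : H.toLadderSystem.Strip} {e : H.Lifted} (h : H.OnSheet s e) :
    H.OnSheet s (H.toLadderSystem.liftAcross e) := by
  unfold OnSheet
  rw [strip_liftAcross, h, liftAcross_eq, ← Equiv.Perm.mul_apply, ← zpow_add, add_comm]
  rfl

theorem OnSheet.glue {s : H.toLadderSystem.Strip} {x : Kind × H.Lifted} (h : H.OnSheet s x.2) :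
    H.OnSheet s (H.toLadderSystem.surface.glue x).2 := by
  obtain ⟨_ | _ | _, e⟩ := x
  exacts [h.liftUp, h.liftUp_symm, h.liftAcross]

/-- A sheet contains one strip for each column number, so any two of its triangles in one column can
be compared by `below_trichotomy`. -/
theorem OnSheet.sameCycle {s : H.toLadderSystem.Strip} {e e' : H.Lifted} (h : H.OnSheet s e)
    (h' : H.OnSheet s e') (hX : e'.2.1 = e.2.1) : H.toLadderSystem.liftUp.SameCycle e e' := by
  unfold OnSheet at h h'
  rw [← strip_eq_iff, h, h', hX]

/-- Two vertical rays, from the ends of the side `c`, differ by this side and by the boundary of the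
part of the strip above (or below) this side. -/
def RaysAgree (b : ℤ) (c x : Kind × H.Lifted) : Prop :=
  H.rayCrossing b (H.vertex (H.toLadderSystem.surface.rot c)) x -
    H.rayCrossing b (H.vertex (H.toLadderSystem.surface.rot
      (H.toLadderSystem.surface.rot c))) x =
  (open Classical in if x = c then (1 : ℤ) else 0) -
    (open Classical in if H.toLadderSystem.surface.glue x = c then 1 else 0) +
    H.aboveSide b c x - H.aboveSide b c (H.toLadderSystem.surface.glue x)

theorem RaysAgree.of_glue_right {b : ℤ} {c x : Kind × H.Lifted}
    (h : RaysAgree b c (H.toLadderSystem.surface.glue x)) : RaysAgree b c x := by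
  unfold RaysAgree at h ⊢
  rw [rayCrossing_glue, rayCrossing_glue, TriangulatedSurface.glue_glue] at h
  linarith

theorem RaysAgree.of_glue_left {b : ℤ} {c x : Kind × H.Lifted}
    (h : RaysAgree b (H.toLadderSystem.surface.glue c) x) : RaysAgree b c x := by
  classical
  unfold RaysAgree at h ⊢
  rw [aboveSide_glue, aboveSide_glue, vertex_rot_glue, ← vertex_rot_glue H
    (H.toLadderSystem.surface.glue c), TriangulatedSurface.glue_glue] at h
  simp only [EmbeddingLike.apply_eq_iff_eq] at h
  have e : x = H.toLadderSystem.surface.glue c ↔ H.toLadderSystem.surface.glue x = c := by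
    rw [← (H.toLadderSystem.surface.glue).apply_eq_iff_eq, TriangulatedSurface.glue_glue]
  simp only [e] at h
  linarith

/-- Vertical rays do not cross rungs. What remains is that `aboveBottom` changes between consecutive
triangles of the strip only at the rung `c`. -/
theorem raysAgree_bot_bot (b : ℤ) {s : H.toLadderSystem.Strip} {e e' : H.Lifted}
    (he : H.OnSheet s e) (he' : H.OnSheet s (H.toLadderSystem.liftUp e')) :
    RaysAgree b (bot, e) (bot, H.toLadderSystem.liftUp e') := by
  classical
  unfold RaysAgree
  have g : H.toLadderSystem.surface.glue (bot, H.toLadderSystem.liftUp e') = (top, e') := by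
    rw [surface_glue, glueSide, Equiv.symm_apply_apply]
  rw [g]
  simp only [rayCrossing, aboveSide, aboveBottom, Prod.mk.injEq, true_and, reduceCtorEq, false_and,
    if_false]
  have hX : (H.toLadderSystem.liftUp e').2.1 = e'.2.1 := by rw [liftUp_eq]
  rw [hX]
  by_cases h : e'.2.1 = e.2.1
  · rw [if_pos h, if_pos h]
    have hs := he.sameCycle he' (by rw [hX, h])
    have hs' := he.sameCycle (e' := e') (by
      have := he'.liftUp_symm; rwa [Equiv.symm_apply_apply] at this) h
    have hlt := (below_liftUp e').sum_lt
    by_cases heq : H.toLadderSystem.liftUp e' = e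
    · rw [if_pos heq, heq, if_pos le_rfl, if_neg]
      · ring
      · rw [← heq]; exact not_le.2 hlt
    · rw [if_neg heq]
      rcases below_trichotomy hs' with h1 | h1 | h1
      · rw [← h1, if_pos le_rfl, if_pos hlt.le]; ring
      · rw [if_pos h1.sum_lt.le, if_pos (h1.sum_lt.le.trans hlt.le)]; ring
      · rcases below_trichotomy hs with h2 | h2 | h2
        · exact absurd h2 heq
        -- No triangle of a strip lies strictly between `e'` and the next one: `e` would have to fit
        -- its pole side into the single pole side of `e'`.
        · exfalso
          have c1 := h1.left_le
          have c2 := h1.right_le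
          have a1 := h1.left_add_le
          have a2 := h1.right_add_le
          have b1 := h2.left_le
          have b2 := h2.right_le
          have b3 := h2.left_add_le
          have b4 := h2.right_add_le
          have w1 := H.width_pos e.1
          have w2 := H.width_pos e'.1
          rw [rightHeight_liftUp] at b2 b4
          rw [liftUp_eq] at b1 b3
          dsimp only at b1 b3
          cases k1 : L.left e.1 <;> cases k2 : L.left e'.1 <;>
            simp only [k1, k2, if_true, if_false, Bool.false_eq_true, forall_const,
              reduceCtorEq, false_imp_iff, imp_false] at a1 a2 b1 b2 b3 b4 <;> linarith
        · rw [if_neg (not_le.2 h2.sum_lt), if_neg (not_le.2 h1.sum_lt)]; ring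
  · rw [if_neg h, if_neg h, if_neg]
    · ring
    · intro h'; exact h (by rw [← hX, h'])

/-- The side of `e'` lies on the left pole of the strip of `e`, on its right pole, or on neither. On
either pole, being above the end of the rung is equivalent to belonging to a triangle above the
rung. -/
theorem raysAgree_bot_pole (b : ℤ) {s : H.toLadderSystem.Strip} {e e' : H.Lifted}
    (he : H.OnSheet s e) (he' : H.OnSheet s e') (hl : L.left e'.1 = true) :
    RaysAgree b (bot, e) (pole, e') := by
  classical
  unfold RaysAgree
  rw [vertex_rot_bot, vertex_rot_rot_bot]
  have g : H.toLadderSystem.surface.glue (pole, e') =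
      (pole, H.toLadderSystem.liftAcross e') := rfl
  rw [g]
  have hp : H.poleBase e' = (e'.2.1, e'.2.2.1) := by simp [poleBase, vertex, hl]
  have hX : (H.toLadderSystem.liftAcross e').2.1 = e'.2.1 - 1 := by
    rw [liftAcross_eq]; simp [hl, sub_eq_add_neg]
  have hR : rightHeight (H := H) (H.toLadderSystem.liftAcross e') = e'.2.2.1 := by
    rw [liftAcross_eq]; simp [hl, rightHeight]
  have hl' : L.left (H.toLadderSystem.liftAcross e').1 = false := by
    rw [liftAcross_eq]; simp [L.left_across, hl]
  simp only [rayCrossing, aboveSide, aboveBottom, Prod.mk.injEq, reduceCtorEq, false_and,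
    if_false, hp, hl, if_true, hX]
  by_cases h : e'.2.1 = e.2.1
  · have n1 : ¬ e'.2.1 = e.2.1 + 1 := by omega
    have n2 : ¬ e'.2.1 - 1 = e.2.1 := by omega
    rw [if_pos h, if_pos h, if_neg n1, if_neg n2]
    have : (e.2.2.1 ≤ e'.2.2.1) ↔ sumHeight (H := H) e ≤ sumHeight (H := H) e' := by
      rcases below_trichotomy (he.sameCycle he' h) with h1 | h1 | h1
      · simp [h1]
      · simp [h1.left_le, h1.sum_lt.le]
      · have h2 := h1.left_add_le hl
        have := H.width_pos e'.1
        simp only [not_le.2 h1.sum_lt, iff_false, not_le]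
        linarith
    simp only [this]
    ring
  by_cases h' : e'.2.1 = e.2.1 + 1
  · have n2 : e'.2.1 - 1 = e.2.1 := by omega
    rw [if_neg h, if_neg h, if_pos h', if_pos n2]
    have : (rightHeight (H := H) e ≤ e'.2.2.1) ↔ sumHeight (H := H) e ≤
        sumHeight (H := H) (H.toLadderSystem.liftAcross e') := by
      rw [← hR]
      rcases below_trichotomy (he.sameCycle he'.liftAcross (by rw [hX, n2])) with h1 | h1 | h1
      · simp [h1]
      · simp [h1.right_le, h1.sum_lt.le]
      · have h2 := h1.right_add_le hl'
        have := H.width_pos (H.toLadderSystem.liftAcross e').1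
        simp only [not_le.2 h1.sum_lt, iff_false, not_le]
        linarith
    simp only [this]
    ring
  · have n2 : ¬ e'.2.1 - 1 = e.2.1 := by omega
    rw [if_neg h, if_neg h, if_neg h', if_neg n2]
    ring

/-- The two rays lie on one vertical line and differ exactly by the side `c`; different sides on a
pole do not overlap. -/
theorem raysAgree_pole_pole (b : ℤ) {s : H.toLadderSystem.Strip} {e e' : H.Lifted}
    (he : H.OnSheet s e) (he' : H.OnSheet s e') (hl : L.left e.1 = true)
    (hl' : L.left e'.1 = true) : RaysAgree b (pole, e) (pole, e') := by
  classical
  unfold RaysAgree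
  rw [vertex_rot_pole, vertex_rot_rot_pole, if_pos hl, if_pos hl]
  have g : H.toLadderSystem.surface.glue (pole, e') =
      (pole, H.toLadderSystem.liftAcross e') := rfl
  have hp : H.poleBase e' = (e'.2.1, e'.2.2.1) := by simp [poleBase, vertex, hl']
  have hp' : H.poleBase e = (e.2.1, e.2.2.1) := by simp [poleBase, vertex, hl]
  have ne : H.toLadderSystem.liftAcross e' ≠ e := by
    intro h
    have := congrArg (fun e => L.left e.1) h
    rw [liftAcross_eq] at this
    simp [L.left_across, hl, hl'] at this
  rw [g]
  simp only [rayCrossing, aboveSide, Prod.mk.injEq, true_and, ne, if_false, hp, hp', hl',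
    if_true]
  by_cases h : e'.2.1 = e.2.1
  · rw [if_pos h, if_pos h]
    have w1 := H.width_pos e.1
    have w2 := H.width_pos e'.1
    rcases below_trichotomy (he.sameCycle he' h) with h1 | h1 | h1
    · rw [if_pos h1, h1, if_pos le_rfl, if_neg (by linarith)]; ring
    · have h2 := h1.left_add_le hl
      rw [if_pos h2, if_pos (by linarith), if_neg]
      · ring
      · rintro rfl; linarith
    · have h2 := h1.left_add_le hl'
      rw [if_neg (by linarith), if_neg (by linarith), if_neg]
      · ring
      · rintro rfl; linarith
  · rw [if_neg h, if_neg h, if_neg]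
    · ring
    · rintro rfl; exact h rfl

theorem raysAgree_pole_bot (b : ℤ) (e e' : H.Lifted) : RaysAgree b (pole, e) (bot, e') := by
  unfold RaysAgree
  have g : H.toLadderSystem.surface.glue (bot, e') =
      (top, H.toLadderSystem.liftUp.symm e') := rfl
  rw [g, if_neg (fun h => Kind.noConfusion (congrArg Prod.fst h)),
    if_neg (fun h => Kind.noConfusion (congrArg Prod.fst h))]
  simp only [rayCrossing, aboveSide, sub_self, add_zero]

/-- Up to gluing, every side is a bottom side or the pole side of a triangle that has it on the
left. -/
theorem raysAgree (b : ℤ) {s : H.toLadderSystem.Strip} {c x : Kind × H.Lifted}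
    (hc : H.OnSheet s c.2) (hx : H.OnSheet s x.2) : RaysAgree b c x := by
  have nl : ∀ e : H.Lifted, L.left e.1 = false →
      L.left (H.toLadderSystem.liftAcross e).1 = true := by
    intro e h; rw [liftAcross_eq]; simp [L.left_across, h]
  have hbot : ∀ e, H.OnSheet s e → RaysAgree b (bot, e) x := by
    intro e he
    have hb : ∀ e', H.OnSheet s e' → RaysAgree b (bot, e) (bot, e') := by
      intro e' he'
      obtain ⟨e', rfl⟩ := H.toLadderSystem.liftUp.surjective e'
      exact raysAgree_bot_bot b he he'
    obtain ⟨_ | _ | _, e'⟩ := x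
    · exact (hb _ hx.liftUp).of_glue_right
    · exact hb _ hx
    · cases h : L.left e'.1
      · exact (raysAgree_bot_pole b he hx.liftAcross (nl _ h)).of_glue_right
      · exact raysAgree_bot_pole b he hx h
  have hpole : ∀ e, H.OnSheet s e → L.left e.1 = true → RaysAgree b (pole, e) x := by
    intro e he hl
    obtain ⟨_ | _ | _, e'⟩ := x
    · exact RaysAgree.of_glue_right (x := (top, e'))
        (raysAgree_pole_bot b e (H.toLadderSystem.liftUp e'))
    · exact raysAgree_pole_bot b e e'
    · cases h : L.left e'.1
      · exact (raysAgree_pole_pole b he hx.liftAcross hl (nl _ h)).of_glue_right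
      · exact raysAgree_pole_pole b he hx hl h
  obtain ⟨_ | _ | _, e⟩ := c
  · exact RaysAgree.of_glue_left (c := (top, e)) (hbot (H.toLadderSystem.liftUp e) hc.liftUp)
  · exact hbot _ hc
  · cases h : L.left e.1
    · exact RaysAgree.of_glue_left (c := (pole, e))
        (hpole (H.toLadderSystem.liftAcross e) hc.liftAcross (nl _ h))
    · exact hpole _ hc h

end Heights
end LadderSystem

/-! ### Periodic paths in the plane -/

namespace LadderSystem
open Kind

theorem exists_forall_lt_of_add_period {F : ℕ → ℝ} {n : ℕ} (hn : 0 < n) {a : ℝ} (ha : 0 < a)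
    (hF : ∀ j, F (j + n) = F j + a) (B : ℝ) : ∃ N, ∀ j, N ≤ j → B < F j := by
  have h1 : ∀ q r, F (r + q * n) = F r + q * a := by
    intro q r
    induction q with
    | zero => simp
    | succ q ih => rw [Nat.succ_mul, ← add_assoc, hF, ih]; push_cast; ring
  have h2 : ∀ r < n, -∑ i ∈ range n, |F i| ≤ F r := fun r hr => by
    have := Finset.single_le_sum (f := fun i => |F i|) (fun i _ => abs_nonneg (F i))
      (Finset.mem_range.2 hr)
    have := neg_abs_le (F r)
    linarith
  obtain ⟨Q, hQ⟩ := exists_nat_gt ((B + ∑ i ∈ range n, |F i|) / a)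
  rw [div_lt_iff₀ ha] at hQ
  refine ⟨Q * n, fun j hj => ?_⟩
  have h3 := h1 (j / n) (j % n)
  rw [mul_comm, Nat.mod_add_div] at h3
  have h4 := h2 (j % n) (Nat.mod_lt _ hn)
  have h5 : (Q : ℝ) ≤ (j / n : ℕ) := by
    exact_mod_cast (Nat.le_div_iff_mul_le hn).2 hj
  have h6 := mul_le_mul_of_nonneg_right h5 ha.le
  linarith

variable {D G : Type*} [AddCommGroup G] {L : LadderSystem D G}

namespace Heights
variable {H : L.Heights}

/-- The translation of the lifted corners by an element of the group. -/
def shiftCorner (v : ℤ × ℝ × G) (x : Kind × H.Lifted) : Kind × H.Lifted := (x.1, x.2.1, x.2.2 + v)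

theorem vertex_shiftCorner (v : ℤ × ℝ × G) (x : Kind × H.Lifted) :
    H.vertex (shiftCorner (H := H) v x) = H.vertex x + (v.1, v.2.1) := by
  obtain ⟨_ | _ | _, d, X, y, z⟩ := x <;> cases h : L.left d <;>
    refine Prod.ext ?_ ?_ <;> simp [shiftCorner, vertex, h, rightHeight] <;> ring

theorem rayCrossing_shiftCorner (b : ℤ) (v : ℤ × ℝ × G) (w : ℤ × ℝ) (x : Kind × H.Lifted) :
    H.rayCrossing b (w + (v.1, v.2.1)) (shiftCorner (H := H) v x) = H.rayCrossing b w x := by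
  obtain ⟨_ | _ | _, e⟩ := x
  · rfl
  · rfl
  · have : H.poleBase (e.1, e.2 + v) = H.poleBase e + (v.1, v.2.1) :=
      vertex_shiftCorner (H := H) v (top, e)
    simp only [shiftCorner, rayCrossing, this, Prod.fst_add, Prod.snd_add, add_left_inj,
      add_le_add_iff_right]

theorem rayCrossing_eq_zero {b : ℤ} {w : ℤ × ℝ} {x : Kind × H.Lifted} (h1 : x.2.2.1 ≠ w.1)
    (h2 : x.2.2.1 + 1 ≠ w.1) : H.rayCrossing b w x = 0 := by
  obtain ⟨_ | _ | _, e⟩ := x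
  · rfl
  · rfl
  · dsimp only at h1 h2
    simp only [rayCrossing, poleBase, vertex]
    by_cases h : L.left e.1 = true <;> simp [h, h1, h2]

theorem rayCrossing_zero_eq_zero {w : ℤ × ℝ} {x : Kind × H.Lifted} (h1 : x.2.2.2.1 < w.2)
    (h2 : rightHeight (H := H) x.2 < w.2) : H.rayCrossing 0 w x = 0 := by
  obtain ⟨_ | _ | _, e⟩ := x
  · rfl
  · rfl
  · dsimp only at h1 h2
    simp only [rayCrossing, poleBase, vertex]
    by_cases h : L.left e.1 = true <;> simp [h, not_le.2 h1, not_le.2 h2]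

theorem rayCrossing_one_eq_zero {w : ℤ × ℝ} {x : Kind × H.Lifted} (h1 : w.2 ≤ x.2.2.2.1)
    (h2 : w.2 ≤ rightHeight (H := H) x.2) : H.rayCrossing 1 w x = 0 := by
  obtain ⟨_ | _ | _, e⟩ := x
  · rfl
  · rfl
  · dsimp only at h1 h2
    simp only [rayCrossing, poleBase, vertex]
    by_cases h : L.left e.1 = true <;> simp [h, h1, h2]

theorem exists_aboveSide_eq (b : ℤ) (c : Kind × H.Lifted) : ∃ e : H.Lifted, e.2.1 = c.2.2.1 ∧
    ∀ x, H.aboveBottom b e x.2 = 0 → H.aboveSide b c x = 0 := by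
  obtain ⟨_ | _ | _, e⟩ := c
  · exact ⟨H.toLadderSystem.liftUp e, by rw [liftUp_eq], fun x h => by simp [aboveSide, h]⟩
  · exact ⟨e, rfl, fun x h => by simp [aboveSide, h]⟩
  · exact ⟨e, rfl, fun x h => rfl⟩

/-- In the base a triangle may be glued to itself; after lifting, heights strictly increase along a
strip and `across` exchanges left and right. -/
theorem not_sameTriangle_glue (x : Kind × H.Lifted) :
    ¬ H.toLadderSystem.surface.SameTriangle x (H.toLadderSystem.surface.glue x) := by
  intro h
  have h := sameTriangle_snd _ h
  have key : ∀ e : H.Lifted, H.toLadderSystem.liftUp e ≠ e := fun e he => by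
    have := (below_liftUp e).sum_lt
    rw [he] at this
    exact lt_irrefl _ this
  obtain ⟨_ | _ | _, e⟩ := x
  · exact key e h
  · exact key _ ((Equiv.apply_symm_apply _ _).trans (Eq.symm h))
  · exact liftAcross_ne _ e h

end Heights

section Path
variable {H : L.Heights} (γ : H.toLadderSystem.surface.NormalRay)
open Heights

theorem exists_onSheet : ∃ s, ∀ i, H.OnSheet s (γ.corner i).2 := by
  refine ⟨(H.toLadderSystem.shift ^ (-(γ.corner 0).2.2.1)) (H.toLadderSystem.strip
    (γ.corner 0).2), fun i => ?_⟩
  induction i with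
  | zero =>
    unfold OnSheet
    rw [← Equiv.Perm.mul_apply, ← zpow_add, add_neg_cancel, zpow_zero]
    rfl
  | succ i ih =>
    have h1 := sameTriangle_snd _ (γ.sameTriangle_exit i)
    have h2 := sameTriangle_snd _ (γ.sameTriangle_enter (i + 1))
    rw [← h2, γ.enter_succ]
    rw [← h1] at ih
    exact ih.glue

variable {γ} {v : ℤ × ℝ × G} {n : ℕ}

/-- The sides far away on a path are not met by a vertical ray, which goes upwards if `b = 0` and
downwards if `b = 1`. -/
theorem eventually_far (hn : 0 < n)
    (hc : ∀ j, γ.corner (j + n) = shiftCorner (H := H) v (γ.corner j))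
    (hv : v.1 ≠ 0 ∨ v.2.1 ≠ 0) : ∃ b : ℤ, ∀ (w : ℤ × ℝ) (c : Kind × H.Lifted), ∃ N, ∀ j, N ≤ j →
      H.rayCrossing b w (γ.exit j) = 0 ∧ H.aboveSide b c (γ.corner j) = 0 ∧
      ¬ H.toLadderSystem.surface.SameTriangle c (γ.corner j) := by
  have hX : ∀ j, (γ.corner (j + n)).2.2.1 = (γ.corner j).2.2.1 + v.1 := fun j => by
    rw [hc]; rfl
  have hY : ∀ j, (γ.corner (j + n)).2.2.2.1 = (γ.corner j).2.2.2.1 + v.2.1 := fun j => by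
    rw [hc]; rfl
  have hR : ∀ j, rightHeight (H := H) (γ.corner (j + n)).2 =
      rightHeight (H := H) (γ.corner j).2 + v.2.1 := fun j => by
    rw [hc]; simp [shiftCorner, rightHeight]; ring
  have hex : ∀ j, (γ.exit j).2 = (γ.corner j).2 := fun j =>
    sameTriangle_snd _ (γ.sameTriangle_exit j)
  have hs : ∀ (c x : Kind × H.Lifted), H.toLadderSystem.surface.SameTriangle c x → x.2 = c.2 :=
    fun c x h => sameTriangle_snd _ h
  by_cases hv1 : v.1 = 0
  · have hv2 : v.2.1 ≠ 0 := hv.resolve_left (not_not.2 hv1)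
    -- Only the future of the path has to avoid the ray, so the ray points against the vertical
    -- translation.
    rcases lt_or_gt_of_ne hv2 with hneg | hpos
    · refine ⟨0, fun w c => ?_⟩
      obtain ⟨e, -, he⟩ := exists_aboveSide_eq (H := H) 0 c
      have hY' := exists_forall_lt_of_add_period hn (neg_pos.2 hneg)
        (F := fun j => -(γ.corner j).2.2.2.1) (fun j => by rw [hY]; ring)
        (|w.2| + |c.2.2.2.1| + |sumHeight (H := H) e|)
      have hR' := exists_forall_lt_of_add_period hn (neg_pos.2 hneg)
        (F := fun j => -rightHeight (H := H) (γ.corner j).2) (fun j => by rw [hR]; ring)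
        (|w.2| + |c.2.2.2.1| + |sumHeight (H := H) e|)
      obtain ⟨N1, h1⟩ := hY'
      obtain ⟨N2, h2⟩ := hR'
      refine ⟨max N1 N2, fun j hj => ?_⟩
      have h1 := h1 j (le_of_max_le_left hj)
      have h2 := h2 j (le_of_max_le_right hj)
      have a1 := neg_abs_le w.2
      have a2 := neg_abs_le c.2.2.2.1
      have a3 := neg_abs_le (sumHeight (H := H) e)
      have b1 := abs_nonneg w.2
      have b2 := abs_nonneg c.2.2.2.1
      have b3 := abs_nonneg (sumHeight (H := H) e)
      refine ⟨rayCrossing_zero_eq_zero ?_ ?_, he _ ?_, fun h => ?_⟩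
      · rw [hex]; linarith
      · rw [hex]; linarith
      · have hlt : sumHeight (H := H) (γ.corner j).2 < sumHeight (H := H) e := by
          unfold sumHeight at *; linarith
        simp [aboveBottom, not_le.2 hlt]
      · have := hs _ _ h
        rw [this] at h1
        linarith
    · refine ⟨1, fun w c => ?_⟩
      obtain ⟨e, -, he⟩ := exists_aboveSide_eq (H := H) 1 c
      have hY' := exists_forall_lt_of_add_period hn hpos
        (F := fun j => (γ.corner j).2.2.2.1) hY
        (|w.2| + |c.2.2.2.1| + |sumHeight (H := H) e|)
      have hR' := exists_forall_lt_of_add_period hn hpos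
        (F := fun j => rightHeight (H := H) (γ.corner j).2) hR
        (|w.2| + |c.2.2.2.1| + |sumHeight (H := H) e|)
      obtain ⟨N1, h1⟩ := hY'
      obtain ⟨N2, h2⟩ := hR'
      refine ⟨max N1 N2, fun j hj => ?_⟩
      have h1 := h1 j (le_of_max_le_left hj)
      have h2 := h2 j (le_of_max_le_right hj)
      have a1 := le_abs_self w.2
      have a2 := le_abs_self c.2.2.2.1
      have a3 := le_abs_self (sumHeight (H := H) e)
      have b1 := abs_nonneg w.2
      have b2 := abs_nonneg c.2.2.2.1
      have b3 := abs_nonneg (sumHeight (H := H) e)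
      refine ⟨rayCrossing_one_eq_zero ?_ ?_, he _ ?_, fun h => ?_⟩
      · rw [hex]; linarith
      · rw [hex]; linarith
      · unfold aboveBottom
        rw [if_pos (show sumHeight (H := H) e ≤ sumHeight (H := H) (γ.corner j).2 by
          unfold sumHeight at *; linarith)]
        simp
      · have := hs _ _ h
        rw [this] at h1
        linarith
  -- With a horizontal component the path leaves every column for good, and either ray would do.
  · refine ⟨0, fun w c => ?_⟩
    have hX' : ∃ N, ∀ j, N ≤ j → (|w.1| + |c.2.2.1| + 1 : ℝ) < |(γ.corner j).2.2.1| := by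
      rcases lt_or_gt_of_ne hv1 with hneg | hpos
      · obtain ⟨N, h⟩ := exists_forall_lt_of_add_period hn
          (neg_pos.2 (Int.cast_lt_zero.2 hneg : (v.1 : ℝ) < 0))
          (F := fun j => -((γ.corner j).2.2.1 : ℝ)) (fun j => by rw [hX]; push_cast; ring)
          (|w.1| + |c.2.2.1| + 1 : ℝ)
        exact ⟨N, fun j hj => (h j hj).trans_le (by exact_mod_cast neg_le_abs _)⟩
      · obtain ⟨N, h⟩ := exists_forall_lt_of_add_period hn
          (Int.cast_pos.2 hpos : 0 < (v.1 : ℝ))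
          (F := fun j => ((γ.corner j).2.2.1 : ℝ)) (fun j => by rw [hX]; push_cast; ring)
          (|w.1| + |c.2.2.1| + 1 : ℝ)
        exact ⟨N, fun j hj => (h j hj).trans_le (by exact_mod_cast le_abs_self _)⟩
    obtain ⟨N, h⟩ := hX'
    refine ⟨N, fun j hj => ?_⟩
    have h1 : |w.1| + |c.2.2.1| + 1 < |(γ.corner j).2.2.1| := by exact_mod_cast h j hj
    have b1 := abs_nonneg w.1
    have b2 := abs_nonneg c.2.2.1
    obtain ⟨e, he0, he⟩ := exists_aboveSide_eq (H := H) 0 c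
    refine ⟨rayCrossing_eq_zero ?_ ?_, he _ ?_, fun h => ?_⟩
    · rw [hex]; intro h; rw [h] at h1; omega
    · rw [hex]; intro h
      rw [← h] at h1 b1
      rcases abs_cases (γ.corner j).2.2.1 with ⟨q, -⟩ | ⟨q, -⟩ <;>
      rcases abs_cases ((γ.corner j).2.2.1 + 1) with ⟨q', -⟩ | ⟨q', -⟩ <;> omega
    · unfold aboveBottom
      rw [if_neg]
      rw [he0]; intro h; rw [h] at h1; omega
    · rw [hs _ _ h] at h1; omega

/-- This is `umlaufsatz` for vertical rays. A left turn keeps the vertex on the left; a right turn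
moves it along the side `corner i`, where `raysAgree` compares the two rays. -/
theorem exists_sum_eq_zero (hγ : γ.IsEmbedded) (hn : 0 < n)
    (hc : ∀ j, γ.corner (j + n) = shiftCorner (H := H) v (γ.corner j))
    (hl : ∀ j, γ.left (j + n) = γ.left j) (hp : ∀ j, γ.pos (j + n) = γ.pos j)
    (hv : v.1 ≠ 0 ∨ v.2.1 ≠ 0) : ∃ b : ℤ, ∑ i ∈ range n,
      (-H.rayCrossing b (H.vertex (H.toLadderSystem.surface.rot (γ.enter i))) (γ.exit i) +
        if γ.left i then 0 else H.aboveSide b (γ.corner i) (γ.corner (i + 1))) = 0 := by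
  obtain ⟨b, hb⟩ := eventually_far hn hc hv
  obtain ⟨s, hs⟩ := exists_onSheet γ
  refine ⟨b, γ.umlaufsatz hγ not_sameTriangle_glue
    (fun i => H.rayCrossing b (H.vertex (H.toLadderSystem.surface.rot (γ.enter i))))
    (fun i => H.aboveSide b (γ.corner i)) ?_ ?_ ?_
    (fun i => hb _ _) n (shiftCorner (H := H) v) ?_ ?_ hc hl hp
    ?_⟩
  · intro i x
    rcases γ.corner i with ⟨_ | _ | _, e⟩ <;> rfl
  · intro i hi j
    rw [γ.enter_succ, vertex_rot_glue]
    simp only [TriangulatedSurface.NormalRay.exit, TriangulatedSurface.NormalRay.enter, hi, if_true]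
  · intro i hi j
    have he : H.OnSheet s (γ.exit j).2 := by
      rw [sameTriangle_snd _ (γ.sameTriangle_exit j)]; exact hs j
    have h := raysAgree b (hs i) he
    unfold RaysAgree at h
    refine Eq.trans ?_ (h.trans (by congr!))
    rw [γ.enter_succ, vertex_rot_glue]
    simp only [TriangulatedSurface.NormalRay.exit, TriangulatedSurface.NormalRay.enter, hi,
      Bool.false_eq_true, if_false, TriangulatedSurface.rot_rot_rot]
  · rintro ⟨k, d, g⟩ ⟨k', d', g'⟩ h
    simpa only [shiftCorner, Prod.mk.injEq, add_left_inj] using h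
  · intro x; rfl
  · intro j
    have hfx : γ.exit (j + n) = shiftCorner (H := H) v (γ.exit j) := by
      unfold TriangulatedSurface.NormalRay.exit; rw [hl, hc]; split_ifs <;> rfl
    have hfe : γ.enter (0 + n) = shiftCorner (H := H) v (γ.enter 0) := by
      unfold TriangulatedSurface.NormalRay.enter; rw [hl, hc]; split_ifs <;> rfl
    rw [zero_add] at hfe
    rw [hfx, hfe]
    change H.rayCrossing b (H.vertex (shiftCorner (H := H) v
      (H.toLadderSystem.surface.rot (γ.enter 0)))) _ = _
    rw [vertex_shiftCorner, rayCrossing_shiftCorner]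

end Path
end LadderSystem

/-! ### The turning of an arc and the turning number of a periodic path -/

namespace LadderSystem
open Kind Heights

variable {D G : Type*} [AddCommGroup G] {L : LadderSystem D G} {H : L.Heights}

/-- The direction in which a path enters a triangle through a side, relative to the direction `sgn`
along the ladder. -/
def enterDir (L : LadderSystem D G) (sgn : D → Bool) (b : ℤ) : Kind × H.Lifted → ℤ
  | (bot, _) => 3 - 2 * b
  | (top, _) => 1 + 2 * b
  | (pole, e) => if L.left e.1 then (2 - 2 * b) - (if sgn e.1 then 1 else -1)
      else 2 * b + if sgn e.1 then 1 else -1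

/-- The direction in which a path leaves a triangle through a side. -/
def exitDir (L : LadderSystem D G) (sgn : D → Bool) (b : ℤ) : Kind × H.Lifted → ℤ
  | (top, _) => 3 - 2 * b
  | (bot, _) => 1 + 2 * b
  | (pole, e) => if L.left e.1 then 2 * b - (if sgn e.1 then 1 else -1)
      else (2 - 2 * b) + if sgn e.1 then 1 else -1

theorem enterDir_glue {sgn : D → Bool} (hs : ∀ d, sgn (L.across d) = !sgn d) (b : ℤ)
    (x : Kind × H.Lifted) :
    enterDir (H := H) L sgn b (H.toLadderSystem.surface.glue x) = exitDir (H := H) L sgn b x := by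
  obtain ⟨_ | _ | _, e⟩ := x
  · rfl
  · rfl
  · change enterDir (H := H) L sgn b (pole, H.toLadderSystem.liftAcross e) = _
    simp only [enterDir, exitDir]
    rw [liftAcross_eq]
    cases h : L.left e.1 <;> cases h' : sgn e.1 <;> simp [h, h', L.left_across, hs] <;> ring

/-- The corners with angle `π`. -/
def IsStraight (sgn : D → Bool) (x : Kind × H.Lifted) : Prop :=
  x.1 = if sgn x.2.1 then bot else top

theorem aboveSide_congr (b : ℤ) (c : Kind × H.Lifted) {x y : Kind × H.Lifted} (h : x.2 = y.2) :
    H.aboveSide b c x = H.aboveSide b c y := by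
  obtain ⟨_ | _ | _, e⟩ := c <;> simp [aboveSide, h]

theorem aboveBottom_liftUp (b : ℤ) (e : H.Lifted) :
    H.aboveBottom b e (H.toLadderSystem.liftUp e) = b - 1 := by
  unfold aboveBottom
  rw [if_pos (by rw [liftUp_eq]), if_pos (below_liftUp e).sum_lt.le]

theorem aboveBottom_liftUp_symm (b : ℤ) (e : H.Lifted) :
    H.aboveBottom b (H.toLadderSystem.liftUp e) (H.toLadderSystem.liftUp.symm e) = b := by
  obtain ⟨e, rfl⟩ := H.toLadderSystem.liftUp.surjective e
  rw [Equiv.symm_apply_apply]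
  unfold aboveBottom
  rw [if_pos (by rw [liftUp_eq, liftUp_eq]), if_neg, sub_zero]
  exact not_le.2 ((below_liftUp e).sum_lt.trans (below_liftUp _).sum_lt)

theorem aboveBottom_liftAcross (b : ℤ) (e : H.Lifted) :
    H.aboveBottom b e (H.toLadderSystem.liftAcross e) = 0 := by
  unfold aboveBottom
  rw [if_neg]
  rw [liftAcross_eq]
  split_ifs <;> simp

theorem aboveBottom_liftUp_liftAcross (b : ℤ) (e : H.Lifted) :
    H.aboveBottom b (H.toLadderSystem.liftUp e) (H.toLadderSystem.liftAcross e) = 0 := by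
  unfold aboveBottom
  rw [if_neg]
  rw [liftAcross_eq, liftUp_eq]
  split_ifs <;> simp

-- Directions are counted in units of `π / 2`, so a straight corner turns by `2` and a full turn is
-- `4`. As all angles are `0` or `π`, every direction is odd. The integers chosen for the directions
-- are consistent except for full turns, which the ray terms supply. The two equations treat an arc
-- with `c` to its left and one with `c` to its right.
open Classical in
theorem turn_eq (sgn : D → Bool) (b : ℤ) (c : Kind × H.Lifted) :
    (2 * (if IsStraight (H := H) sgn c then 1 else 0) =
      4 * -H.rayCrossing b (H.vertex c) (H.toLadderSystem.surface.rot c) +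
      exitDir (H := H) L sgn b (H.toLadderSystem.surface.rot c) -
      enterDir (H := H) L sgn b
        (H.toLadderSystem.surface.rot (H.toLadderSystem.surface.rot c))) ∧
    (-2 * (if IsStraight (H := H) sgn c then 1 else 0) =
      4 * (-H.rayCrossing b (H.vertex (H.toLadderSystem.surface.rot
          (H.toLadderSystem.surface.rot c)))
          (H.toLadderSystem.surface.rot (H.toLadderSystem.surface.rot c)) +
        H.aboveSide b c (H.toLadderSystem.surface.glue
          (H.toLadderSystem.surface.rot (H.toLadderSystem.surface.rot c)))) +
      exitDir (H := H) L sgn b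
        (H.toLadderSystem.surface.rot (H.toLadderSystem.surface.rot c)) -
      enterDir (H := H) L sgn b (H.toLadderSystem.surface.rot c)) := by
  have hl : H.toLadderSystem.left = L.left := rfl
  obtain ⟨k, e⟩ := c
  have hw := H.width_pos e.1
  simp only [surface_rot, hl, surface_glue]
  cases h : L.left e.1 <;> cases h' : sgn e.1 <;> cases k <;>
    simp [h, h', rotKind, IsStraight, enterDir, exitDir, rayCrossing, aboveSide, glueSide,
      aboveBottom_liftUp, aboveBottom_liftUp_symm, aboveBottom_liftAcross,
      aboveBottom_liftUp_liftAcross, poleBase, vertex, hw, hw.le, not_le.2 hw] <;>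
    (try constructor) <;> ring

end LadderSystem

namespace LadderSystem
open Kind Heights

variable {D G : Type*} [AddCommGroup G] {L : LadderSystem D G} {H : L.Heights}
  {γ : H.toLadderSystem.surface.NormalRay} {v : ℤ × ℝ × G} {n : ℕ}

theorem enterDir_shiftCorner (sgn : D → Bool) (b : ℤ) (x : Kind × H.Lifted) :
    enterDir (H := H) L sgn b (shiftCorner (H := H) v x) = enterDir (H := H) L sgn b x := by
  obtain ⟨_ | _ | _, e⟩ := x <;> rfl

open Classical in
/-- The turning number of an embedded periodic path in the plane is zero. -/
theorem sum_straight_eq_zero (hγ : γ.IsEmbedded) (hn : 0 < n)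
    (hc : ∀ j, γ.corner (j + n) = shiftCorner (H := H) v (γ.corner j))
    (hl : ∀ j, γ.left (j + n) = γ.left j) (hp : ∀ j, γ.pos (j + n) = γ.pos j)
    (hv : v.1 ≠ 0 ∨ v.2.1 ≠ 0) {sgn : D → Bool} (hs : ∀ d, sgn (L.across d) = !sgn d) :
    ∑ i ∈ range n, (if γ.left i then (1 : ℤ) else -1) *
      (if IsStraight (H := H) sgn (γ.corner i) then 1 else 0) = 0 := by
  obtain ⟨b, hb⟩ := exists_sum_eq_zero hγ hn hc hl hp hv
  have key : ∀ i, 2 * ((if γ.left i then (1 : ℤ) else -1) *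
      (if IsStraight (H := H) sgn (γ.corner i) then 1 else 0)) =
      4 * (-H.rayCrossing b (H.vertex (H.toLadderSystem.surface.rot (γ.enter i))) (γ.exit i) +
        if γ.left i then 0 else H.aboveSide b (γ.corner i) (γ.corner (i + 1))) +
      (enterDir (H := H) L sgn b (γ.enter (i + 1)) - enterDir (H := H) L sgn b (γ.enter i)) := by
    intro i
    have h := turn_eq (H := H) sgn b (γ.corner i)
    have h1 : enterDir (H := H) L sgn b (γ.enter (i + 1)) =
        exitDir (H := H) L sgn b (γ.exit i) := by
      rw [γ.enter_succ, enterDir_glue hs]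
    have h2 : (γ.corner (i + 1)).2 = (H.toLadderSystem.surface.glue (γ.exit i)).2 := by
      rw [← γ.enter_succ, sameTriangle_snd _ (γ.sameTriangle_enter (i + 1))]
    rw [h1, aboveSide_congr b _ h2]
    unfold TriangulatedSurface.NormalRay.exit TriangulatedSurface.NormalRay.enter
    by_cases hi : γ.left i = true
    · simp only [hi, if_true, TriangulatedSurface.rot_rot_rot]
      linarith [h.1]
    · simp only [hi, if_false, Bool.false_eq_true]
      linarith [h.2]
  have he : γ.enter (0 + n) = shiftCorner (H := H) v (γ.enter 0) := by
    unfold TriangulatedSurface.NormalRay.enter; rw [hl, hc]; split_ifs <;> rfl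
  -- The local terms vanish in total by `hb`, and the directions telescope to a difference that is
  -- zero since translations preserve directions.
  have h := Finset.sum_congr rfl fun i (_ : i ∈ range n) => key i
  rw [← Finset.mul_sum, Finset.sum_add_distrib, ← Finset.mul_sum, hb,
    Finset.sum_range_sub (fun i => enterDir (H := H) L sgn b (γ.enter i)), ← zero_add n, he,
    enterDir_shiftCorner] at h
  simpa using h

end LadderSystem

/-! ### Veering colourings and their ladders -/

namespace TriangulatedSurface
variable {C : Type*} (S : TriangulatedSurface C)

/-- The surface with the opposite orientation. -/
def mirror : TriangulatedSurface C where
  rot := S.rot⁻¹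
  rot_rot_rot c := by rw [Equiv.Perm.inv_eq_iff_eq, Equiv.Perm.inv_eq_iff_eq,
    Equiv.Perm.inv_eq_iff_eq, S.rot_rot_rot]
  rot_ne c h := S.rot_ne c (Equiv.Perm.inv_eq_iff_eq.1 h).symm
  glue := S.glue
  glue_glue := S.glue_glue
  glue_ne := S.glue_ne

theorem mirror_rot (c : C) : S.mirror.rot c = S.rot (S.rot c) := by
  change S.rot⁻¹ c = _
  rw [Equiv.Perm.inv_eq_iff_eq, S.rot_rot_rot]

theorem mirror_glue : S.mirror.glue = S.glue := rfl

theorem vertexRot_apply (c : C) : S.vertexRot c = S.rot (S.glue (S.rot c)) := rfl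

theorem vertexRot_mirror (c : C) : S.vertexRot (S.mirror.vertexRot c) = c := by
  simp only [vertexRot_apply, mirror_rot, mirror_glue, S.rot_rot_rot, S.glue_glue]

theorem mirror_vertexRot : S.mirror.vertexRot = S.vertexRot⁻¹ := by
  ext c
  rw [Equiv.Perm.eq_inv_iff_eq, vertexRot_mirror]

/-- A cocycle on the dual cell decomposition. -/
structure Cocycle (G : Type*) [AddCommGroup G] where
  val : C → G
  val_glue : ∀ s, val (S.glue s) = -val s
  sum_eq_zero : ∀ c K, S.vertexRot^[K] c = c →
    ∑ j ∈ range K, val (S.rot (S.vertexRot^[j] c)) = 0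

variable {S} {G : Type*} [AddCommGroup G]

/-- The same cocycle on the surface with the opposite orientation. -/
def Cocycle.mirror (ζ : S.Cocycle G) : S.mirror.Cocycle G where
  val := ζ.val
  val_glue := ζ.val_glue
  sum_eq_zero c K h := by
    have h1 : ∀ j, ζ.val (S.mirror.rot (S.mirror.vertexRot^[j] c)) =
        -ζ.val (S.rot (S.mirror.vertexRot^[j + 1] c)) := fun j => by
      rw [← ζ.val_glue, Function.iterate_succ_apply', vertexRot_apply]
      simp only [mirror_rot, mirror_glue, S.rot_rot_rot]
      rw [S.glue_glue]
    have h2 : ∀ i m, i ≤ m → S.vertexRot^[i] (S.mirror.vertexRot^[m] c) =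
        S.mirror.vertexRot^[m - i] c := by
      intro i m him
      induction i with
      | zero => rfl
      | succ i ih =>
        rw [Function.iterate_succ_apply', ih (by omega),
          show m - i = (m - (i + 1)) + 1 by omega, Function.iterate_succ_apply',
          vertexRot_mirror]
    have h3 : S.vertexRot^[K] c = c := by
      conv_lhs => rw [← h, h2 K K le_rfl]
      simp
    rw [sum_congr rfl fun j _ => h1 j, sum_neg_distrib, neg_eq_zero, ← ζ.sum_eq_zero c K h3,
      ← sum_range_reflect]
    refine sum_congr rfl fun j hj => ?_
    have hj := mem_range.1 hj
    have : K - 1 - j + 1 = K - j := by omega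
    rw [this, ← h2 j K hj.le, h]

variable (S)


/-- A corner is straight if the next vertex of its triangle has the first and the last vertex
has the second colour. -/
def StraightFor (color : C → Bool) (x : C) : Prop :=
  color (S.rot x) = true ∧ color (S.rot (S.rot x)) = false

/-- A colouring of the vertices by two colours, such that no triangle has all its vertices of the
same colour and each vertex has two straight corners. -/
structure Veering where
  color : C → Bool
  color_vertexRot : ∀ c, color (S.vertexRot c) = color c
  exists_straight : ∀ c, ∃ x, S.SameTriangle c x ∧ S.StraightFor color x
  two : ∀ c, ∃ p q, p ≠ q ∧ S.vertexRot.SameCycle c p ∧ S.vertexRot.SameCycle c q ∧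
    S.StraightFor color p ∧ S.StraightFor color q ∧
    ∀ r, S.vertexRot.SameCycle c r → S.StraightFor color r → r = p ∨ r = q

namespace Veering
variable {S} (κ : S.Veering)

theorem straightFor_mirror (x : C) :
    S.mirror.StraightFor (fun c => !κ.color c) x ↔ S.StraightFor κ.color x := by
  simp only [StraightFor, mirror_rot, S.rot_rot_rot, Bool.not_eq_true', Bool.not_eq_false']
  exact and_comm

/-- The same colouring on the surface with the opposite orientation, with the colours exchanged. -/
def mirror : S.mirror.Veering where
  color c := !κ.color c
  color_vertexRot c := by rw [← κ.color_vertexRot (S.mirror.vertexRot c), vertexRot_mirror]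
  exists_straight c := by
    obtain ⟨x, h, h'⟩ := κ.exists_straight c
    refine ⟨x, ?_, (κ.straightFor_mirror x).2 h'⟩
    unfold SameTriangle at *
    simp only [mirror_rot, S.rot_rot_rot]
    tauto
  two c := by
    simpa only [κ.straightFor_mirror, mirror_vertexRot, Equiv.Perm.sameCycle_inv] using κ.two c

/-- The corners with angle `π`, one in each triangle. -/
def Straight (x : C) : Prop := S.StraightFor κ.color x

/-- The side across which the next triangle up the ladder lies. The triangle of the straight corner
`p` is a rung of a ladder, with the bottom side `p`; the poles of the ladder join vertices of the
same colour. -/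
def top (p : C) : C := if κ.color p then S.rot p else S.rot (S.rot p)

/-- The side on a pole of the ladder. -/
def pole (p : C) : C := if κ.color p then S.rot (S.rot p) else S.rot p

/-- The next triangle up the ladder. -/
def up (p : C) : C := S.glue (κ.top p)

/-- The adjacent triangle in the next ladder. -/
def across (p : C) : C :=
  if κ.color p then S.rot (S.glue (κ.pole p)) else S.rot (S.rot (S.glue (κ.pole p)))

theorem mirror_straight (p : C) : κ.mirror.Straight p ↔ κ.Straight p := κ.straightFor_mirror p

theorem mirror_color (p : C) : κ.mirror.color p = !κ.color p := rfl

theorem mirror_top : κ.mirror.top = κ.top := by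
  ext p
  cases h : κ.color p <;> simp [top, mirror_color, h, mirror_rot, S.rot_rot_rot]

theorem mirror_pole : κ.mirror.pole = κ.pole := by
  ext p
  cases h : κ.color p <;> simp [pole, mirror_color, h, mirror_rot, S.rot_rot_rot]

theorem mirror_up : κ.mirror.up = κ.up := by
  ext p
  simp [up, mirror_top, mirror_glue]

theorem mirror_across : κ.mirror.across = κ.across := by
  ext p
  cases h : κ.color p <;>
    simp [across, mirror_color, mirror_pole, h, mirror_rot, S.rot_rot_rot, mirror_glue]

theorem color_rot_glue (c : C) : κ.color (S.rot (S.glue c)) = κ.color (S.rot (S.rot c)) := by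
  have := κ.color_vertexRot (S.rot (S.rot c))
  rwa [vertexRot_apply, S.rot_rot_rot] at this

theorem color_rot_rot_glue (c : C) :
    κ.color (S.rot (S.rot (S.glue c))) = κ.color (S.rot c) := by
  rw [← κ.color_rot_glue, S.glue_glue]

theorem color_eq_not {c : C} (h : κ.color (S.rot c) = κ.color (S.rot (S.rot c))) :
    κ.color c = !κ.color (S.rot c) := by
  obtain ⟨x, hx, h1, h2⟩ := κ.exists_straight c
  rcases hx with rfl | rfl | rfl
  · rw [h1, h2] at h
    exact Bool.noConfusion h
  · rw [S.rot_rot_rot] at h2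
    rw [h, h1, h2]
    rfl
  · rw [S.rot_rot_rot] at h1 h2
    rw [h1, h2]
    rfl

variable {κ}

theorem Straight.not_rot {p : C} (h : κ.Straight p) : ¬ κ.Straight (S.rot p) := fun h' => by
  have h1 := h.2
  have h2 := h'.1
  rw [h1] at h2
  exact Bool.noConfusion h2

theorem Straight.not_rot_rot {p : C} (h : κ.Straight p) : ¬ κ.Straight (S.rot (S.rot p)) :=
  fun h' => h'.not_rot (by rwa [S.rot_rot_rot])

theorem Straight.eq_of_sameTriangle {p q : C} (hp : κ.Straight p) (hq : κ.Straight q)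
    (h : S.SameTriangle p q) : q = p := by
  rcases h with h | rfl | rfl
  · exact h
  · exact absurd hq hp.not_rot
  · exact absurd hq hp.not_rot_rot

theorem Straight.up {p : C} (h : κ.Straight p) : κ.Straight (κ.up p) := by
  have h1 := h.1
  have h2 := h.2
  unfold Straight StraightFor Veering.up top
  cases hc : κ.color p <;>
    simp [hc, h1, h2, color_rot_glue, color_rot_rot_glue, S.rot_rot_rot]

theorem Straight.up_iterate {p : C} (h : κ.Straight p) (n : ℕ) : κ.Straight (κ.up^[n] p) := by
  induction n with
  | zero => exact h
  | succ n ih => rw [Function.iterate_succ_apply']; exact ih.up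

theorem Straight.color_across {p : C} (h : κ.Straight p) :
    κ.color (κ.across p) = κ.color p := by
  have h1 := h.1
  have h2 := h.2
  unfold Veering.across pole
  cases hc : κ.color p <;>
    simp [hc, h1, h2, color_rot_glue, color_rot_rot_glue, S.rot_rot_rot]

/-- The two triangles share a monochromatic side, so in both of them the third vertex has the other
colour, and this determines the straight corner. -/
theorem Straight.across {p : C} (h : κ.Straight p) : κ.Straight (κ.across p) := by
  have h1 := h.1
  have h2 := h.2
  have h3 := h.color_across
  unfold Straight StraightFor
  have h4 := κ.color_eq_not (c := S.glue (κ.pole p))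
  revert h3 h4
  unfold Veering.across pole
  cases hc : κ.color p <;>
    simp [hc, h1, h2, color_rot_glue, color_rot_rot_glue, S.rot_rot_rot]

theorem Straight.pole_across {p : C} (h : κ.Straight p) :
    κ.pole (κ.across p) = S.glue (κ.pole p) := by
  have h3 := h.color_across
  conv_lhs => unfold pole
  rw [h3]
  unfold Veering.across
  cases hc : κ.color p <;> simp [hc, S.rot_rot_rot]

theorem Straight.across_across {p : C} (h : κ.Straight p) : κ.across (κ.across p) = p := by
  change (if κ.color (κ.across p) then S.rot (S.glue (κ.pole (κ.across p)))
    else S.rot (S.rot (S.glue (κ.pole (κ.across p))))) = p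
  rw [h.color_across, h.pole_across, S.glue_glue]
  unfold pole
  cases hc : κ.color p <;> simp [hc, S.rot_rot_rot]

theorem Straight.across_ne {p : C} (h : κ.Straight p) : κ.across p ≠ p := fun h' =>
  S.glue_ne _ (h.pole_across.symm.trans (congrArg κ.pole h'))

theorem Straight.up_injective {p q : C} (hp : κ.Straight p) (hq : κ.Straight q)
    (h : κ.up p = κ.up q) : p = q := by
  have h := S.glue.injective h
  unfold top at h
  cases hc : κ.color p <;> cases hc' : κ.color q <;> simp [hc, hc'] at h
  · exact h
  · exact absurd (h ▸ hp.not_rot : ¬ κ.Straight q) (not_not.2 hq)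
  · exact absurd (h ▸ hq.not_rot : ¬ κ.Straight p) (not_not.2 hp)
  · exact h

theorem Straight.vertexRot {p : C} (hc : κ.color p = true) :
    S.vertexRot p = S.rot (κ.up p) := by
  simp [vertexRot_apply, Veering.up, top, hc]

theorem vertexRot_rot_of_false {q : C} (hc : κ.color q = false) :
    S.vertexRot (S.rot q) = S.rot (κ.up q) := by
  simp [vertexRot_apply, Veering.up, top, hc]

theorem vertexRot_rot_of_true {q : C} (hc : κ.color q = true) :
    S.vertexRot (S.rot q) = κ.across q := by
  simp [vertexRot_apply, Veering.across, pole, hc]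

/-- Turning around the vertex of `p` climbs the ladder: the triangles above `p` all have this vertex
as corner `rot`, up to the first one with a side on the same pole. -/
theorem vertexRot_iterate {p : C} {k : ℕ} (hc : κ.color p = true)
    (hk : ∀ j, 0 < j → j < k → κ.color (κ.up^[j] p) = false) (j : ℕ) (hj : 0 < j) (hjk : j ≤ k) :
    S.vertexRot^[j] p = S.rot (κ.up^[j] p) := by
  induction j with
  | zero => omega
  | succ j ih =>
    rw [Function.iterate_succ_apply', Function.iterate_succ_apply']
    rcases j.eq_zero_or_pos with rfl | h0
    · exact Straight.vertexRot hc
    · rw [ih h0 (by omega), vertexRot_rot_of_false (hk j h0 (by omega))]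

theorem vertexRot_iterate_succ {p : C} {k : ℕ} (hc : κ.color p = true) (h0 : 0 < k)
    (hk : ∀ j, 0 < j → j < k → κ.color (κ.up^[j] p) = false) (h : κ.color (κ.up^[k] p) = true) :
    S.vertexRot^[k + 1] p = κ.across (κ.up^[k] p) := by
  rw [Function.iterate_succ_apply', vertexRot_iterate hc hk k h0 le_rfl, vertexRot_rot_of_true h]

theorem sum_vertexRot (ζ : S.Cocycle G) {p : C} {k : ℕ} (hc : κ.color p = true) (h0 : 0 < k)
    (hk : ∀ j, 0 < j → j < k → κ.color (κ.up^[j] p) = false) (h : κ.color (κ.up^[k] p) = true) :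
    ∑ j ∈ range (k + 1), ζ.val (S.rot (S.vertexRot^[j] p)) =
      ∑ j ∈ range k, ζ.val (κ.top (κ.up^[j] p)) + ζ.val (κ.pole (κ.up^[k] p)) := by
  rw [sum_range_succ, vertexRot_iterate hc hk k h0 le_rfl]
  congr 1
  · refine sum_congr rfl fun j hj => ?_
    have hj := mem_range.1 hj
    rcases j.eq_zero_or_pos with rfl | hj0
    · simp [top, hc]
    · rw [vertexRot_iterate hc hk j hj0 hj.le]
      simp [top, hk j hj0 hj]
  · simp [pole, h]

theorem eq_of_straight_iterate {p : C} {k : ℕ} (hp : κ.Straight p) (hc : κ.color p = true)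
    (hk : ∀ j, 0 < j → j < k → κ.color (κ.up^[j] p) = false) {j : ℕ} (hj : j ≤ k)
    (h : κ.Straight (S.vertexRot^[j] p)) : j = 0 := by
  by_contra h0
  rw [vertexRot_iterate hc hk j (by omega) hj] at h
  exact (hp.up_iterate j).not_rot h

theorem sameCycle_iterate (p : C) (n : ℕ) : S.vertexRot.SameCycle p (S.vertexRot^[n] p) :=
  ⟨n, by rw [zpow_natCast, Equiv.Perm.iterate_eq_pow]⟩

theorem exists_iterate_lt {p r : C} {n : ℕ} (hn : 0 < n) (h : S.vertexRot^[n] p = p)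
    (hr : S.vertexRot.SameCycle p r) : ∃ j < n, S.vertexRot^[j] p = r := by
  obtain ⟨z, rfl⟩ := hr
  have hn' : (0 : ℤ) < n := by exact_mod_cast hn
  refine ⟨(z % n).toNat, ?_, ?_⟩
  · have := Int.emod_lt_of_pos z hn'
    have := Int.emod_nonneg z hn'.ne'
    omega
  · rw [Equiv.Perm.iterate_eq_pow, ← zpow_natCast, Int.toNat_of_nonneg (Int.emod_nonneg z hn'.ne')]
    conv_rhs => rw [← Int.emod_add_mul_ediv z n, zpow_add, zpow_mul, Equiv.Perm.mul_apply]
    congr 1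
    symm
    rw [Equiv.Perm.iterate_eq_pow, ← zpow_natCast] at h
    exact Equiv.Perm.zpow_apply_eq_self_of_apply_eq_self h _

theorem Straight.iterate_add_cancel {p q : C} (hp : κ.Straight p) (hq : κ.Straight q) {a b m : ℕ}
    (h : κ.up^[m + a] p = κ.up^[m + b] q) : κ.up^[a] p = κ.up^[b] q := by
  induction m with
  | zero => simpa using h
  | succ m ih =>
    refine ih ?_
    rw [show m + 1 + a = (m + a) + 1 by ring, show m + 1 + b = (m + b) + 1 by ring,
      Function.iterate_succ_apply', Function.iterate_succ_apply'] at h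
    exact (hp.up_iterate _).up_injective (hq.up_iterate _) h

theorem Straight.exists_iterate_self [Finite C] {p : C} (hp : κ.Straight p) :
    ∃ n, 0 < n ∧ κ.up^[n] p = p := by
  have key : ∀ a b : ℕ, a < b → κ.up^[a] p = κ.up^[b] p → ∃ n, 0 < n ∧ κ.up^[n] p = p :=
    fun a b hlt h => ⟨b - a, by omega, (hp.iterate_add_cancel hp (m := a) (a := 0) (by
      rw [Nat.add_sub_cancel' hlt.le]; exact h)).symm⟩
  obtain ⟨a, b, hab, h⟩ := Finite.exists_ne_map_eq_of_infinite fun n : ℕ => κ.up^[n] p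
  rcases lt_or_gt_of_ne hab with hlt | hlt
  · exact key a b hlt h
  · exact key b a hlt (Eq.symm h)

theorem Straight.exists_first_return [Finite C] {p : C} (hp : κ.Straight p) :
    ∃ k, 0 < k ∧ κ.color (κ.up^[k] p) = κ.color p ∧
      ∀ j, 0 < j → j < k → κ.color (κ.up^[j] p) ≠ κ.color p := by
  classical
  obtain ⟨n, hn, h⟩ := hp.exists_iterate_self
  have hex : ∃ k, 0 < k ∧ κ.color (κ.up^[k] p) = κ.color p := ⟨n, hn, by rw [h]⟩
  exact ⟨Nat.find hex, (Nat.find_spec hex).1, (Nat.find_spec hex).2,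
    fun j h0 hj hc => Nat.find_min hex hj ⟨h0, hc⟩⟩

/-- The corners around the vertex of `p` fall into fans, each starting at its only straight corner,
climbing one ladder, and ending with the crossing of a pole. As the vertex has two straight corners
there are two fans, and the second climbs the adjacent ladder back to the neighbour of `p`. The last
equation is the cocycle condition around the vertex. -/
theorem exists_return_across_of_true [Finite C] (ζ : S.Cocycle G) {p : C} {k : ℕ}
    (hp : κ.Straight p) (hc : κ.color p = true) (h0 : 0 < k) (h : κ.color (κ.up^[k] p) = true)
    (hk : ∀ j, 0 < j → j < k → κ.color (κ.up^[j] p) = false) :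
    κ.across (κ.up^[k] p) ≠ p ∧ ∃ k', 0 < k' ∧ κ.up^[k'] (κ.across (κ.up^[k] p)) = κ.across p ∧
      (∀ j, 0 < j → j < k' → κ.color (κ.up^[j] (κ.across (κ.up^[k] p))) ≠ κ.color p) ∧
      ∑ j ∈ range k, ζ.val (κ.top (κ.up^[j] p)) + ζ.val (κ.pole (κ.up^[k] p)) +
        (∑ j ∈ range k', ζ.val (κ.top (κ.up^[j] (κ.across (κ.up^[k] p)))) +
          ζ.val (κ.pole (κ.across p))) = 0 := by
  have hV := vertexRot_iterate_succ hc h0 hk h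
  have hs := sum_vertexRot ζ hc h0 hk h
  have hcy := sameCycle_iterate (S := S) p (k + 1)
  have hq := (hp.up_iterate k).across
  have hqc := (hp.up_iterate k).color_across
  rw [h] at hqc
  obtain ⟨a, b, hab, ha1, hb1, ha2, hb2, hr⟩ := κ.two p
  generalize κ.up^[k] p = q at *
  rw [hV] at hcy
  have hne : κ.across q ≠ p := by
    intro he
    rw [he] at hV
    have key : ∀ r, S.vertexRot.SameCycle p r → κ.Straight r → r = p := by
      intro r h1 h2
      obtain ⟨j, hj, rfl⟩ := exists_iterate_lt (Nat.succ_pos k) hV h1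
      rw [eq_of_straight_iterate hp hc hk (by omega) h2]
      rfl
    exact hab ((key a ha1 ha2).trans (key b hb1 hb2).symm)
  refine ⟨hne, ?_⟩
  obtain ⟨k', h0', h', hk'⟩ := hq.exists_first_return
  rw [hqc] at h' hk'
  have hk'' : ∀ j, 0 < j → j < k' → κ.color (κ.up^[j] (κ.across q)) = false := fun j h1 h2 => by
    simpa using hk' j h1 h2
  have hV' := vertexRot_iterate_succ hqc h0' hk'' h'
  have hs' := sum_vertexRot ζ hqc h0' hk'' h'
  have hcy' := hcy.trans (sameCycle_iterate (S := S) (κ.across q) (k' + 1))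
  rw [hV'] at hcy'
  have hne' : κ.across (κ.up^[k'] (κ.across q)) ≠ κ.across q := by
    intro he
    rw [he] at hV'
    have key : ∀ r, S.vertexRot.SameCycle p r → κ.Straight r → r = κ.across q := by
      intro r h1 h2
      obtain ⟨j, hj, rfl⟩ := exists_iterate_lt (Nat.succ_pos k') hV' (hcy.symm.trans h1)
      rw [eq_of_straight_iterate hq hqc hk'' (by omega) h2]
      rfl
    exact hab ((key a ha1 ha2).trans (key b hb1 hb2).symm)
  -- Three consecutive straight corners at a vertex that has only two: the third is the first.
  have he : κ.across (κ.up^[k'] (κ.across q)) = p := by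
    have h1 := hr p (Equiv.Perm.SameCycle.refl _ _) hp
    have h2 := hr _ hcy hq
    have h3 := hr _ hcy' (hq.up_iterate k').across
    rcases h1 with h1 | h1 <;> rcases h2 with h2 | h2 <;> rcases h3 with h3 | h3 <;> grind
  have he' : κ.up^[k'] (κ.across q) = κ.across p := by
    rw [← he, (hq.up_iterate k').across_across]
  refine ⟨k', h0', he', fun j h1 h2 => by rw [hc]; exact hk' j h1 h2, ?_⟩
  rw [he'] at hs'
  rw [← hs, ← hs', ← hV]
  have hz := ζ.sum_eq_zero p (k + 1 + (k' + 1)) (by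
    rw [add_comm, Function.iterate_add_apply, hV, hV', he])
  rw [sum_range_add] at hz
  rw [← hz]
  congr 1
  refine sum_congr rfl fun j _ => ?_
  rw [add_comm (k + 1) j, Function.iterate_add_apply _ j (k + 1)]

/-- Going up a ladder from `p` to the next triangle `q` of the same colour corresponds to going
up the adjacent ladder from the neighbour of `q` to the neighbour of `p`. -/
theorem Straight.exists_return_across [Finite C] (ζ : S.Cocycle G) {p : C} {k : ℕ}
    (hp : κ.Straight p) (h0 : 0 < k) (h : κ.color (κ.up^[k] p) = κ.color p)
    (hk : ∀ j, 0 < j → j < k → κ.color (κ.up^[j] p) ≠ κ.color p) :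
    κ.across (κ.up^[k] p) ≠ p ∧ ∃ k', 0 < k' ∧ κ.up^[k'] (κ.across (κ.up^[k] p)) = κ.across p ∧
      (∀ j, 0 < j → j < k' → κ.color (κ.up^[j] (κ.across (κ.up^[k] p))) ≠ κ.color p) ∧
      ∑ j ∈ range k, ζ.val (κ.top (κ.up^[j] p)) + ζ.val (κ.pole (κ.up^[k] p)) +
        (∑ j ∈ range k', ζ.val (κ.top (κ.up^[j] (κ.across (κ.up^[k] p)))) +
          ζ.val (κ.pole (κ.across p))) = 0 := by
  cases hc : κ.color p with
  | true =>
    have := exists_return_across_of_true ζ hp hc h0 (h.trans hc) fun j h1 h2 => by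
      simpa [hc] using hk j h1 h2
    rwa [hc] at this
  | false =>
    have := exists_return_across_of_true (κ := κ.mirror) ζ.mirror ((κ.mirror_straight p).2 hp)
      (k := k)
    simp only [mirror_up, mirror_color, mirror_across, mirror_top, mirror_pole, hc,
      Bool.not_false, ne_eq, Bool.not_eq_eq_eq_not, Bool.not_true] at this
    simp only [hc] at h hk
    have hv : ζ.mirror.val = ζ.val := rfl
    simpa [hv] using this trivial h0 h (fun j h1 h2 => by simpa using hk j h1 h2)

/-- Otherwise the corners `rot (rot _)` of the triangles of the ladder would be all the corners at a
single vertex, and none of them is straight. -/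
theorem Straight.exists_iterate_false [Finite C] {p : C} (hp : κ.Straight p) :
    ∃ k, κ.color (κ.up^[k] p) = false := by
  by_contra! h
  have h : ∀ k, κ.color (κ.up^[k] p) = true := fun k => by simpa using h k
  have h1 : ∀ k, S.vertexRot^[k] (S.rot (S.rot (κ.up^[k] p))) = S.rot (S.rot p) := by
    intro k
    induction k with
    | zero => rfl
    | succ k ih =>
      rw [Function.iterate_succ_apply, Function.iterate_succ_apply', ← ih]
      congr 1
      simp [vertexRot_apply, Veering.up, top, h k, S.rot_rot_rot, S.glue_glue]
  obtain ⟨n, hn, hn'⟩ := hp.exists_iterate_self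
  have h2 := h1 n
  rw [hn'] at h2
  obtain ⟨a, b, hab, ha1, -, ha2, -⟩ := κ.two (S.rot (S.rot p))
  obtain ⟨j, hj, rfl⟩ := exists_iterate_lt hn h2 ha1
  have h3 : S.vertexRot^[j] (S.rot (S.rot p)) = S.rot (S.rot (κ.up^[n - j] p)) := by
    have h4 := h1 (n - j)
    refine S.vertexRot.injective.iterate (n - j) ?_
    rw [h4, ← Function.iterate_add_apply, Nat.sub_add_cancel hj.le, h2]
  rw [h3] at ha2
  exact (hp.up_iterate _).not_rot_rot ha2

theorem Straight.exists_iterate_color [Finite C] {p : C} (hp : κ.Straight p) (b : Bool) :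
    ∃ k, κ.color (κ.up^[k] p) = b := by
  cases b with
  | false => exact hp.exists_iterate_false
  | true =>
    obtain ⟨k, hk⟩ := Straight.exists_iterate_false ((κ.mirror_straight p).2 hp)
    rw [mirror_up, mirror_color] at hk
    exact ⟨k, by simpa using hk⟩

/-- Adjacent ladders, with their directions, are different. -/
theorem Straight.across_ne_iterate [Finite C] (k : ℕ) : ∀ {p : C}, κ.Straight p →
    κ.across p ≠ κ.up^[k] p := by
  induction k using Nat.strong_induction_on with
  | _ k ih =>
    intro p hp he
    rcases k.eq_zero_or_pos with rfl | hk0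
    · exact hp.across_ne he
    obtain ⟨m, h0, h, hm⟩ := hp.exists_first_return
    obtain ⟨hne, k', h0', h', hk', -⟩ :=
      hp.exists_return_across (⟨0, by simp, by simp⟩ : S.Cocycle ℤ) h0 h hm
    have hmk : m ≤ k := by
      by_contra! hlt
      exact hm k hk0 hlt (by rw [← he, hp.color_across])
    have hq := hp.up_iterate m
    have hsplit : κ.up^[k] p = κ.up^[k - m] (κ.up^[m] p) := by
      rw [← Function.iterate_add_apply, Nat.sub_add_cancel hmk]
    rw [he, hsplit] at h'
    rcases hmk.eq_or_lt with rfl | hlt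
    · exact hne (by rw [← he, hp.across_across])
    -- Climbing `k'` steps from the neighbour of `q = up^[m] p` and `k - m` steps from `q` leads to
    -- the same triangle. Either the neighbour of `q` lies above `q` by fewer than `k` steps, which
    -- the induction excludes, or `q` occurs inside a climb that avoids its colour.
    rcases le_or_gt k' (k - m) with hle | hgt
    · have h2 : κ.up^[0] (κ.across (κ.up^[m] p)) = κ.up^[k - m - k'] (κ.up^[m] p) :=
        hq.across.iterate_add_cancel hq (m := k') (by
          rw [add_zero, Nat.add_sub_cancel' hle]; exact h')
      exact ih (k - m - k') (by omega) hq h2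
    · have h2 : κ.up^[k' - (k - m)] (κ.across (κ.up^[m] p)) = κ.up^[0] (κ.up^[m] p) :=
        hq.across.iterate_add_cancel hq (m := k - m) (by
          rw [add_zero, Nat.add_sub_cancel' hgt.le]; exact h')
      exact hk' (k' - (k - m)) (by omega) (by omega) (by rw [h2]; exact h)

variable (κ) in
/-- Going up the ladders, as a permutation. -/
noncomputable def upPerm [Finite C] : Equiv.Perm {x // κ.Straight x} :=
  Equiv.ofBijective (fun x => ⟨κ.up x.1, x.2.up⟩)
    (Finite.injective_iff_bijective.1 fun x y h =>
      Subtype.ext (x.2.up_injective y.2 (congrArg Subtype.val h)))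

theorem coe_upPerm [Finite C] (x : {x // κ.Straight x}) : (κ.upPerm x : C) = κ.up x := rfl

theorem coe_upPerm_pow [Finite C] (n : ℕ) (x : {x // κ.Straight x}) :
    ((κ.upPerm ^ n) x : C) = κ.up^[n] x := by
  induction n with
  | zero => rfl
  | succ n ih => rw [pow_succ', Equiv.Perm.mul_apply, coe_upPerm, ih, Function.iterate_succ_apply']

variable (κ)

/-- Going up or down the ladders. -/
noncomputable def orientedUp [Finite C] : Equiv.Perm ({x // κ.Straight x} × Bool) where
  toFun d := (if d.2 then κ.upPerm d.1 else κ.upPerm.symm d.1, d.2)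
  invFun d := (if d.2 then κ.upPerm.symm d.1 else κ.upPerm d.1, d.2)
  left_inv d := by rcases d with ⟨x, _ | _⟩ <;> simp
  right_inv d := by rcases d with ⟨x, _ | _⟩ <;> simp

theorem orientedUp_pow_true [Finite C] (n : ℕ) (x : {x // κ.Straight x}) :
    (κ.orientedUp ^ n) (x, true) = ((κ.upPerm ^ n) x, true) := by
  induction n with
  | zero => rfl
  | succ n ih =>
    rw [pow_succ', Equiv.Perm.mul_apply, ih, pow_succ', Equiv.Perm.mul_apply]
    rfl

theorem orientedUp_pow_false [Finite C] (n : ℕ) (x : {x // κ.Straight x}) :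
    (κ.orientedUp ^ n) (x, false) = ((κ.upPerm⁻¹ ^ n) x, false) := by
  induction n with
  | zero => rfl
  | succ n ih =>
    rw [pow_succ', Equiv.Perm.mul_apply, ih, pow_succ', Equiv.Perm.mul_apply]
    rfl

theorem exists_upPerm_inv_pow [Finite C] (k : ℕ) : ∃ m : ℕ, κ.upPerm⁻¹ ^ m = κ.upPerm ^ k := by
  have hN := orderOf_pos κ.upPerm
  refine ⟨k * (orderOf κ.upPerm - 1), ?_⟩
  rw [inv_pow, inv_eq_iff_mul_eq_one, ← pow_add, ← Nat.mul_succ, Nat.succ_eq_add_one,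
    Nat.sub_add_cancel hN, mul_comm, pow_mul, pow_orderOf_eq_one, one_pow]

theorem upPerm_pow_inv_pow [Finite C] (n j : ℕ) (h : j ≤ n) (x : {x // κ.Straight x}) :
    (κ.upPerm ^ j) ((κ.upPerm⁻¹ ^ n) x) = (κ.upPerm⁻¹ ^ (n - j)) x := by
  rw [← Equiv.Perm.mul_apply]
  congr 1
  obtain ⟨m, rfl⟩ := Nat.exists_eq_add_of_le h
  rw [Nat.add_sub_cancel_left, pow_add, ← mul_assoc, inv_pow, mul_inv_cancel, one_mul]

/-- The triangle on the other side of the pole. -/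
def acrossStraight (x : {x // κ.Straight x}) : {x // κ.Straight x} := ⟨κ.across x, x.2.across⟩

theorem acrossStraight_acrossStraight (x : {x // κ.Straight x}) :
    κ.acrossStraight (κ.acrossStraight x) = x := Subtype.ext x.2.across_across

theorem exists_return [Finite C] (ζ : S.Cocycle G) {x : {x // κ.Straight x}} {k : ℕ}
    (h0 : 0 < k) (h : κ.color ((κ.upPerm ^ k) x) = κ.color x)
    (hk : ∀ j, 0 < j → j < k → κ.color ((κ.upPerm ^ j) x) ≠ κ.color x) :
    ∃ k', 0 < k' ∧
      (κ.upPerm ^ k') (κ.acrossStraight ((κ.upPerm ^ k) x)) = κ.acrossStraight x ∧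
      (∀ j, 0 < j → j < k' →
        κ.color ((κ.upPerm ^ j) (κ.acrossStraight ((κ.upPerm ^ k) x))) ≠ κ.color x) ∧
      ∑ j ∈ range k, ζ.val (κ.top ((κ.upPerm ^ j) x)) + ζ.val (κ.pole ((κ.upPerm ^ k) x)) +
        (∑ j ∈ range k',
          ζ.val (κ.top ((κ.upPerm ^ j) (κ.acrossStraight ((κ.upPerm ^ k) x)))) +
          ζ.val (κ.pole (κ.acrossStraight x))) = 0 := by
  simp only [coe_upPerm_pow, Subtype.ext_iff, acrossStraight] at *
  exact (x.2.exists_return_across ζ h0 h hk).2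

/-- Descending retraces the ascent through the same sides from the other side, which changes the
sign of the cocycle. -/
theorem sum_upPerm_inv [Finite C] (ζ : S.Cocycle G) (x : {x // κ.Straight x}) (k : ℕ) :
    ∑ j ∈ range k, ζ.val ((κ.upPerm⁻¹ ^ j) x : C) =
      -∑ j ∈ range k, ζ.val (κ.top ((κ.upPerm ^ j) ((κ.upPerm⁻¹ ^ k) x) : C)) := by
  rw [← sum_range_reflect, ← sum_neg_distrib]
  refine sum_congr rfl fun j hj => ?_
  have hj := mem_range.1 hj
  rw [← ζ.val_glue, upPerm_pow_inv_pow _ _ _ hj.le, show k - j = k - 1 - j + 1 by omega,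
    pow_succ', Equiv.Perm.mul_apply]
  congr 1
  generalize (κ.upPerm⁻¹ ^ (k - 1 - j)) x = y
  obtain ⟨y, rfl⟩ := κ.upPerm.surjective y
  have : κ.upPerm⁻¹ (κ.upPerm y) = y := κ.upPerm.symm_apply_apply y
  rw [this]
  rfl

end Veering

variable {S}

/-- The ladders of a veering colouring, in both directions. -/
noncomputable def Veering.ladderSystem (κ : S.Veering) [Finite C] (ζ : S.Cocycle G) :
    LadderSystem ({x // κ.Straight x} × Bool) G where
  up := κ.orientedUp
  -- Adjacent ladders climb in opposite directions, so crossing a pole flips the direction.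
  -- Reversing the direction exchanges the left and the right pole; hence the formula for `left`.
  across d := (κ.acrossStraight d.1, !d.2)
  left d := κ.color d.1.1 == d.2
  rise d := if d.2 then ζ.val (κ.top d.1.1) else ζ.val d.1.1
  cross d := ζ.val (κ.pole d.1.1)
  across_across d := by simp [κ.acrossStraight_acrossStraight]
  left_across d := by
    change (κ.color (κ.across d.1.1) == !d.2) = !(κ.color d.1.1 == d.2)
    rw [d.1.2.color_across]
    cases κ.color d.1.1 <;> cases d.2 <;> rfl
  cross_across d := by
    change ζ.val (κ.pole (κ.across d.1.1)) = _
    rw [d.1.2.pole_across, ζ.val_glue]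
  exists_left := by
    rintro ⟨x, _ | _⟩ b
    · obtain ⟨k, hk⟩ := x.2.exists_iterate_color (!b)
      obtain ⟨m, hm⟩ := κ.exists_upPerm_inv_pow k
      refine ⟨m, ?_⟩
      rw [κ.orientedUp_pow_false, hm]
      simp only [Veering.coe_upPerm_pow, hk]
      cases b <;> rfl
    · obtain ⟨k, hk⟩ := x.2.exists_iterate_color b
      refine ⟨k, ?_⟩
      rw [κ.orientedUp_pow_true]
      simp only [Veering.coe_upPerm_pow, hk]
      cases b <;> rfl
  next := by
    have hb : ∀ a b c : Bool, (a == c) = (b == c) ↔ a = b := by decide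
    have hcol : ∀ x : {x // κ.Straight x}, κ.color (κ.acrossStraight x).1 = κ.color x.1 :=
      fun x => x.2.color_across
    have hpole : ∀ x : {x // κ.Straight x},
        ζ.val (κ.pole (κ.acrossStraight x).1) = -ζ.val (κ.pole x.1) :=
      fun x => by
        rw [← ζ.val_glue]
        exact congrArg ζ.val x.2.pole_across
    rintro ⟨x, _ | _⟩ k h0 h hk
    · simp only [κ.orientedUp_pow_false, hb, Bool.not_false, κ.orientedUp_pow_true, hcol, ne_eq,
        Bool.false_eq_true, if_false, if_true, κ.sum_upPerm_inv, Prod.mk.injEq, and_true] at h hk ⊢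
      have hx := κ.upPerm_pow_inv_pow k k le_rfl x
      rw [Nat.sub_self, pow_zero, Equiv.Perm.one_apply] at hx
      obtain ⟨k', h0', h1, h2, h3⟩ := κ.exists_return ζ (x := (κ.upPerm⁻¹ ^ k) x) h0
        (by rw [hx, h]) fun j hj0 hjk => by
          rw [κ.upPerm_pow_inv_pow _ _ hjk.le, h]
          exact hk _ (by omega) (by omega)
      rw [hx, h] at *
      refine ⟨k', h0', h1, h2, ?_⟩
      rw [hpole] at h3
      rw [← sub_eq_zero, ← neg_eq_zero, ← h3]
      abel
    · simp only [κ.orientedUp_pow_true, hb, Bool.not_true, κ.orientedUp_pow_false, hcol, ne_eq,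
        Bool.false_eq_true, if_false, if_true, κ.sum_upPerm_inv, Prod.mk.injEq, and_true] at h hk ⊢
      obtain ⟨k', h0', h1, h2, h3⟩ := κ.exists_return ζ h0 h hk
      have hy : ∀ j ≤ k', (κ.upPerm⁻¹ ^ j) (κ.acrossStraight x) =
          (κ.upPerm ^ (k' - j)) (κ.acrossStraight ((κ.upPerm ^ k) x)) := fun j hj => by
        rw [← h1, ← Equiv.Perm.mul_apply]
        congr 1
        obtain ⟨m, rfl⟩ := Nat.exists_eq_add_of_le hj
        rw [Nat.add_sub_cancel_left, pow_add, ← mul_assoc, inv_pow, inv_mul_cancel, one_mul]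
      refine ⟨k', h0', ?_, fun j hj0 hjk => ?_, ?_⟩
      · rw [hy k' le_rfl, Nat.sub_self, pow_zero, Equiv.Perm.one_apply]
      · rw [hy j hjk.le]
        exact h2 _ (by omega) (by omega)
      · rw [hy k' le_rfl, Nat.sub_self, pow_zero, Equiv.Perm.one_apply]
        rw [hpole] at h3
        rw [← sub_eq_zero, ← h3]
        abel

end TriangulatedSurface

/-! ### Closed paths cross an even number of poles -/

/-- A composition of an odd number of factors from two involutions without fixed points has no
fixed points. -/
theorem zpow_mul_ne_of_involutive {Q : Type*} {a b : Equiv.Perm Q} (ha : a * a = 1) (hb : b * b = 1)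
    (ha' : ∀ q, a q ≠ q) (hb' : ∀ q, b q ≠ q) (m : ℤ) (q : Q) : a (((a * b) ^ m) q) ≠ q := by
  have hinv : (a * b)⁻¹ = b * a := by
    rw [mul_inv_rev, inv_eq_of_mul_eq_one_left ha, inv_eq_of_mul_eq_one_left hb]
  have h1 : ∀ k : ℤ, a * (a * b) ^ k = (a * b) ^ (-k) * a := fun k => by
    rw [zpow_neg, ← inv_zpow, hinv]
    have hs : SemiconjBy a (a * b) (b * a) := by
      unfold SemiconjBy
      rw [← mul_assoc, ha, one_mul, mul_assoc, ha, mul_one]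
    exact (hs.zpow_right k).eq
  have h2 : ∀ (k : ℤ) (c : Equiv.Perm Q), (∀ q, c q ≠ q) →
      ((a * b) ^ (-k) * c * (a * b) ^ k) q ≠ q := fun k c hc h => by
    refine hc (((a * b) ^ k) q) ?_
    rw [zpow_neg, mul_assoc, Equiv.Perm.mul_apply, Equiv.Perm.inv_eq_iff_eq] at h
    exact h
  -- The alternating word has odd length, so it is a conjugate of its middle letter: `a` for even
  -- `m`, `b` for odd `m`.
  obtain ⟨k, rfl | rfl⟩ := m.even_or_odd'
  · intro h
    refine h2 k a ha' ?_
    rw [← h1, mul_assoc, ← zpow_add, ← two_mul]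
    exact h
  · intro h
    refine h2 k b hb' ?_
    have h3 : (a * b) ^ (-k) * b = (a * b) ^ (-k) * a * (a * b) := by
      rw [mul_assoc, ← mul_assoc a, ha, one_mul]
    rw [h3, ← h1, mul_assoc, mul_assoc, ← zpow_one_add, ← zpow_add,
      show k + (1 + k) = 2 * k + 1 by ring]
    exact h

namespace TriangulatedSurface
variable {C : Type*} {S : TriangulatedSurface C}

namespace Veering
variable (κ : S.Veering) [Finite C]

/-- The ladders, without a direction. -/
abbrev Ladder : Type _ := Quotient (Equiv.Perm.SameCycle.setoid κ.upPerm)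

theorem sameCycle_acrossStraight {x y : {x // κ.Straight x}} (h : κ.upPerm.SameCycle x y)
    (hc : κ.color x = κ.color y) :
    κ.upPerm.SameCycle (κ.acrossStraight x) (κ.acrossStraight y) := by
  let L := κ.ladderSystem (⟨0, by simp, by simp⟩ : S.Cocycle ℤ)
  have h1 : L.up.SameCycle (x, true) (y, true) := by
    obtain ⟨n, -, rfl⟩ := h.exists_pow_eq'
    exact ⟨n, by rw [zpow_natCast]; exact κ.orientedUp_pow_true n x⟩
  obtain ⟨n, -, hn⟩ := (L.sameCycle_across h1 (by
    change (κ.color y == true) = (κ.color x == true)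
    rw [hc])).exists_pow_eq'
  refine Equiv.Perm.sameCycle_inv.1 ⟨n, ?_⟩
  have h2 := κ.orientedUp_pow_false n (κ.acrossStraight x)
  rw [zpow_natCast]
  exact congrArg Prod.fst (h2.symm.trans hn)

theorem exists_sameCycle_color (x : {x // κ.Straight x}) (b : Bool) :
    ∃ y, κ.upPerm.SameCycle x y ∧ κ.color y = b := by
  obtain ⟨k, hk⟩ := x.2.exists_iterate_color b
  exact ⟨(κ.upPerm ^ k) x, ⟨k, by rw [zpow_natCast]⟩, by rw [coe_upPerm_pow, hk]⟩

/-- The adjacent ladder on the side of the given colour. -/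
noncomputable def crossLadder (b : Bool) : κ.Ladder → κ.Ladder :=
  Quotient.map (fun x => κ.acrossStraight (κ.exists_sameCycle_color x b).choose) fun x y h => by
    have h1 := (κ.exists_sameCycle_color x b).choose_spec
    have h2 := (κ.exists_sameCycle_color y b).choose_spec
    exact κ.sameCycle_acrossStraight (h1.1.symm.trans (Equiv.Perm.SameCycle.trans h h2.1))
      (h1.2.trans h2.2.symm)

theorem crossLadder_mk {b : Bool} {x : {x // κ.Straight x}} (h : κ.color x = b) :
    κ.crossLadder b (Quotient.mk _ x) = Quotient.mk _ (κ.acrossStraight x) := by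
  have h1 := (κ.exists_sameCycle_color x b).choose_spec
  exact Quotient.sound (κ.sameCycle_acrossStraight h1.1.symm (h1.2.trans h.symm))

theorem exists_mk_color (q : κ.Ladder) (b : Bool) :
    ∃ x : {x // κ.Straight x}, κ.color x = b ∧ q = Quotient.mk _ x := by
  induction q using Quotient.inductionOn with
  | _ x =>
    obtain ⟨y, h1, h2⟩ := κ.exists_sameCycle_color x b
    exact ⟨y, h2, Quotient.sound h1⟩

theorem crossLadder_involutive (b : Bool) : Function.Involutive (κ.crossLadder b) := fun q => by
  obtain ⟨x, hx, rfl⟩ := κ.exists_mk_color q b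
  rw [κ.crossLadder_mk hx, κ.crossLadder_mk (x.2.color_across.trans hx),
    κ.acrossStraight_acrossStraight]

theorem crossLadder_ne (b : Bool) (q : κ.Ladder) : κ.crossLadder b q ≠ q := by
  obtain ⟨x, hx, rfl⟩ := κ.exists_mk_color q b
  rw [κ.crossLadder_mk hx]
  intro h
  obtain ⟨n, -, hn⟩ := (Quotient.exact h.symm : κ.upPerm.SameCycle _ _).exists_pow_eq'
  refine x.2.across_ne_iterate n ?_
  rw [← coe_upPerm_pow, hn]
  rfl

/-- Some path through adjacent ladders from `q` to `q'` crosses an odd number of poles if `odd` is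
true, and an even number if it is false. -/
def Reaches (q : κ.Ladder) (odd : Bool) (q' : κ.Ladder) : Prop :=
  ∃ m : ℤ, q' = (if odd then (κ.crossLadder_involutive true).toPerm else 1)
    ((((κ.crossLadder_involutive true).toPerm * (κ.crossLadder_involutive false).toPerm) ^ m) q)

theorem Reaches.refl (q : κ.Ladder) : κ.Reaches q false q := ⟨0, rfl⟩

variable {κ}

theorem involutive_toPerm_mul_self (b : Bool) :
    (κ.crossLadder_involutive b).toPerm * (κ.crossLadder_involutive b).toPerm = 1 :=
  Equiv.ext (κ.crossLadder_involutive b)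

/-- Multiplying by one of the two involutions either lengthens the alternating word or cancels a
letter; the parity changes in both cases. -/
theorem Reaches.cross {q q' : κ.Ladder} {odd : Bool} (h : κ.Reaches q odd q') (b : Bool) :
    κ.Reaches q (!odd) (κ.crossLadder b q') := by
  obtain ⟨m, rfl⟩ := h
  change κ.Reaches q _ (Function.Involutive.toPerm _ (κ.crossLadder_involutive b) _)
  unfold Reaches
  have ha := involutive_toPerm_mul_self (κ := κ) true
  have hb := involutive_toPerm_mul_self (κ := κ) false
  cases b <;> generalize (κ.crossLadder_involutive true).toPerm = f at *
  · generalize (κ.crossLadder_involutive false).toPerm = g at *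
    cases odd
    · refine ⟨1 + m, ?_⟩
      simp only [Bool.false_eq_true, if_false, Bool.not_false, if_true, zpow_one_add,
        ← Equiv.Perm.mul_apply, ← mul_assoc, ha, one_mul]
    · refine ⟨-1 + m, ?_⟩
      have hi : (f * g) ^ (-1 : ℤ) = g * f := by
        rw [zpow_neg_one, mul_inv_rev, inv_eq_of_mul_eq_one_left ha, inv_eq_of_mul_eq_one_left hb]
      simp only [if_true, Bool.not_true, Bool.false_eq_true, if_false, zpow_add, hi,
        ← Equiv.Perm.mul_apply, ← mul_assoc, one_mul]
  · generalize (κ.crossLadder_involutive false).toPerm = g at *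
    refine ⟨m, ?_⟩
    cases odd <;> simp only [Bool.false_eq_true, if_false, Bool.not_false, if_true, Bool.not_true,
      ← Equiv.Perm.mul_apply, ← mul_assoc, ha, one_mul]

/-- No ladder is adjacent to itself (`crossLadder_ne`), so no odd word fixes a ladder. This is what
brings a lifted closed path back with its original direction. -/
theorem Reaches.eq_false {q : κ.Ladder} {odd : Bool} (h : κ.Reaches q odd q) : odd = false := by
  cases odd
  · rfl
  · obtain ⟨m, hm⟩ := h
    exact absurd hm.symm (zpow_mul_ne_of_involutive (involutive_toPerm_mul_self true)
      (involutive_toPerm_mul_self false) (κ.crossLadder_ne true) (κ.crossLadder_ne false) m q)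

end Veering
end TriangulatedSurface

/-! ### The homology coordinate and the lifting of paths -/

namespace TriangulatedSurface
open LadderSystem LadderSystem.Kind LadderSystem.Heights

variable {C : Type*} {S : TriangulatedSurface C}

section Cocycle
variable [DecidableEq C]

theorem sum_single_apply (F : ℕ → C) (K : ℕ) (s : C) :
    (∑ j ∈ range K, Pi.single (F j) (1 : ℤ) : C → ℤ) s =
      ∑ j ∈ range K, if F j = s then 1 else 0 := by
  rw [Finset.sum_apply]
  exact Finset.sum_congr rfl fun j _ => by rw [Pi.single_apply]; simp only [eq_comm]

variable (S)

/-- The boundaries, as a submodule of the functions on the sides. -/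
def boundaries : Submodule ℤ (C → ℤ) := (LinearMap.range S.boundaryMap).map S.oneCycles.subtype

/-- The universal cocycle. -/
def universalCocycle : S.Cocycle ((C → ℤ) ⧸ S.boundaries) where
  val s := Submodule.Quotient.mk (Pi.single s 1 - Pi.single (S.glue s) 1)
  val_glue s := by rw [S.glue_glue, ← Submodule.Quotient.mk_neg, neg_sub]
  sum_eq_zero c K h := by
    have hper : ∀ s, (∑ j ∈ range K, if S.vertexRot^[j + 1] c = s then (1 : ℤ) else 0) =
        ∑ j ∈ range K, if S.vertexRot^[j] c = s then (1 : ℤ) else 0 := fun s => by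
      have h1 := Finset.sum_range_succ (fun j => if S.vertexRot^[j] c = s then (1 : ℤ) else 0) K
      rw [Finset.sum_range_succ', h] at h1
      exact add_right_cancel h1
    -- The weight of a corner is the number of visits in `K` steps; it is constant around the vertex
    -- since the walk closes up. The sum of the cocycle is the class of the boundary of this chain.
    let f : S.twoChains := ⟨∑ j ∈ range K, Pi.single (S.vertexRot^[j] c) 1, fun x => by
      rw [sum_single_apply, sum_single_apply, ← hper]
      simp only [Function.iterate_succ_apply', EmbeddingLike.apply_eq_iff_eq]⟩
    have hsum : (Submodule.Quotient.mk ((S.boundaryMap f : S.oneCycles) : C → ℤ) :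
        (C → ℤ) ⧸ S.boundaries) = 0 :=
      (Submodule.Quotient.mk_eq_zero _).2 ⟨_, ⟨f, rfl⟩, rfl⟩
    rw [← hsum]
    change ∑ j ∈ range K, S.boundaries.mkQ _ = S.boundaries.mkQ _
    rw [← map_sum]
    congr 1
    ext s
    rw [Finset.sum_sub_distrib, Pi.sub_apply, sum_single_apply, sum_single_apply]
    change _ = (∑ j ∈ range K, Pi.single (S.vertexRot^[j] c) (1 : ℤ) : C → ℤ) (S.rot (S.rot s)) -
      (∑ j ∈ range K, Pi.single (S.vertexRot^[j] c) (1 : ℤ) : C → ℤ) (S.rot s)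
    rw [sum_single_apply, sum_single_apply, ← hper (S.rot s)]
    congr 1
    · refine Finset.sum_congr rfl fun j _ => ?_
      refine if_congr ?_ rfl rfl
      rw [← S.rot.apply_eq_iff_eq (y := S.rot (S.rot s)), S.rot_rot_rot]
    · refine Finset.sum_congr rfl fun j _ => ?_
      refine if_congr ?_ rfl rfl
      rw [Function.iterate_succ_apply', vertexRot_apply, S.rot.apply_eq_iff_eq]

variable {S}

/-- The universal cocycle adds up along the path to the class of its own cycle. -/
theorem ClosedNormalPath.homologyClass_eq_zero {γ : S.ClosedNormalPath}
    (h : ∑ i, S.universalCocycle.val (γ.exit i) = 0) : γ.homologyClass = 0 := by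
  have h2 : ∑ i, (Pi.single (S.glue (γ.exit i)) 1 : C → ℤ) = ∑ i, Pi.single (γ.enter i) 1 := by
    rw [← Equiv.sum_comp (Equiv.addRight (1 : ZMod γ.len)) fun i => Pi.single (γ.enter i) 1]
    refine Finset.sum_congr rfl fun i _ => ?_
    rw [Equiv.coe_addRight, γ.enter_succ]
  have h1 : (Submodule.Quotient.mk (γ.cycle : C → ℤ) : (C → ℤ) ⧸ S.boundaries) =
      ∑ i, S.universalCocycle.val (γ.exit i) := by
    change S.boundaries.mkQ _ = ∑ i, S.boundaries.mkQ _
    rw [← map_sum, Finset.sum_sub_distrib, h2, ← Finset.sum_sub_distrib]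
    congr 1
    ext s
    rw [Finset.sum_apply]
    refine Finset.sum_congr rfl fun i _ => ?_
    simp only [Pi.sub_apply, Pi.single_apply, eq_comm]
  rw [h, Submodule.Quotient.mk_eq_zero] at h1
  obtain ⟨x, hx, hx'⟩ := h1
  refine (Submodule.Quotient.mk_eq_zero _).2 ?_
  rwa [← Subtype.ext hx']

end Cocycle

section Lift
variable {C' : Type*} (S' : TriangulatedSurface C') (γ : S.ClosedNormalPath)

/-- The corners cut off by a lifted path. -/
def ClosedNormalPath.liftCorner (y : C') : ℕ → C'
  | 0 => y
  | i + 1 => if γ.left (i + 1 : ℕ) then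
      S'.rot (S'.glue (if γ.left i then S'.rot (liftCorner y i)
        else S'.rot (S'.rot (liftCorner y i))))
    else S'.rot (S'.rot (S'.glue (if γ.left i then S'.rot (liftCorner y i)
      else S'.rot (S'.rot (liftCorner y i)))))

/-- The lift of a path to a covering. -/
def ClosedNormalPath.lift (a : ZMod γ.len → ℝ) (y : C') : S'.NormalRay where
  corner := γ.liftCorner S' y
  left i := γ.left i
  pos i := a i
  next i := by
    rw [ClosedNormalPath.liftCorner]
    by_cases h : γ.left (i + 1 : ℕ) = true <;>
      simp only [h, if_true, if_false, Bool.false_eq_true, S'.rot_rot_rot]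

variable {S' γ} {a : ZMod γ.len → ℝ} {y : C'}

theorem ClosedNormalPath.project_lift {f : C' → C} (hr : ∀ x, f (S'.rot x) = S.rot (f x))
    (hg : ∀ x, f (S'.glue x) = S.glue (f x)) (hy : f y = γ.corner 0) (i : ℕ) :
    f ((γ.lift S' a y).corner i) = γ.corner i := by
  induction i with
  | zero => exact hy.trans (by rw [Nat.cast_zero])
  | succ i ih =>
    have h := γ.next i
    change f (γ.liftCorner S' y i) = _ at ih
    change f (γ.liftCorner S' y (i + 1)) = _
    rw [ClosedNormalPath.liftCorner]
    have hc : ((i + 1 : ℕ) : ZMod γ.len) = (i : ZMod γ.len) + 1 := by push_cast; rfl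
    rw [hc]
    by_cases h1 : γ.left ((i : ZMod γ.len) + 1) = true <;> by_cases h2 : γ.left i = true <;>
      simp only [h1, h2, if_true, if_false, Bool.false_eq_true, hr, hg, ih] at h ⊢ <;>
      rw [← h] <;> simp only [S.rot_rot_rot]

/-- Lifts are determined by one corner, and `t` acts as a deck transformation. -/
theorem ClosedNormalPath.lift_add {t : C' → C'} (hr : ∀ x, t (S'.rot x) = S'.rot (t x))
    (hg : ∀ x, t (S'.glue x) = S'.glue (t x)) (h : (γ.lift S' a y).corner γ.len = t y) (i : ℕ) :
    (γ.lift S' a y).corner (i + γ.len) = t ((γ.lift S' a y).corner i) := by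
  induction i with
  | zero => rw [zero_add]; exact h
  | succ i ih =>
    change γ.liftCorner S' y (i + γ.len) = t (γ.liftCorner S' y i) at ih
    rw [show i + 1 + γ.len = i + γ.len + 1 by ring]
    change γ.liftCorner S' y (i + γ.len + 1) = t (γ.liftCorner S' y (i + 1))
    rw [ClosedNormalPath.liftCorner, ClosedNormalPath.liftCorner, ih]
    have hc : ((i + γ.len : ℕ) : ZMod γ.len) = i := by simp
    have hc' : ((i + γ.len + 1 : ℕ) : ZMod γ.len) = (i + 1 : ℕ) := by simp
    rw [hc, hc']
    split_ifs <;> simp only [hr, hg]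

end Lift

theorem sum_zmod_eq_sum_range {M : Type*} [AddCommMonoid M] {n : ℕ} [NeZero n] (f : ZMod n → M) :
    ∑ i, f i = ∑ i ∈ range n, f i := by
  refine Finset.sum_nbij' ZMod.val (fun i => (i : ZMod n)) ?_ ?_ ?_ ?_ ?_
  · intro i _; exact mem_range.2 (ZMod.val_lt i)
  · intro i _; exact mem_univ _
  · intro i _; exact ZMod.natCast_zmod_val i
  · intro i hi; exact ZMod.val_cast_of_lt (mem_range.1 hi)
  · intro i _; rw [ZMod.natCast_zmod_val]

namespace Veering
variable [Finite C] {κ : S.Veering} {G : Type*} [AddCommGroup G] {ζ : S.Cocycle G}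
  (H : (κ.ladderSystem ζ).Heights)

/-- The covering by the lifted ladders. -/
def project (x : Kind × H.Lifted) : C :=
  match x.1, x.2.1.2 with
  | .top, true => κ.top x.2.1.1
  | .bot, true => x.2.1.1
  | .top, false => x.2.1.1
  | .bot, false => κ.top x.2.1.1
  | .pole, _ => κ.pole x.2.1.1

theorem project_rot (x : Kind × H.Lifted) :
    project H (H.toLadderSystem.surface.rot x) = S.rot (project H x) := by
  obtain ⟨k, ⟨⟨p, hp⟩, ε⟩, g⟩ := x
  rw [surface_rot]
  change project H (rotKind (κ.color p == ε) k, ((⟨p, hp⟩, ε), g)) = _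
  cases hc : κ.color p <;> cases ε <;> cases k <;>
    simp [project, rotKind, Veering.top, Veering.pole, hc, S.rot_rot_rot]

theorem glue_upPerm_symm (x : {x // κ.Straight x}) : S.glue x = κ.top (κ.upPerm.symm x) := by
  obtain ⟨y, rfl⟩ := κ.upPerm.surjective x
  rw [Equiv.symm_apply_apply, coe_upPerm, Veering.up, S.glue_glue]

theorem project_glue (x : Kind × H.Lifted) :
    project H (H.toLadderSystem.surface.glue x) = S.glue (project H x) := by
  obtain ⟨k, ⟨p, ε⟩, g⟩ := x
  have h1 := κ.glue_upPerm_symm p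
  have h2 : (κ.upPerm p : C) = S.glue (κ.top p) := rfl
  cases k <;> cases ε
  · exact h1.symm
  · exact h2
  · exact h2
  · exact h1.symm
  · exact p.2.pole_across
  · exact p.2.pole_across

theorem shiftCorner_rot (v : ℤ × ℝ × G) (x : Kind × H.Lifted) :
    shiftCorner (H := H) v (H.toLadderSystem.surface.rot x) =
      H.toLadderSystem.surface.rot (shiftCorner (H := H) v x) := rfl

theorem shiftCorner_glue (v : ℤ × ℝ × G) (x : Kind × H.Lifted) :
    shiftCorner (H := H) v (H.toLadderSystem.surface.glue x) =
      H.toLadderSystem.surface.glue (shiftCorner (H := H) v x) := by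
  obtain ⟨_ | _ | _, d, g⟩ := x <;>
    simp [shiftCorner, surface_glue, glueSide, LadderSystem.liftUp,
      LadderSystem.liftAcross] <;> abel

/-- The last coordinate integrates the cocycle along a lifted path. -/
theorem lift_glue (x : Kind × H.Lifted) : (H.toLadderSystem.surface.glue x).2.2.2.2 =
    x.2.2.2.2 + ζ.val (project H x) := by
  obtain ⟨k, ⟨p, ε⟩, g⟩ := x
  have h1 : ζ.val (p : C) = -ζ.val (κ.top (κ.upPerm.symm p)) := by
    rw [← glue_upPerm_symm, ζ.val_glue, neg_neg]
  have h2 : ζ.val (κ.top (p : C)) = -ζ.val (κ.upPerm p : C) := by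
    rw [← ζ.val_glue]
    exact congrArg ζ.val (S.glue_glue _).symm
  cases k <;> cases ε
  · rfl
  · rfl
  · exact (sub_eq_add_neg _ _).trans (congrArg _ h2.symm)
  · exact (sub_eq_add_neg _ _).trans (congrArg _ h1.symm)
  · rfl
  · rfl

theorem straight_project_iff (x : Kind × H.Lifted) :
    κ.Straight (project H x) ↔ IsStraight (H := H) Prod.snd x := by
  obtain ⟨k, ⟨⟨p, hp⟩, ε⟩, g⟩ := x
  have h1 := hp.not_rot
  have h2 := hp.not_rot_rot
  cases hc : κ.color p <;> cases ε <;> cases k <;>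
    simp [project, IsStraight, Veering.top, Veering.pole, hc, h1, h2, hp]

theorem sameTriangle_project (x : Kind × H.Lifted) : S.SameTriangle x.2.1.1 (project H x) := by
  obtain ⟨k, ⟨⟨p, hp⟩, ε⟩, g⟩ := x
  cases hc : κ.color p <;> cases ε <;> cases k <;>
    simp [project, SameTriangle, Veering.top, Veering.pole, hc]

theorem exists_project_eq (c : C) : ∃ x, project H x = c := by
  obtain ⟨p, h, hp⟩ := κ.exists_straight c
  have hp : κ.Straight p := hp
  rcases h.symm with rfl | rfl | rfl
  · exact ⟨(bot, ((⟨_, hp⟩, true), 0)), rfl⟩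
  · refine ⟨H.toLadderSystem.surface.rot (bot, ((⟨_, hp⟩, true), 0)), ?_⟩
    rw [project_rot]; rfl
  · refine ⟨H.toLadderSystem.surface.rot (H.toLadderSystem.surface.rot
      (bot, ((⟨_, hp⟩, true), 0))), ?_⟩
    rw [project_rot, project_rot]; rfl

theorem fst_eq_of_project_eq {x y : Kind × H.Lifted} (h : project H x = project H y) :
    x.2.1.1 = y.2.1.1 := by
  refine Subtype.ext (y.2.1.1.2.eq_of_sameTriangle x.2.1.1.2 ?_)
  have h1 := sameTriangle_project H x
  rw [h] at h1
  exact (sameTriangle_project H y).trans h1.symm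

theorem eq_shiftCorner {x y : Kind × H.Lifted} (h : project H x = project H y)
    (hs : x.2.1.2 = y.2.1.2) : x = shiftCorner (H := H) (x.2.2 - y.2.2) y := by
  have h1 := fst_eq_of_project_eq H h
  obtain ⟨k, ⟨⟨p, hp⟩, ε⟩, g⟩ := x
  obtain ⟨k', ⟨⟨p', hp'⟩, ε'⟩, g'⟩ := y
  dsimp only at hs h1
  cases hs
  cases h1
  have r1 := S.rot_ne
  have r2 := S.rot_rot_ne
  have r1' := fun c => (S.rot_ne c).symm
  have r2' := fun c => (S.rot_rot_ne c).symm
  have hk : k = k' := by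
    cases hc : κ.color p <;> cases ε <;> cases k <;> cases k' <;>
      first | rfl | simp [project, Veering.top, Veering.pole, hc, r1, r2, r1', r2'] at h
  subst hk
  simp [shiftCorner]

theorem reaches_glue {q : κ.Ladder} {b : Bool} {x : Kind × H.Lifted}
    (h : κ.Reaches q (x.2.1.2 != b) (Quotient.mk _ x.2.1.1)) :
    κ.Reaches q ((H.toLadderSystem.surface.glue x).2.1.2 != b)
      (Quotient.mk _ (H.toLadderSystem.surface.glue x).2.1.1) := by
  obtain ⟨k, ⟨p, ε⟩, g⟩ := x
  have h1 : ∀ p, (Quotient.mk _ (κ.upPerm p) : κ.Ladder) = Quotient.mk _ p := fun p =>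
    Quotient.sound (Equiv.Perm.sameCycle_apply_left.2 (Equiv.Perm.SameCycle.refl _ _))
  have h2 : (Quotient.mk _ (κ.upPerm.symm p) : κ.Ladder) = Quotient.mk _ p := by
    rw [← h1, Equiv.apply_symm_apply]
  have h3 : κ.Reaches q ((!ε) != b) (Quotient.mk _ (κ.acrossStraight p)) := by
    rw [← κ.crossLadder_mk rfl, show ((!ε) != b) = !(ε != b) by cases ε <;> cases b <;> rfl]
    exact Reaches.cross h _
  dsimp only at h
  cases k <;> cases ε
  · change κ.Reaches q _ (Quotient.mk _ (κ.upPerm.symm p)); rw [h2]; exact h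
  · change κ.Reaches q _ (Quotient.mk _ (κ.upPerm p)); rw [h1]; exact h
  · change κ.Reaches q _ (Quotient.mk _ (κ.upPerm p)); rw [h1]; exact h
  · change κ.Reaches q _ (Quotient.mk _ (κ.upPerm.symm p)); rw [h2]; exact h
  · exact h3
  · exact h3

end Veering
end TriangulatedSurface

/-! ### Vanishing of the turning angle for a veering colouring -/

namespace TriangulatedSurface
open LadderSystem LadderSystem.Kind LadderSystem.Heights

variable {C : Type*} {S : TriangulatedSurface C}

/-- Lifts of different arcs inherit disjointness from the base. Lifts of the same arc cut off
different corners by `h3`, so they are never compared. -/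
theorem ClosedNormalPath.lift_isEmbedded {C' : Type*} {S' : TriangulatedSurface C'}
    {γ : S.ClosedNormalPath} {a : ZMod γ.len → ℝ} {y : C'} {f : C' → C}
    (hf : ∀ i, f ((γ.lift S' a y).corner i) = γ.corner i)
    (hr : ∀ x, f (S'.rot x) = S.rot (f x))
    (h1 : ∀ i j, i ≠ j → γ.corner i = γ.corner j →
      (γ.distRot a i < γ.distRot a j ∧ γ.distRotRot a i < γ.distRotRot a j) ∨
      (γ.distRot a j < γ.distRot a i ∧ γ.distRotRot a j < γ.distRotRot a i))
    (h2 : ∀ i j, γ.corner j = S.rot (γ.corner i) → γ.distRot a i + γ.distRotRot a j < 1)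
    (h3 : ∀ i q, 0 < q → (γ.lift S' a y).corner (i + q * γ.len) ≠ (γ.lift S' a y).corner i) :
    (γ.lift S' a y).IsEmbedded := by
  have hd : ∀ i : ℕ, (γ.lift S' a y).distRot i = γ.distRot a i := fun i => by
    unfold NormalRay.distRot ClosedNormalPath.distRot ClosedNormalPath.lift
    push_cast
    rfl
  have hd' : ∀ i : ℕ, (γ.lift S' a y).distRotRot i = γ.distRotRot a i := fun i => by
    unfold NormalRay.distRotRot ClosedNormalPath.distRotRot ClosedNormalPath.lift
    push_cast
    rfl
  have key : ∀ i j : ℕ, i < j → (γ.lift S' a y).corner i = (γ.lift S' a y).corner j →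
      (i : ZMod γ.len) ≠ j := by
    intro i j hij h hz
    obtain ⟨q, hq⟩ := (Nat.modEq_iff_dvd' hij.le).1 ((ZMod.natCast_eq_natCast_iff _ _ _).1 hz)
    refine h3 i q (Nat.pos_of_ne_zero fun h0 => ?_) ?_
    · rw [h0, mul_zero] at hq; omega
    · rw [h, mul_comm, ← hq, Nat.add_sub_cancel' hij.le]
  constructor
  · intro i j hij h
    rw [hd, hd, hd', hd']
    refine h1 i j ?_ ?_
    · rcases lt_or_gt_of_ne hij with hlt | hlt
      · exact key i j hlt h
      · exact (key j i hlt h.symm).symm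
    · rw [← hf, ← hf, h]
  · intro i j h
    rw [hd, hd']
    refine h2 i j ?_
    rw [← hf, ← hf, h, hr]

namespace Veering
variable (κ : S.Veering)

open Classical in
/-- The turning angle of an embedded closed path that is not homologous to zero vanishes. -/
theorem turning_eq_zero [Finite C] [DecidableEq C] (γ : S.ClosedNormalPath) (hγ : γ.IsEmbedded)
    (hγ' : γ.homologyClass ≠ 0) : γ.turning (fun c => if κ.Straight c then Real.pi else 0) = 0 := by
  have := Fintype.ofFinite ({x // κ.Straight x} × Bool)
  obtain ⟨H⟩ := (κ.ladderSystem S.universalCocycle).exists_heights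
  obtain ⟨y, hy⟩ := exists_project_eq H (γ.corner 0)
  obtain ⟨a, ha, h1, h2⟩ := hγ
  set r := γ.lift H.toLadderSystem.surface a y with hr
  have hproj : ∀ i, project H (r.corner i) = γ.corner i :=
    fun i => γ.project_lift (project_rot H) (project_glue H) hy i
  have hproj' : ∀ i, project H (r.exit i) = γ.exit i := fun i => by
    unfold NormalRay.exit ClosedNormalPath.exit
    rw [apply_ite (project H), project_rot, project_rot, project_rot, hproj]
    rfl
  have hsnd : ∀ i, (r.corner (i + 1)).2 = (H.toLadderSystem.surface.glue (r.exit i)).2 :=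
    fun i => by rw [← r.enter_succ, sameTriangle_snd _ (r.sameTriangle_enter (i + 1))]
  have hsnd' : ∀ i, (r.exit i).2 = (r.corner i).2 := fun i =>
    sameTriangle_snd _ (r.sameTriangle_exit i)
  have hlen : project H (r.corner γ.len) = project H y := by
    rw [hproj, hy, ZMod.natCast_self]
  -- The direction flips exactly at the crossings of poles, and the path returns to its initial
  -- ladder.
  have hsign : (r.corner γ.len).2.1.2 = y.2.1.2 := by
    have h : ∀ i, κ.Reaches (Quotient.mk _ y.2.1.1) ((r.corner i).2.1.2 != y.2.1.2)
        (Quotient.mk _ (r.corner i).2.1.1) := by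
      intro i
      induction i with
      | zero =>
        have h0 : r.corner 0 = y := rfl
        rw [h0, bne_self_eq_false]
        exact Reaches.refl _ _
      | succ i ih =>
        rw [hsnd]
        exact reaches_glue H (by rw [hsnd']; exact ih)
    have h := h γ.len
    rw [fst_eq_of_project_eq H hlen] at h
    simpa using h.eq_false
  have hshift := eq_shiftCorner H hlen hsign
  set v := (r.corner γ.len).2.2 - y.2.2 with hv
  have hper : ∀ i, r.corner (i + γ.len) = shiftCorner (H := H) v (r.corner i) := fun i =>
    ClosedNormalPath.lift_add (shiftCorner_rot H v) (shiftCorner_glue H v) hshift i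
  -- With no planar displacement, the end of the lift is in the strip of its start at the same
  -- height, hence is the same lifted triangle. Then the homology coordinate has not changed either,
  -- so the class is zero.
  have hv0 : v.1 ≠ 0 ∨ v.2.1 ≠ 0 := by
    by_contra! hv0
    obtain ⟨s, hs⟩ := exists_onSheet r
    have h0 : r.corner 0 = y := rfl
    have he : (r.corner γ.len).2 = (y.2.1, y.2.2 + v) := congrArg Prod.snd hshift
    have hsum : sumHeight (H := H) (r.corner γ.len).2 = sumHeight (H := H) y.2 := by
      rw [he]; simp [sumHeight, rightHeight, hv0.2]
    have hcycle := (hs 0).sameCycle (hs γ.len) (by rw [he, h0]; simp [hv0.1])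
    rw [h0] at hcycle
    have heq : (r.corner γ.len).2 = y.2 := by
      rcases below_trichotomy hcycle with h | h | h
      · exact h
      · exact absurd hsum h.sum_lt.ne'
      · exact absurd hsum h.sum_lt.ne
    refine hγ' (γ.homologyClass_eq_zero ?_)
    have hinc : ∀ n : ℕ, (r.corner n).2.2.2.2 =
        y.2.2.2.2 + ∑ i ∈ range n, S.universalCocycle.val (γ.exit i) := by
      intro n
      induction n with
      | zero => simp [h0]
      | succ n ih =>
        rw [hsnd, lift_glue, hsnd', ih, Finset.sum_range_succ, hproj', add_assoc]
    have h := hinc γ.len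
    rw [heq] at h
    rw [sum_zmod_eq_sum_range fun i => S.universalCocycle.val (γ.exit i)]
    simpa using h.symm
  have hmul : ∀ i q : ℕ, r.corner (i + q * γ.len) = shiftCorner (H := H) (q • v) (r.corner i) := by
    intro i q
    induction q with
    | zero => simp [shiftCorner]
    | succ q ih =>
      rw [Nat.succ_mul, ← add_assoc, hper, ih, succ_nsmul]
      simp [shiftCorner, add_assoc]
  have hemb : r.IsEmbedded := by
    refine ClosedNormalPath.lift_isEmbedded hproj (project_rot H) h1 h2 fun i q hq h => ?_
    change r.corner _ = r.corner _ at h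
    rw [hmul] at h
    have h := congrArg (fun x => x.2.2) h
    simp only [shiftCorner, add_eq_left] at h
    have h3 := congrArg Prod.fst h
    have h4 := congrArg (fun x => x.2.1) h
    simp [hq.ne'] at h3 h4
    rcases hv0 with hv0 | hv0
    · exact hv0 h3
    · exact hv0 h4
  have hsum := sum_straight_eq_zero hemb (Nat.pos_of_ne_zero (NeZero.ne γ.len)) hper
    (fun j => by change γ.left _ = γ.left _; simp) (fun j => by change a _ = a _; simp) hv0
    (sgn := Prod.snd) (fun d => rfl)
  have hcast := congrArg (fun z : ℤ => Real.pi * (z : ℝ)) hsum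
  simp only [Int.cast_sum, Finset.mul_sum, Int.cast_zero, mul_zero] at hcast
  rw [γ.turning_eq_sum, sum_zmod_eq_sum_range]
  refine Eq.trans (Finset.sum_congr rfl fun i _ => ?_) hcast
  rw [← hproj, straight_project_iff]
  change (if γ.left i = true then _ else _) =
    Real.pi * (((if γ.left i = true then _ else _ : ℤ) * _ : ℤ) : ℝ)
  split_ifs <;> simp

end Veering
end TriangulatedSurface

/-! ### From veering angles to colourings, and the theorem -/

namespace TriangulatedSurface
variable {C : Type*} [Fintype C] [DecidableEq C] {S : TriangulatedSurface C}

open Classical in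
/-- Angles `0` and `π` that sum to `π` in each triangle and to `2π` around each vertex come from
a colouring, if they are veering. -/
theorem exists_veering {α : C → ℝ} (h01 : ∀ c, α c = 0 ∨ α c = Real.pi)
    (hsum : ∀ c, α c + α (S.rot c) + α (S.rot (S.rot c)) = Real.pi)
    (hvert : ∀ c, ∑ d with S.vertexRot.SameCycle c d, α d = 2 * Real.pi)
    (hveer : ∀ c, (∀ d, S.vertexRot.SameCycle c d → α d = 0 → α (S.rot (S.rot d)) = Real.pi) ∨
      (∀ d, S.vertexRot.SameCycle c d → α d = 0 → α (S.rot d) = Real.pi)) :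
    ∃ κ : S.Veering, ∀ c, α c = if κ.Straight c then Real.pi else 0 := by
  have hpi := Real.pi_pos
  -- The colour records whether the first alternative of `hveer` holds. The vertex after a corner
  -- `π` excludes the second alternative, the vertex before it excludes the first.
  let color : C → Bool := fun c => decide
    (∀ d, S.vertexRot.SameCycle c d → α d = 0 → α (S.rot (S.rot d)) = Real.pi)
  have hzero : ∀ p, α p = Real.pi → α (S.rot p) = 0 ∧ α (S.rot (S.rot p)) = 0 := by
    intro p hp
    have h := hsum p
    rcases h01 (S.rot p) with h1 | h1 <;> rcases h01 (S.rot (S.rot p)) with h2 | h2 <;>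
      rw [hp, h1, h2] at h
    · exact ⟨h1, h2⟩
    all_goals exfalso; linarith
  have hstraight : ∀ p, α p = Real.pi → S.StraightFor color p := by
    intro p hp
    obtain ⟨h1, h2⟩ := hzero p hp
    constructor
    · refine decide_eq_true ((hveer (S.rot p)).resolve_right fun h => ?_)
      have := h _ (Equiv.Perm.SameCycle.refl _ _) h1
      linarith
    · refine decide_eq_false fun h => ?_
      have := h _ (Equiv.Perm.SameCycle.refl _ _) h2
      rw [S.rot_rot_rot] at this
      linarith
  have hexists : ∀ c, ∃ x, S.SameTriangle c x ∧ α x = Real.pi := by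
    intro c
    by_contra! h
    have h0 := (h01 c).resolve_right (h c (Or.inl rfl))
    have h1 := (h01 _).resolve_right (h _ (Or.inr (Or.inl rfl)))
    have h2 := (h01 _).resolve_right (h _ (Or.inr (Or.inr rfl)))
    have := hsum c
    rw [h0, h1, h2] at this
    linarith
  have hiff : ∀ p, α p = Real.pi ↔ S.StraightFor color p := by
    refine fun p => ⟨hstraight p, fun hp => ?_⟩
    obtain ⟨x, hx, hx'⟩ := hexists p
    have hs := hstraight x hx'
    rcases hx with rfl | rfl | rfl
    · exact hx'
    · exact absurd (hs.1.symm.trans hp.2) Bool.noConfusion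
    · have h := hs.2
      rw [S.rot_rot_rot] at h
      exact absurd (hp.1.symm.trans h) Bool.noConfusion
  have hval : ∀ c, α c = if S.StraightFor color c then Real.pi else 0 := by
    intro c
    split_ifs with h
    · exact (hiff c).2 h
    · exact (h01 c).resolve_right fun h' => h ((hiff c).1 h')
  refine ⟨⟨color, fun c => ?_, fun c => ?_, fun c => ?_⟩, hval⟩
  · simp only [color, Equiv.Perm.sameCycle_apply_left]
  · obtain ⟨x, hx, hx'⟩ := hexists c
    exact ⟨x, hx, hstraight x hx'⟩
  · have h := hvert c
    rw [Finset.sum_congr rfl fun d _ => hval d, ← Finset.sum_filter, Finset.sum_const,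
      nsmul_eq_mul] at h
    -- The angle sum `2π` is made up of angles `π`, so a vertex has exactly two straight corners.
    have hcard := mul_right_cancel₀ hpi.ne' h
    obtain ⟨p, q, hpq, hs⟩ := Finset.card_eq_two.1 (by exact_mod_cast hcard)
    have hmem : ∀ r, (S.vertexRot.SameCycle c r ∧ S.StraightFor color r) ↔ r = p ∨ r = q := by
      intro r
      have := congrArg (r ∈ ·) hs
      simpa using this
    have h1 := (hmem p).2 (Or.inl rfl)
    have h2 := (hmem q).2 (Or.inr rfl)
    exact ⟨p, q, hpq, h1.1, h2.1, h1.2, h2.2, fun r h3 h4 => (hmem r).1 ⟨h3, h4⟩⟩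

end TriangulatedSurface

namespace IdealTriangulation
variable {T : Type*} [Fintype T] [DecidableEq T] {τ : IdealTriangulation T} {θ : T → Fin 3 → ℝ}

theorem IsVeering.turning_eq_zero (hθ : τ.IsVeering θ) (γ : τ.boundary.ClosedNormalPath)
    (hγ : γ.IsEmbedded) (hγ' : γ.homologyClass ≠ 0) : γ.turning (cornerAngle θ) = 0 := by
  obtain ⟨⟨⟨h1, h2⟩, h3⟩, h4⟩ := hθ
  have hsum : ∀ c : Corner T, cornerAngle θ c + cornerAngle θ (τ.boundary.rot c) +
      cornerAngle θ (τ.boundary.rot (τ.boundary.rot c)) = Real.pi := by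
    rintro ⟨t, ⟨⟨v, w⟩, h⟩⟩
    rw [← h1 t, Fin.sum_univ_three]
    change θ t (pairIdx v w) + θ t (pairIdx v (nxt v w)) + θ t (pairIdx v (nxt v (nxt v w))) = _
    rw [pairIdx_nxt _ _ (nxt_ne _ _ h), pairIdx_nxt _ _ h]
    generalize pairIdx v w = j
    fin_cases j <;> simp <;> ring
  obtain ⟨κ, hκ⟩ := TriangulatedSurface.exists_veering (S := τ.boundary) (α := cornerAngle θ)
    (fun c => h3 _ _) hsum (fun c => by convert h2 c) h4
  classical
  rw [show cornerAngle θ = fun c => if κ.Straight c then Real.pi else 0 from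
    funext fun c => by convert hκ c]
  convert κ.turning_eq_zero γ hγ hγ'

end IdealTriangulation

theorem lemma5p3 {T : Type*} [Fintype T] [DecidableEq T] (τ : IdealTriangulation T)
    (θ : T → Fin 3 → ℝ) (hθ : τ.IsVeering θ) :
    τ.IsAngularHolonomy θ 0 ∧
      ∀ θ' : T → Fin 3 → ℝ, τ.TrivialDeformation θ θ' → τ.IsAngularHolonomy θ' 0 := by
  refine ⟨fun γ hγ hγ' => (hθ.turning_eq_zero γ hγ hγ').symm, fun θ' h γ hγ hγ' => ?_⟩
  rw [τ.turning_trivialDeformation θ θ' h]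
  exact (hθ.turning_eq_zero γ hγ hγ').symm
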